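/- **Setting.** Let $M$ be a closed (compact, connected, boundaryless) smooth Riemannian manifold with distance $d$, let $f:M\to M$ be a $C^1$ diffeomorphism and $\phi:M\to\mathbb R$ a continuous function; write $S_n\phi=\sum_{i=0}^{n-1}\phi\circ f^i$. A *foliation* of $M$ is here a continuous foliation with $C^1$ leaves whose tangent spaces depend continuously on the point. For a foliation $\mathcal F$, let $d^{\mathcal F}$ be the distance along leaves induced by the Riemannian metric ($\infty$ for points in different leaves), $W^{\mathcal F}(x,\delta)$ the open $d^{\mathcal F}$-ball, and $W^{\mathcal F}(x,n,\varepsilon)=\{y: d^{\mathcal F}(f^jx,f^jy)<\varepsilon,\ 0\le j<n\}$. A set $E\subset K$ is an $(n,\varepsilon)$ $\mathcal F$-spanning set of $K$ if $K\subset\bigcup_{z\in E}W^{\mathcal F}(z,n,\varepsilon)$. The foliation $\mathcal F$ is *expanding* if it is $f$-invariant and for all $x\in M$, $\delta>0$ there is $N>0$ such that for all $n\ge N$, $\varepsilon>0$ and $E\subset f^nW^{\mathcal F}(x,\delta)$ with $f^nW^{\mathcal F}(x,\delta)\subset\bigcup_{z\in E}W^{\mathcal F}(z,\varepsilon)$,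 the set $f^{-n}E$ is an $(n,\varepsilon)$ $\mathcal F$-spanning set of $W^{\mathcal F}(x,\delta)$. Let $W^u$ and $W^{cs}$ be two foliations, with leaf distances $d^u$, $d^{cs}$. The conditions are: - **(C1)** Either (i) $f$ is partially hyperbolic: there are a $Df$-invariant splitting $TM=E^s\oplus E^c\oplus E^u$ and constants $0<\lambda_1\le\lambda_2<\gamma_1\le1\le\gamma_2<\mu_1\le\mu_2$, $C\ge1$ such that for all $n\ge 0$, $C^{-1}a^n\|v\|\le\|Df^nv\|\le Cb^n\|v\|$ for $v\in E^s,E^c,E^u$ with $(a,b)=(\lambda_1,\lambda_2),(\gamma_1,\gamma_2),(\mu_1,\mu_2)$ respectively; $W^u$ is the unstable foliation (the $f$-invariant foliation tangent to $E^u$), and $W^{cs}$ is a foliation tangent to $E^c\oplus E^s$. Or (ii) $f$ is $C^{1+\alpha}$ for some $\alpha>0$, $W^u$ is an expanding foliation, and the unstable and stable laminations integrate into $W^u$ and $W^{cs}$: for every $f$-invariant Borel probability measure and almost every $x$, the set of points $y$ with $d(f^{-n}x,f^{-n}y)\to0$ exponentially fast as $n\to+\infty$ is contained in the $W^u$-leaf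 of $x$, and the set of points $y$ with $d(f^{n}x,f^{n}y)\to0$ exponentially fast is contained in the $W^{cs}$-leaf of $x$. - **(C2)** There is $r>0$, and for every $\varepsilon>0$ a nondecreasing function $g^\varepsilon:\mathbb N\to(0,\infty)$ with $\frac1n\log g^\varepsilon(n)\to0$, such that for all $n\ge 0$, $y\in M$ and $z\in W^{cs}(y,r)$: if $d^{cs}(y,z)\le\varepsilon g^\varepsilon(n)^{-1}$ then $d^{cs}(f^ny,f^nz)\le\varepsilon$. - **(C3)** For the same functions $g^\varepsilon$: for all $x\in M$ and $\delta,\varepsilon>0$ there is $h:\mathbb N\to\mathbb N$ with $h(n)/n\to0$ such that for all $n\ge 0$ and $y\in M$, $f^{h(n)}\big(\overline{W^u(x,\delta)}\big)\cap W^{cs}\big(y,\varepsilon g^\varepsilon(n)^{-1}\big)\ne\varnothing$. Let $P_{\rm top}(f,\phi)=\lim_{\varepsilon\to0}\limsup_{n}\frac1n\log\inf_E\sum_{z\in E}e^{S_n\phi(z)}$, where $E$ runs over the $(n,\varepsilon)$-spanning sets of $M$ for $d$. For a subset $K$ of a leaf of $W^u$, let $P^u(f,\phi,K)=\lim_{\varepsilon\to0}\limsup_{n}\frac1n\log\inf_E\sum_{z\in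 E}e^{S_n\phi(z)}$, where $E$ runs over the $(n,\varepsilon)$ $W^u$-spanning sets of $K$. Let $P^u_{\rm top}(f,\phi)=\sup_{y\in M}P^u(f,\phi,\overline{W^u(y,\rho)})$, where $\rho>0$ is any fixed radius. Write $\lambda$ for the Riemannian volume on the leaves of $W^u$, $E^u_x$ for the tangent space at $x$ of the leaf of $W^u$ through $x$, and $\Phi^u(x)=-\log|\det(Df|_{E^u_x})|$. **Theorem.** Assume (C1)–(C3). Then for all $x\in M$ and $\delta>0$, both limits below exist and $$P_{\rm top}(f,\phi)=\lim_{n\to\infty}\frac1n\log\int_{f^nW^u(x,\delta)}e^{S_n\phi(f^{-n}y)}\,d\lambda(y)=\lim_{n\to\infty}\frac1n\log\int_{W^u(x,\delta)}e^{S_n(\phi-\Phi^u)(y)}\,d\lambda(y).$$ Moreover, for all $x\in M$ and $\delta>0$ (and whichever radius $\rho>0$ is used to define $P^u_{\rm top}$), $$P_{\rm top}(f,\phi)=P^u_{\rm top}(f,\phi)=P^u\big(f,\phi,\overline{W^u(x,\delta)}\big).$$ -/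

import Mathlib

open Set Filter Topology MeasureTheory Bundle Manifold
open scoped ENNReal ContDiff NNReal

noncomputable section

/-! ### Topological pressure of a map of a metric space -/

/-- `S_d(φ, n, ε)`: the infimum of `∑_{z ∈ E} exp (S_n φ (z))` over the `(n, ε)`-spanning sets `E`,
i.e. the sets whose open Bowen balls of order `n` and radius `ε` cover the space. -/
def spanningSum {X : Type*} [MetricSpace X] (f : X → X) (φ : X → ℝ) (n : ℕ) (ε : ℝ) : ℝ≥0∞ :=
  ⨅ (E : Set X) (_ : ∀ y, ∃ z ∈ E, ∀ j < n, dist (f^[j] z) (f^[j] y) < ε),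
    ∑' z : E, ENNReal.ofReal (Real.exp (birkhoffSum f φ n z))

/-- The topological pressure `lim_{ε → 0} limsup_n (1/n) log S_d(φ, n, ε)`. The inner quantity
increases as `ε` decreases to `0`, so that the limit is the supremum over `ε > 0`. -/
def topPressure {X : Type*} [MetricSpace X] (f : X → X) (φ : X → ℝ) : EReal :=
  ⨆ (ε : ℝ) (_ : 0 < ε),
    limsup (fun n : ℕ => ENNReal.log (spanningSum f φ n ε) / (n : EReal)) atTop

/-! ### Continuous foliations with `C¹` leaves -/

section Foliation

variable {n : ℕ} {M : Type*} [MetricSpace M] [ChartedSpace (EuclideanSpace ℝ (Fin n)) M]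
  [IsManifold (𝓡 n) ∞ M]

/-- `h : ℝᵏ × ℝⁿ⁻ᵏ → M` is (the inverse of) a foliated chart for the partition of `M` into the
classes ("leaves") of `rel`: an open embedding whose plaques `h (ℝᵏ × {t})` are `C¹` immersed,
with tangent spaces depending continuously on the point, each plaque lies in one leaf, and each leaf
meets the chart in at most countably many plaques. -/
structure IsFoliatedChart (k : ℕ) (rel : Setoid M)
    (h : EuclideanSpace ℝ (Fin k) × EuclideanSpace ℝ (Fin (n - k)) → M) : Prop where
  isOpenEmbedding : IsOpenEmbedding h
  contMDiff_plaque : ∀ t, ContMDiff (𝓡 k) (𝓡 n) 1 (fun p => h (p, t))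
  injective_mfderiv : ∀ p t,
    Function.Injective (mfderiv (𝓡 k) (𝓡 n) (fun q => h (q, t)) p)
  continuous_mfderiv : Continuous
    (fun a : EuclideanSpace ℝ (Fin k) × EuclideanSpace ℝ (Fin (n - k)) ×
        EuclideanSpace ℝ (Fin k) =>
      (⟨h (a.1, a.2.1), mfderiv (𝓡 k) (𝓡 n) (fun q => h (q, a.2.1)) a.1 a.2.2⟩ :
        TangentBundle (𝓡 n) M))
  rel_plaque : ∀ p q t, rel (h (p, t)) (h (q, t))
  countable_plaques : ∀ x, {t | ∃ p, rel x (h (p, t))}.Countable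

variable (n) in
/-- A continuous foliation of `M` with `C¹` leaves of dimension `k`: a partition of `M` (into the
classes of `rel`) such that every point lies in a foliated chart and the leaves are
path-connected. Since a leaf meets a foliated chart in countably many plaques, a path of `M` that
stays in a leaf is automatically continuous for the leaf topology. -/
structure Foliation (k : ℕ) (M : Type*) [MetricSpace M]
    [ChartedSpace (EuclideanSpace ℝ (Fin n)) M] [IsManifold (𝓡 n) ∞ M] where
  rel : Setoid M
  exists_chart : ∀ x, ∃ h, IsFoliatedChart (n := n) k rel h ∧ x ∈ range h
  isPathConnected_leaf : ∀ x, IsPathConnected {y | rel x y}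

namespace Foliation

variable {k : ℕ} (F : Foliation n k M)

/-- The leaf through `x`. -/
def leaf (x : M) : Set M := {y | F.rel x y}

/-- The tangent space at `x` of the leaf through `x`: the space of the vectors tangent at `x` to
the plaques of foliated charts. -/
def tangent (x : M) : Submodule ℝ (TangentSpace (𝓡 n) x) :=
  Submodule.span ℝ {v | ∃ h, IsFoliatedChart (n := n) k F.rel h ∧
    ∃ p t w, (⟨h (p, t), mfderiv (𝓡 k) (𝓡 n) (fun q => h (q, t)) p w⟩ :
      TangentBundle (𝓡 n) M) = ⟨x, v⟩}

/-- Invariance of the foliation: `f` maps leaves onto leaves. -/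
def IsInvariant (f : M ≃ₘ^1⟮𝓡 n, 𝓡 n⟯ M) : Prop :=
  ∀ x, f '' F.leaf x = F.leaf (f x)

variable [RiemannianBundle (fun x : M => TangentSpace (𝓡 n) x)]

/-- The distance along leaves: the infimum of the Riemannian lengths of the `C¹` paths from `x` to
`y` inside the leaf of `x`. It is `∞` if `y` is not in the leaf of `x`. -/
def leafEDist (x y : M) : ℝ≥0∞ :=
  ⨅ (γ : Path x y) (_ : ContMDiff (𝓡∂ 1) (𝓡 n) 1 γ) (_ : ∀ s, γ s ∈ F.leaf x),
    ∫⁻ s, ‖mfderiv (𝓡∂ 1) (𝓡 n) γ s 1‖ₑ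

/-- The open ball of radius `δ` in the leaf of `x`. -/
def ball (x : M) (δ : ℝ) : Set M := {y | F.leafEDist x y < ENNReal.ofReal δ}

/-- The Bowen ball in the leaf of `x`, for the metric
`d_m(x, y) = max_{0 ≤ j ≤ m - 1} d(f^j x, f^j y)` along leaves. -/
def bowenBall (f : M → M) (x : M) (m : ℕ) (ε : ℝ) : Set M :=
  {y | ∀ j < m, F.leafEDist (f^[j] x) (f^[j] y) < ENNReal.ofReal ε}

/-- `E` is an `(m, ε)`-spanning subset of `K` along the leaves. -/
def IsSpanning (f : M → M) (m : ℕ) (ε : ℝ) (K E : Set M) : Prop :=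
  E ⊆ K ∧ K ⊆ ⋃ z ∈ E, F.bowenBall f z m ε

/-- The infimum of `∑_{z ∈ E} exp (S_m φ (z))` over the `(m, ε)`-spanning sets `E` of `K`. -/
def spanningSum (f : M → M) (φ : M → ℝ) (K : Set M) (m : ℕ) (ε : ℝ) : ℝ≥0∞ :=
  ⨅ (E : Set M) (_ : F.IsSpanning f m ε K E),
    ∑' z : E, ENNReal.ofReal (Real.exp (birkhoffSum f φ m z))

/-- The pressure along the foliation of a subset `K` of a leaf,
`lim_{ε → 0} limsup_m (1/m) log S(K, m, ε)`; the limit is a supremum by monotonicity in `ε`. -/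
def pressureOn (f : M → M) (φ : M → ℝ) (K : Set M) : EReal :=
  ⨆ (ε : ℝ) (_ : 0 < ε),
    limsup (fun m : ℕ => ENNReal.log (F.spanningSum f φ K m ε) / (m : EReal)) atTop

/-- The pressure along the foliation, computed on closed leaf balls of radius `δ`:
the supremum over `x` of the pressure of the closure of the leaf ball of radius `δ` at `x`. -/
def pressure (f : M → M) (φ : M → ℝ) (δ : ℝ) : EReal :=
  ⨆ x, F.pressureOn f φ (closure (F.ball x δ))

/-- Expanding foliations: `f`-invariant foliations such that for all `x` and `δ > 0` there is
`N > 0` such that for `m ≥ N` and all `ε > 0`, if the `ε`-balls with centers in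
`E ⊆ f^m (W(x, δ))` cover `f^m (W(x, δ))`, then `f^{-m} E` is `(m, ε)`-spanning in `W(x, δ)`. -/
def IsExpanding (f : M ≃ₘ^1⟮𝓡 n, 𝓡 n⟯ M) : Prop :=
  F.IsInvariant f ∧
  ∀ x, ∀ δ > 0, ∃ N > 0, ∀ m ≥ N, ∀ ε > 0, ∀ E ⊆ f^[m] '' F.ball x δ,
    f^[m] '' F.ball x δ ⊆ ⋃ z ∈ E, F.ball z ε →
      F.IsSpanning f m ε (F.ball x δ) (f.symm^[m] '' E)

end Foliation

end Foliation

/-! ### Classes of diffeomorphisms -/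

section Dynamics

variable {n : ℕ} {M : Type*} [MetricSpace M] [ChartedSpace (EuclideanSpace ℝ (Fin n)) M]
  [IsManifold (𝓡 n) ∞ M]

/-- The derivative of `f` is locally Hölder continuous of exponent `α`, in charts. -/
def HasHolderDeriv (f : M → M) (α : ℝ≥0) : Prop :=
  ∀ x, ∃ U ∈ 𝓝 (extChartAt (𝓡 n) x x), ∃ C : ℝ≥0,
    HolderOnWith C α (fderiv ℝ (writtenInExtChartAt (𝓡 n) (𝓡 n) x f)) U

/-- The unstable set of `x`: the points whose backward orbits are exponentially asymptotic to that
of `x`. For almost every point with respect to an invariant probability measure of a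
`C^{1+α}` diffeomorphism, this is its (Pesin) unstable manifold. -/
def unstableSet (f : M ≃ₘ^1⟮𝓡 n, 𝓡 n⟯ M) (x : M) : Set M :=
  {y | ∃ C > 0, ∃ χ > 0, ∀ m : ℕ, dist (f.symm^[m] x) (f.symm^[m] y) ≤ C * Real.exp (-χ * m)}

/-- The stable set of `x`: the points whose forward orbits are exponentially asymptotic to that
of `x`. -/
def stableSet (f : M ≃ₘ^1⟮𝓡 n, 𝓡 n⟯ M) (x : M) : Set M :=
  {y | ∃ C > 0, ∃ χ > 0, ∀ m : ℕ, dist (f^[m] x) (f^[m] y) ≤ C * Real.exp (-χ * m)}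

/-- The family of sets `W x` integrates into the foliation `F`: for every `f`-invariant Borel
probability measure and almost every `x`, the set `W x` lies in the leaf of `x`. -/
def IntegratesInto [MeasurableSpace M] {k : ℕ} (f : M ≃ₘ^1⟮𝓡 n, 𝓡 n⟯ M) (W : M → Set M)
    (F : Foliation n k M) : Prop :=
  ∀ μ : Measure M, IsProbabilityMeasure μ → MeasurePreserving f μ μ →
    ∀ᵐ x ∂μ, W x ⊆ F.leaf x

variable [RiemannianBundle (fun x : M => TangentSpace (𝓡 n) x)]

/-- `f` is partially hyperbolic with invariant splitting `TM = Es ⊕ Ec ⊕ Eu`. -/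
structure IsPartiallyHyperbolic (f : M ≃ₘ^1⟮𝓡 n, 𝓡 n⟯ M)
    (Es Ec Eu : ∀ x : M, Submodule ℝ (TangentSpace (𝓡 n) x)) : Prop where
  disjoint : ∀ x, Disjoint (Es x) (Ec x)
  isCompl : ∀ x, IsCompl (Es x ⊔ Ec x) (Eu x)
  map_s : ∀ x, (Es x).map (mfderiv (𝓡 n) (𝓡 n) f x).toLinearMap = Es (f x)
  map_c : ∀ x, (Ec x).map (mfderiv (𝓡 n) (𝓡 n) f x).toLinearMap = Ec (f x)
  map_u : ∀ x, (Eu x).map (mfderiv (𝓡 n) (𝓡 n) f x).toLinearMap = Eu (f x)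
  exists_rates : ∃ lam₁ lam₂ γ₁ γ₂ μ₁ μ₂ C : ℝ,
    0 < lam₁ ∧ lam₁ ≤ lam₂ ∧ lam₂ < γ₁ ∧ γ₁ ≤ 1 ∧ 1 ≤ γ₂ ∧ γ₂ < μ₁ ∧ μ₁ ≤ μ₂ ∧ 1 ≤ C ∧
    (∀ x, ∀ v ∈ Es x, ∀ m : ℕ,
      C⁻¹ * lam₁ ^ m * ‖v‖ ≤ ‖mfderiv (𝓡 n) (𝓡 n) f^[m] x v‖ ∧
      ‖mfderiv (𝓡 n) (𝓡 n) f^[m] x v‖ ≤ C * lam₂ ^ m * ‖v‖) ∧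
    (∀ x, ∀ v ∈ Ec x, ∀ m : ℕ,
      C⁻¹ * γ₁ ^ m * ‖v‖ ≤ ‖mfderiv (𝓡 n) (𝓡 n) f^[m] x v‖ ∧
      ‖mfderiv (𝓡 n) (𝓡 n) f^[m] x v‖ ≤ C * γ₂ ^ m * ‖v‖) ∧
    (∀ x, ∀ v ∈ Eu x, ∀ m : ℕ,
      C⁻¹ * μ₁ ^ m * ‖v‖ ≤ ‖mfderiv (𝓡 n) (𝓡 n) f^[m] x v‖ ∧
      ‖mfderiv (𝓡 n) (𝓡 n) f^[m] x v‖ ≤ C * μ₂ ^ m * ‖v‖)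

/-- Condition (C1). Either `f` is a (`C¹`) partially hyperbolic diffeomorphism, `Wu` is its
unstable foliation (the invariant foliation tangent to `E^u`) and `Wcs` is a foliation tangent to
`E^c ⊕ E^s`; or `f` is `C^{1+α}`, its unstable lamination integrates into the expanding foliation
`Wu` and its stable lamination integrates into the foliation `Wcs`. -/
def ConditionC1 [MeasurableSpace M] {k l : ℕ} (f : M ≃ₘ^1⟮𝓡 n, 𝓡 n⟯ M)
    (Wu : Foliation n k M) (Wcs : Foliation n l M) : Prop :=
  (∃ Es Ec Eu : ∀ x : M, Submodule ℝ (TangentSpace (𝓡 n) x),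
    IsPartiallyHyperbolic f Es Ec Eu ∧
    Wu.IsInvariant f ∧ (∀ x, Wu.tangent x = Eu x) ∧ (∀ x, Wcs.tangent x = Ec x ⊔ Es x)) ∨
  ((∃ α : ℝ≥0, 0 < α ∧ HasHolderDeriv (n := n) f α) ∧
    Wu.IsExpanding f ∧ IntegratesInto f (unstableSet f) Wu ∧ IntegratesInto f (stableSet f) Wcs)

/-- Condition (C2), with `g ε` the function `g^ε` for `ε > 0`. The local leaves of `Wcs` are the
leaf balls of some fixed radius `r > 0`. -/
def ConditionC2 {l : ℕ} (f : M ≃ₘ^1⟮𝓡 n, 𝓡 n⟯ M) (Wcs : Foliation n l M)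
    (g : ℝ → ℕ → ℝ) : Prop :=
  ∃ r > 0, ∀ ε > 0, (∀ m, 0 < g ε m) ∧ Monotone (g ε) ∧
    Tendsto (fun m : ℕ => Real.log (g ε m) / m) atTop (𝓝 0) ∧
    ∀ (m : ℕ) (y : M), ∀ z ∈ Wcs.ball y r,
      Wcs.leafEDist y z ≤ ENNReal.ofReal (ε * (g ε m)⁻¹) →
      Wcs.leafEDist (f^[m] y) (f^[m] z) ≤ ENNReal.ofReal ε

/-- Condition (C3), with respect to the functions `g^ε` of (C2). -/
def ConditionC3 {k l : ℕ} (f : M ≃ₘ^1⟮𝓡 n, 𝓡 n⟯ M) (Wu : Foliation n k M)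
    (Wcs : Foliation n l M) (g : ℝ → ℕ → ℝ) : Prop :=
  ∀ x, ∀ δ > 0, ∀ ε > 0, ∃ h : ℕ → ℕ,
    Tendsto (fun m : ℕ => (h m : ℝ) / m) atTop (𝓝 0) ∧
    ∀ (m : ℕ) (y : M),
      (f^[h m] '' closure (Wu.ball x δ) ∩ Wcs.ball y (ε * (g ε m)⁻¹)).Nonempty

/-- `|det (Df_x|V)|` for a subspace `V` of `T_x M`: the square root of the determinant of `A* A`,
where `A : V → T_{f x} M` is the restriction of `Df_x`. The adjoint is taken for the Riemannian
inner products, through the Gram matrix in an orthonormal basis of `V`. -/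
def absDetOn (f : M → M) (x : M) (V : Submodule ℝ (TangentSpace (𝓡 n) x)) : ℝ :=
  haveI : FiniteDimensional ℝ (TangentSpace (𝓡 n) x) :=
    inferInstanceAs (FiniteDimensional ℝ (EuclideanSpace ℝ (Fin n)))
  Real.sqrt (Matrix.det (Matrix.of fun i j : Fin (Module.finrank ℝ V) =>
    inner ℝ (mfderiv (𝓡 n) (𝓡 n) f x (stdOrthonormalBasis ℝ V i : TangentSpace (𝓡 n) x))
      (mfderiv (𝓡 n) (𝓡 n) f x (stdOrthonormalBasis ℝ V j : TangentSpace (𝓡 n) x))))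

/-- `Φ^u(x) = - log |det (Df|E^u_x)|`, where `E^u_x` is the tangent space of the foliation. -/
def geometricPotential {k : ℕ} (f : M → M) (Wu : Foliation n k M) (x : M) : ℝ :=
  -Real.log (absDetOn f x (Wu.tangent x))

end Dynamics

end

/-!
# Topological pressure and the volume growth of unstable leaves

Let `P` be the topological pressure. Everything is compared with the pressure computed on one leaf
ball `W(x, δ)` of the foliation `Wu`, by four mechanisms.

* *Upper bound on leaves* (`Foliation.IsInvariant.eventually_spanningSum_le`). A leaf ball is a
  finite union of small leaf balls, and two points of the same small leaf ball which are close for the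
  Bowen metric of `M` are close for the Bowen metric of the leaf: at small leaf distance the leaf
  distance is comparable to the distance of `M`, uniformly, so that closeness propagates in time.
* *Lower bound on leaves* (`Foliation.eventually_le_coverSum`). By (C3) and (C2) every orbit of length
  `m` is shadowed by the orbit of a point of `f^h (W(x, δ))`, with `h` negligible with respect to
  `m`. Thus a cover of `W(x, δ)` by Bowen balls of order `m + h` yields a spanning set of `M` of
  order `m`. As `P` is a priori only an upper limit, it matters that it is also the lower growth
  rate of the spanning sums (`exists_le_spanningSum`, by submultiplicativity of sums over covers).
* *Weighted volumes* (`Foliation.tendsto_log_lintegral_image`). The integral over `f^m (W(x, δ))` is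
  bounded above by a spanning sum, since the image under `f^m` of a Bowen ball of order `m` is
  contained in a leaf ball of fixed radius. It is bounded below by the sum over a maximal separated
  subset of `f^m (W(x, δ/2))`, since small leaf balls have volume bounded below and their preimages
  under `f^j`, `j ≤ m`, remain small (`Foliation.IsInvariant.leafEDist_symm_iterate_lt`): one may
  choose in each small leaf ball a point at which the weight is almost minimal, so that no
  distortion estimate is needed.
* *Change of variables* (`Foliation.IsInvariant.lintegral_image_comparable`). To first order
  `f^m` multiplies leaf volumes by `exp (- S_m Φᵘ)`, so that the two integrals are within a constant
  factor of each other, uniformly in `m`.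

The only use of (C1) is that the derivatives of the backward iterates `f^{-j}`, `j ≤ m`, are bounded
on the tangent spaces of `f^m (W(x, δ))`, uniformly in `m`
(`ConditionC1.exists_norm_mfderiv_symm_le`). In the partially hyperbolic case this is part of the
definition. For an expanding foliation one applies the definition to the
complement of a thin slab: if `D f^{-j}` expanded a vector tangent at `z`, then the set
`f^m (W(x, δ))` deprived of the points whose `f^{-j}` images are within about `ε` of `f^{-j} z`, in
the direction of the image vector, would still be an `ε`-net although none of its points has an
`f^{-j}` image `ε`-close to `f^{-j} z`.

The geometric input is that plaques of a foliated chart may be used with uniform constants over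
the compact manifold (`Foliation.exists_uniformPlaque`): on a plaque, coordinates, the distance of
`M` and the leaf distance are Lipschitz equivalent, and a leaf ball of fixed radius is contained in
a single plaque, because a path inside a leaf cannot jump between the countably many plaques of this
leaf.
-/

/-! ### Exponential growth of sequences -/

lemma log_div_le_iff {a : ℝ≥0∞} {c : ℝ} {m : ℕ} (hm : 0 < m) :
    ENNReal.log a / (m : EReal) ≤ (c : EReal) ↔ a ≤ ENNReal.ofReal (Real.exp (c * m)) := by
  rw [EReal.div_le_iff_le_mul (by exact_mod_cast hm) (EReal.natCast_ne_top m),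
    ← ENNReal.log_le_log_iff, ENNReal.log_ofReal_of_pos (Real.exp_pos _), Real.log_exp, mul_comm c]
  push_cast
  rfl

lemma le_log_div_iff {a : ℝ≥0∞} {c : ℝ} {m : ℕ} (hm : 0 < m) :
    (c : EReal) ≤ ENNReal.log a / (m : EReal) ↔ ENNReal.ofReal (Real.exp (c * m)) ≤ a := by
  rw [EReal.le_div_iff_mul_le (by exact_mod_cast hm) (EReal.natCast_ne_top m),
    ← ENNReal.log_le_log_iff, ENNReal.log_ofReal_of_pos (Real.exp_pos _), Real.log_exp]
  push_cast
  rfl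

lemma limsup_log_div_le {a : ℕ → ℝ≥0∞} {c : ℝ}
    (h : ∀ᶠ m : ℕ in atTop, a m ≤ ENNReal.ofReal (Real.exp (c * m))) :
    limsup (fun m : ℕ => ENNReal.log (a m) / (m : EReal)) atTop ≤ c := by
  refine limsup_le_of_le (by isBoundedDefault) ?_
  filter_upwards [h, eventually_gt_atTop 0] with m hm h0
  exact (log_div_le_iff h0).2 hm

lemma eventually_le_of_limsup_lt {a : ℕ → ℝ≥0∞} {c : ℝ}
    (h : limsup (fun m : ℕ => ENNReal.log (a m) / (m : EReal)) atTop < c) :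
    ∀ᶠ m : ℕ in atTop, a m ≤ ENNReal.ofReal (Real.exp (c * m)) := by
  filter_upwards [eventually_lt_of_limsup_lt h, eventually_gt_atTop 0] with m hm h0
  exact (log_div_le_iff h0).1 hm.le

lemma le_limsup_log_div {a : ℕ → ℝ≥0∞} {c : ℝ}
    (h : ∀ᶠ m : ℕ in atTop, ENNReal.ofReal (Real.exp (c * m)) ≤ a m) :
    (c : EReal) ≤ limsup (fun m : ℕ => ENNReal.log (a m) / (m : EReal)) atTop := by
  refine le_limsup_of_frequently_le (Eventually.frequently ?_)
  filter_upwards [h, eventually_gt_atTop 0] with m hm h0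
  exact (le_log_div_iff h0).2 hm

lemma tendsto_log_div {a : ℕ → ℝ≥0∞} {P : EReal}
    (hu : ∀ c : ℝ, P < c → ∀ᶠ m : ℕ in atTop, a m ≤ ENNReal.ofReal (Real.exp (c * m)))
    (hl : ∀ c : ℝ, c < P → ∀ᶠ m : ℕ in atTop, ENNReal.ofReal (Real.exp (c * m)) ≤ a m) :
    Tendsto (fun m : ℕ => ENNReal.log (a m) / (m : EReal)) atTop (𝓝 P) := by
  refine tendsto_order.2 ⟨fun b hb => ?_, fun b hb => ?_⟩
  · obtain ⟨c, hbc, hcP⟩ := EReal.lt_iff_exists_real_btwn.1 hb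
    filter_upwards [hl c hcP, eventually_gt_atTop 0] with m hm h0
    exact hbc.trans_le ((le_log_div_iff h0).2 hm)
  · obtain ⟨c, hbc, hcP⟩ := EReal.lt_iff_exists_real_btwn.1 hb
    filter_upwards [hu c hbc, eventually_gt_atTop 0] with m hm h0
    exact ((log_div_le_iff h0).2 hm).trans_lt hcP

/-- Subexponential factors do not change exponential upper bounds. -/
lemma eventually_le_of_le_mul {a b : ℕ → ℝ≥0∞} {c c' D : ℝ} (hc : c < c')
    (hb : ∀ᶠ m : ℕ in atTop, b m ≤ ENNReal.ofReal (Real.exp (c * m)))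
    (hab : ∀ᶠ m : ℕ in atTop, a m ≤ ENNReal.ofReal D * b m) :
    ∀ᶠ m : ℕ in atTop, a m ≤ ENNReal.ofReal (Real.exp (c' * m)) := by
  have h1 : ∀ᶠ m : ℕ in atTop, D ≤ Real.exp ((c' - c) * m) := by
    refine Tendsto.eventually_ge_atTop ?_ D
    exact Real.tendsto_exp_atTop.comp
      (tendsto_natCast_atTop_atTop.const_mul_atTop (sub_pos.2 hc))
  filter_upwards [hb, hab, h1] with m hb ha h1
  calc a m ≤ ENNReal.ofReal D * b m := ha
    _ ≤ ENNReal.ofReal (Real.exp ((c' - c) * m)) * ENNReal.ofReal (Real.exp (c * m)) := by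
        gcongr
    _ = ENNReal.ofReal (Real.exp (c' * m)) := by
        rw [← ENNReal.ofReal_mul (Real.exp_pos _).le, ← Real.exp_add]
        ring_nf

lemma tsum_range_le {α ι : Type*} (g : ι → α) (ψ : α → ℝ≥0∞) :
    ∑' z : range g, ψ z ≤ ∑' i, ψ (g i) :=
  ENNReal.tsum_le_tsum_comp_of_surjective (f := rangeFactorization g)
    rangeFactorization_surjective (fun z : range g => ψ z)

/-- A set over which a function bounded below by a positive constant has a finite sum is
countable. -/
lemma countable_of_tsum_ne_top {α : Type*} {E : Set α} {ψ : α → ℝ≥0∞} (hψ : ∀ x, ψ x ≠ 0)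
    (h : ∑' z : E, ψ z ≠ ⊤) : E.Countable := by
  have := Summable.countable_support_ennreal h
  rw [Function.support_eq_univ (fun z : E => hψ z)] at this
  exact countable_coe_iff.1 (countable_univ_iff.1 this)

lemma ofReal_exp_ne_zero (t : ℝ) : ENNReal.ofReal (Real.exp t) ≠ 0 := by
  simpa using Real.exp_pos t

lemma ofReal_exp_add (s t : ℝ) : ENNReal.ofReal (Real.exp (s + t)) =
    ENNReal.ofReal (Real.exp s) * ENNReal.ofReal (Real.exp t) := by
  rw [Real.exp_add, ENNReal.ofReal_mul (Real.exp_pos _).le]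

lemma ofReal_exp_le {s t : ℝ} (h : s ≤ t) :
    ENNReal.ofReal (Real.exp s) ≤ ENNReal.ofReal (Real.exp t) :=
  ENNReal.ofReal_le_ofReal (Real.exp_le_exp.2 h)

/-! ### Birkhoff sums -/

lemma abs_birkhoffSum_le {X : Type*} {f : X → X} {φ : X → ℝ} {B : ℝ} (hB : ∀ x, |φ x| ≤ B)
    (m : ℕ) (x : X) : |birkhoffSum f φ m x| ≤ m * B := by
  calc |birkhoffSum f φ m x| ≤ ∑ i ∈ Finset.range m, |φ (f^[i] x)| :=
        Finset.abs_sum_le_sum_abs _ _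
    _ ≤ ∑ _i ∈ Finset.range m, B := Finset.sum_le_sum fun i _ => hB _
    _ = m * B := by simp

lemma birkhoffSum_le_add {X : Type*} {f : X → X} {φ : X → ℝ} {τ : ℝ} {m : ℕ} {x y : X}
    (h : ∀ j < m, φ (f^[j] x) ≤ φ (f^[j] y) + τ) :
    birkhoffSum f φ m x ≤ birkhoffSum f φ m y + τ * m := by
  calc birkhoffSum f φ m x ≤ ∑ j ∈ Finset.range m, (φ (f^[j] y) + τ) :=
        Finset.sum_le_sum fun j hj => h j (Finset.mem_range.1 hj)
    _ = birkhoffSum f φ m y + τ * m := by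
        rw [Finset.sum_add_distrib]; simp [birkhoffSum, mul_comm]

lemma birkhoffSum_add_le {X : Type*} {f : X → X} {φ : X → ℝ} {B : ℝ} (hB : ∀ x, |φ x| ≤ B)
    (m i : ℕ) (x : X) : birkhoffSum f φ m x ≤ birkhoffSum f φ (m + i) x + i * B := by
  rw [birkhoffSum_add]
  have := (abs_le.1 (abs_birkhoffSum_le (f := f) hB i (f^[m] x))).1
  linarith

lemma birkhoffSum_iterate_le {X : Type*} {f : X → X} {φ : X → ℝ} {B : ℝ} (hB : ∀ x, |φ x| ≤ B)
    (m i : ℕ) (x : X) : birkhoffSum f φ m (f^[i] x) ≤ birkhoffSum f φ (m + i) x + i * B := by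
  rw [add_comm m i, birkhoffSum_add]
  have := (abs_le.1 (abs_birkhoffSum_le (f := f) hB i x)).1
  linarith

lemma exists_abs_le_of_continuous {X : Type*} [TopologicalSpace X] [CompactSpace X] {φ : X → ℝ}
    (hφ : Continuous φ) : ∃ B, 0 ≤ B ∧ ∀ x, |φ x| ≤ B := by
  obtain ⟨B, hB⟩ := isCompact_univ.exists_bound_of_continuousOn hφ.continuousOn
  exact ⟨max B 0, le_max_right _ _, fun x => (hB x (mem_univ x)).trans (le_max_left _ _)⟩

lemma exists_modulus {X : Type*} [MetricSpace X] [CompactSpace X] {φ : X → ℝ}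
    (hφ : Continuous φ) {τ : ℝ} (hτ : 0 < τ) :
    ∃ ε > 0, ∀ x y, dist x y < ε → φ x ≤ φ y + τ := by
  obtain ⟨ε, hε, h⟩ := Metric.uniformContinuous_iff.1
    (CompactSpace.uniformContinuous_of_continuous hφ) τ hτ
  refine ⟨ε, hε, fun x y hxy => ?_⟩
  have := (abs_lt.1 (h hxy)).2
  linarith

/-! ### Topological pressure as a limit -/

section Pressure

variable {X : Type*} [MetricSpace X]

/-- There is a countable cover `(A_i)` of the space by sets of diameter less than `ε` for the Bowen
metric of order `m`, with `∑_i sup_{A_i} exp (S_m φ) ≤ s`. Contrary to spanning sums, the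
admissible `s` are submultiplicative in `m`. -/
def HasCoverSum (f : X → X) (φ : X → ℝ) (ε : ℝ) (m : ℕ) (s : ℝ≥0∞) : Prop :=
  ∃ A : ℕ → Set X, (∀ y, ∃ i, y ∈ A i) ∧
    (∀ i, ∀ y ∈ A i, ∀ z ∈ A i, ∀ j < m, dist (f^[j] y) (f^[j] z) < ε) ∧
    ∑' i, ⨆ y ∈ A i, ENNReal.ofReal (Real.exp (birkhoffSum f φ m y)) ≤ s

variable {f : X → X} {φ : X → ℝ} {ε : ℝ}

lemma HasCoverSum.mono {m : ℕ} {s t : ℝ≥0∞} (h : HasCoverSum f φ ε m s) (hst : s ≤ t) :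
    HasCoverSum f φ ε m t := by
  obtain ⟨A, h1, h2, h3⟩ := h
  exact ⟨A, h1, h2, h3.trans hst⟩

lemma HasCoverSum.mul {m p : ℕ} {s t : ℝ≥0∞} (hm : HasCoverSum f φ ε m s)
    (hp : HasCoverSum f φ ε p t) : HasCoverSum f φ ε (m + p) (s * t) := by
  obtain ⟨A, hA1, hA2, hA⟩ := hm
  obtain ⟨A', hA1', hA2', hA'⟩ := hp
  let e : ℕ ≃ ℕ × ℕ := Nat.pairEquiv.symm
  refine ⟨fun i => A (e i).1 ∩ f^[m] ⁻¹' A' (e i).2, ?_, ?_, ?_⟩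
  · intro y
    obtain ⟨i, hi⟩ := hA1 y
    obtain ⟨i', hi'⟩ := hA1' (f^[m] y)
    exact ⟨e.symm (i, i'), by simpa using ⟨hi, hi'⟩⟩
  · rintro i y ⟨hy, hy'⟩ z ⟨hz, hz'⟩ j hj
    by_cases hjm : j < m
    · exact hA2 _ y hy z hz j hjm
    · have := hA2' _ _ hy' _ hz' (j - m) (by omega)
      rwa [← Function.iterate_add_apply, ← Function.iterate_add_apply,
        Nat.sub_add_cancel (not_lt.1 hjm)] at this
  · refine le_trans ?_ (mul_le_mul' hA hA')
    rw [← ENNReal.tsum_mul_right]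
    simp_rw [← ENNReal.tsum_mul_left]
    rw [← ENNReal.tsum_prod, ← Equiv.tsum_eq e]
    refine ENNReal.tsum_le_tsum fun i => iSup₂_le fun y hy => ?_
    rw [birkhoffSum_add, ofReal_exp_add]
    exact mul_le_mul' (le_iSup₂_of_le y hy.1 le_rfl) (le_iSup₂_of_le _ hy.2 le_rfl)

lemma hasCoverSum_zero : HasCoverSum f φ ε 0 1 := by
  refine ⟨fun i => if i = 0 then univ else ∅, fun y => ⟨0, by simp⟩, by simp, ?_⟩
  rw [tsum_eq_single 0 (fun i hi => by simp [hi])]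
  simp [birkhoffSum_zero]

lemma HasCoverSum.pow {m : ℕ} {s : ℝ≥0∞} (hm : HasCoverSum f φ ε m s) (q : ℕ) :
    HasCoverSum f φ ε (q * m) (s ^ q) := by
  induction q with
  | zero => simpa using hasCoverSum_zero
  | succ q ih => simpa [Nat.succ_mul, pow_succ] using ih.mul hm

lemma HasCoverSum.spanningSum_le {m : ℕ} {s : ℝ≥0∞} (h : HasCoverSum f φ ε m s) :
    spanningSum f φ m ε ≤ s := by
  obtain ⟨A, hA1, hA2, hA⟩ := h
  refine le_trans ?_ hA
  let g : {i | (A i).Nonempty} → X := fun i => i.2.some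
  have hg : ∀ i : {i | (A i).Nonempty}, g i ∈ A i := fun i => i.2.some_mem
  refine (iInf₂_le (range g) fun y => ?_).trans ?_
  · obtain ⟨i, hi⟩ := hA1 y
    exact ⟨g ⟨i, y, hi⟩, mem_range_self _, fun j hj => hA2 i _ (hg ⟨i, y, hi⟩) _ hi j hj⟩
  · refine (tsum_range_le g fun z => ENNReal.ofReal (Real.exp (birkhoffSum f φ m z))).trans ?_
    refine le_trans (ENNReal.tsum_le_tsum fun i => ?_) (ENNReal.tsum_comp_le_tsum_of_injective
      Subtype.val_injective _)
    exact le_iSup₂_of_le (g i) (hg i) le_rfl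

lemma hasCoverSum_of_spanningSum_lt {m : ℕ} {s : ℝ≥0∞} {ε' τ : ℝ} (hε : 2 * ε' ≤ ε)
    (hτ : ∀ x y, dist x y < ε' → φ x ≤ φ y + τ)
    (h : spanningSum f φ m ε' < s) :
    HasCoverSum f φ ε m (ENNReal.ofReal (Real.exp (τ * m)) * s) := by
  simp only [spanningSum, iInf_lt_iff] at h
  obtain ⟨E, hE, hs⟩ := h
  have hcount : E.Countable := countable_of_tsum_ne_top
    (ψ := fun z => ENNReal.ofReal (Real.exp (birkhoffSum f φ m z)))
    (fun x => ofReal_exp_ne_zero _) hs.ne_top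
  have := hcount.toEncodable
  let b : E → Set X := fun z => {y | ∀ j < m, dist (f^[j] z) (f^[j] y) < ε'}
  refine ⟨fun i => ⋃ z ∈ Encodable.decode₂ E i, b z, fun y => ?_, fun i y hy z hz j hj => ?_, ?_⟩
  · obtain ⟨z, hz, h⟩ := hE y
    refine ⟨Encodable.encode (⟨z, hz⟩ : E), mem_iUnion₂.2 ⟨⟨z, hz⟩, ?_, h⟩⟩
    simp [Encodable.decode₂_encode]
  · obtain ⟨w, hw, hy⟩ := mem_iUnion₂.1 hy
    obtain ⟨w', hw', hz⟩ := mem_iUnion₂.1 hz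
    obtain rfl : w = w' := by
      rw [Option.mem_def] at hw hw'
      rw [hw] at hw'
      exact Option.some.inj hw'
    have h1 := hy j hj
    have h2 := hz j hj
    have := dist_triangle_left (f^[j] y) (f^[j] z) (f^[j] w)
    linarith
  · rw [tsum_iUnion_decode₂ (fun A : Set X => ⨆ y ∈ A, ENNReal.ofReal
      (Real.exp (birkhoffSum f φ m y))) (by simp)]
    refine le_trans ?_ (mul_le_mul_right hs.le _)
    rw [← ENNReal.tsum_mul_left]
    refine ENNReal.tsum_le_tsum fun z => iSup₂_le fun y hy => ?_
    rw [← ofReal_exp_add, add_comm]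
    refine ofReal_exp_le (birkhoffSum_le_add fun j hj => hτ _ _ ?_)
    rw [dist_comm]
    exact hy j hj

lemma exists_hasCoverSum_one [CompactSpace X] (hφ : Continuous φ) (hε : 0 < ε) :
    ∃ s : ℝ, 0 < s ∧ HasCoverSum f φ ε 1 (ENNReal.ofReal s) := by
  obtain ⟨B, hB0, hB⟩ := exists_abs_le_of_continuous hφ
  have hτ : ∀ x y : X, dist x y < ε / 2 → φ x ≤ φ y + 2 * B := fun x y _ => by
    have h1 := (abs_le.1 (hB x)).2
    have h2 := (abs_le.1 (hB y)).1
    linarith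
  obtain ⟨E, -, hE, hcov⟩ := finite_cover_balls_of_compact (isCompact_univ (X := X)) (half_pos hε)
  have hfin : spanningSum f φ 1 (ε / 2) < ⊤ := by
    refine lt_of_le_of_lt (iInf₂_le E fun y => ?_) ?_
    · obtain ⟨z, hz, hy⟩ := mem_iUnion₂.1 (hcov (mem_univ y))
      refine ⟨z, hz, fun j hj => ?_⟩
      obtain rfl : j = 0 := by omega
      rw [dist_comm]
      exact hy
    · have := hE.fintype
      rw [tsum_fintype]
      exact ENNReal.sum_lt_top.2 fun z _ => ENNReal.ofReal_lt_top
  obtain ⟨s, hs⟩ := ENNReal.lt_iff_exists_nnreal_btwn.1 hfin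
  have := hasCoverSum_of_spanningSum_lt (ε := ε) (by linarith) hτ hs.1
  refine ⟨Real.exp (2 * B * (1 : ℕ)) * s + 1, by positivity, this.mono ?_⟩
  rw [← ENNReal.ofReal_coe_nnreal, ← ENNReal.ofReal_mul (Real.exp_pos _).le]
  exact ENNReal.ofReal_le_ofReal (by linarith)

lemma HasCoverSum.exists_bound [CompactSpace X] (hφ : Continuous φ) (hε : 0 < ε) {c : ℝ} {p : ℕ}
    (hp : 0 < p) (h : HasCoverSum f φ ε p (ENNReal.ofReal (Real.exp (c * p)))) :
    ∃ D : ℝ, ∀ m : ℕ, spanningSum f φ m ε ≤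
      ENNReal.ofReal D * ENNReal.ofReal (Real.exp (c * m)) := by
  obtain ⟨s, hs0, hs⟩ := exists_hasCoverSum_one (f := f) hφ hε
  refine ⟨∑ r ∈ Finset.range p, s ^ r * Real.exp (-(c * r)), fun m => ?_⟩
  have h1 := (h.pow (m / p)).mul (hs.pow (m % p))
  rw [mul_one, Nat.div_add_mod'] at h1
  refine h1.spanningSum_le.trans ?_
  rw [← ENNReal.ofReal_pow (Real.exp_pos _).le, ← ENNReal.ofReal_pow hs0.le,
    ← ENNReal.ofReal_mul (by positivity), ← ENNReal.ofReal_mul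
    (Finset.sum_nonneg fun r _ => by positivity)]
  refine ENNReal.ofReal_le_ofReal ?_
  have h2 : s ^ (m % p) * Real.exp (-(c * (m % p : ℕ))) ≤
      ∑ r ∈ Finset.range p, s ^ r * Real.exp (-(c * r)) :=
    Finset.single_le_sum (f := fun r : ℕ => s ^ r * Real.exp (-(c * r)))
      (fun r _ => by positivity) (Finset.mem_range.2 (Nat.mod_lt _ hp))
  refine le_trans (le_of_eq ?_) (mul_le_mul_of_nonneg_right h2 (Real.exp_pos _).le)
  have h3 : (m : ℝ) = (m / p : ℕ) * p + (m % p : ℕ) := by exact_mod_cast (Nat.div_add_mod' m p).symm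
  have h4 : Real.exp (c * p) ^ (m / p) = Real.exp (-(c * (m % p : ℕ))) * Real.exp (c * m) := by
    rw [← Real.exp_add, ← Real.exp_nat_mul]
    congr 1
    rw [h3]
    ring
  rw [h4]
  ring

lemma spanningSum_anti {m : ℕ} {ε ε' : ℝ} (h : ε ≤ ε') :
    spanningSum f φ m ε' ≤ spanningSum f φ m ε :=
  le_iInf₂ fun E hE => iInf₂_le E fun y => by
    obtain ⟨z, hz, h'⟩ := hE y
    exact ⟨z, hz, fun j hj => (h' j hj).trans_le h⟩

/-- The pressure is also the limit of the lower growth rates of the spanning sums. -/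
lemma exists_le_spanningSum [CompactSpace X] (hφ : Continuous φ) {c : ℝ}
    (hc : c < topPressure f φ) :
    ∃ ε > 0, ∀ᶠ m : ℕ in atTop, ENNReal.ofReal (Real.exp (c * m)) ≤ spanningSum f φ m ε := by
  obtain ⟨c₂, hc₂, hcP⟩ := EReal.lt_iff_exists_real_btwn.1 hc
  obtain ⟨c₁, hc₁, hc₁₂⟩ := exists_between (EReal.coe_lt_coe_iff.1 hc₂)
  simp only [topPressure, lt_iSup_iff] at hcP
  obtain ⟨ε, hε, hlim⟩ := hcP
  have hno : ∀ m : ℕ, 0 < m → ¬ HasCoverSum f φ ε m (ENNReal.ofReal (Real.exp (c₁ * m))) := by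
    intro m hm h
    obtain ⟨D, hD⟩ := h.exists_bound hφ hε hm
    exact hlim.not_ge (limsup_log_div_le (eventually_le_of_le_mul hc₁₂
      (Eventually.of_forall fun m => le_rfl) (Eventually.of_forall hD)))
  obtain ⟨ε', hε', hmod⟩ := exists_modulus hφ (sub_pos.2 hc₁)
  refine ⟨min ε' (ε / 2), lt_min hε' (half_pos hε), ?_⟩
  filter_upwards [eventually_gt_atTop 0] with m hm
  by_contra! hlt
  refine hno m hm ((hasCoverSum_of_spanningSum_lt (ε := ε) ?_ (fun x y hxy =>
    hmod x y (hxy.trans_le (min_le_left _ _))) hlt).mono ?_)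
  · have := min_le_right ε' (ε / 2)
    linarith
  · rw [← ofReal_exp_add]
    exact ofReal_exp_le (by ring_nf; rfl)

lemma eventually_spanningSum_le {c : ℝ} (hc : topPressure f φ < c) (hε : 0 < ε) :
    ∀ᶠ m : ℕ in atTop, spanningSum f φ m ε ≤ ENNReal.ofReal (Real.exp (c * m)) :=
  eventually_le_of_limsup_lt (lt_of_le_of_lt (le_iSup₂_of_le ε hε le_rfl) hc)

end Pressure

/-! ### Hausdorff measure under almost isometric maps -/

section Hausdorff

variable {X Y : Type*} [MetricSpace X] [MetricSpace Y] [MeasurableSpace X] [BorelSpace X]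
  [MeasurableSpace Y] [BorelSpace Y]

lemma LipschitzOnWith.euclideanHausdorffMeasure_image_le {K : ℝ≥0} {g : X → Y} {s : Set X}
    (hg : LipschitzOnWith K g s) (d : ℕ) :
    μHE[d] (g '' s) ≤ (K : ℝ≥0∞) ^ (d : ℝ) * μHE[d] s := by
  simp only [Measure.euclideanHausdorffMeasure_def, Measure.smul_apply, ENNReal.smul_def,
    smul_eq_mul]
  rw [mul_left_comm]
  gcongr
  exact hg.hausdorffMeasure_image_le (Nat.cast_nonneg d)

/-- If `H` distorts the distances of `S` by a factor at most `b` with respect to an injective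
linear map `A`, the measure of `H '' S` is within `b ^ k` of that of `A '' S`. -/
lemma euclideanHausdorffMeasure_image_of_dist_le {k : ℕ} {V : Type*} [NormedAddCommGroup V]
    [InnerProductSpace ℝ V] {A : EuclideanSpace ℝ (Fin k) →ₗ[ℝ] V} (hA : Function.Injective A)
    {H : EuclideanSpace ℝ (Fin k) → X} {S : Set (EuclideanSpace ℝ (Fin k))} {b : ℝ≥0}
    (h1 : ∀ p ∈ S, ∀ q ∈ S, ‖A (p - q)‖ ≤ b * dist (H p) (H q))
    (h2 : ∀ p ∈ S, ∀ q ∈ S, dist (H p) (H q) ≤ b * ‖A (p - q)‖) :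
    μHE[k] (H '' S) ≤ (b : ℝ≥0∞) ^ (k : ℝ) * (ENNReal.ofReal A.normDet * volume S) ∧
      ENNReal.ofReal A.normDet * volume S ≤ (b : ℝ≥0∞) ^ (k : ℝ) * μHE[k] (H '' S) := by
  let _ : MeasurableSpace V := borel V
  have : BorelSpace V := ⟨rfl⟩
  have hvol : μHE[k] (A '' S) = ENNReal.ofReal A.normDet * volume S := by
    have := A.euclideanHausdorffMeasure_image_eq_normDet_mul_volume S
    rwa [finrank_euclideanSpace_fin] at this
  rw [← hvol]
  have hleft : ∀ p, Function.invFun A (A p) = p := Function.leftInverse_invFun hA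
  constructor
  · have h : H '' S = (fun v => H (Function.invFun A v)) '' (A '' S) := by
      rw [image_image]
      exact image_congr fun p _ => by rw [hleft]
    rw [h]
    refine LipschitzOnWith.euclideanHausdorffMeasure_image_le
      (LipschitzOnWith.of_dist_le_mul ?_) k
    rintro _ ⟨p, hp, rfl⟩ _ ⟨q, hq, rfl⟩
    rw [hleft, hleft, dist_eq_norm (A p), ← map_sub]
    exact h2 p hp q hq
  · have hg : ∀ y ∈ H '' S, ∃ p ∈ S, H p = y := fun y hy => hy
    choose! g hgS hg using hg
    have hgH : ∀ p ∈ S, A (g (H p)) = A p := fun p hp => by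
      have h3 := h1 _ (hgS _ (mem_image_of_mem H hp)) p hp
      rw [hg _ (mem_image_of_mem H hp), dist_self, mul_zero, map_sub] at h3
      exact sub_eq_zero.1 (norm_le_zero_iff.1 h3)
    have h : A '' S = (fun y => A (g y)) '' (H '' S) := by
      rw [image_image]
      exact image_congr fun p hp => (hgH p hp).symm
    rw [h]
    refine LipschitzOnWith.euclideanHausdorffMeasure_image_le
      (LipschitzOnWith.of_dist_le_mul ?_) k
    rintro _ ⟨p, hp, rfl⟩ _ ⟨q, hq, rfl⟩
    rw [hgH p hp, hgH q hq, dist_eq_norm (A p), ← map_sub]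
    exact h1 p hp q hq

end Hausdorff

/-! ### Riemannian distance and normal coordinates to first order -/

section Riemannian

variable {n : ℕ} {M : Type*} [MetricSpace M] [ChartedSpace (EuclideanSpace ℝ (Fin n)) M]
  [IsManifold (𝓡 n) ∞ M]

/-- The identification of the model space with the tangent space at `x` given by the preferred
chart at `x`. -/
noncomputable def toTangent (x : M) :
    EuclideanSpace ℝ (Fin n) ≃L[ℝ] TangentSpace (𝓡 n) x :=
  ContinuousLinearEquiv.refl ℝ (EuclideanSpace ℝ (Fin n))

/-- The derivative at `y` of the preferred chart at `x`, with values in the model space. -/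
noncomputable def chartDeriv (x y : M) :
    TangentSpace (𝓡 n) y →L[ℝ] EuclideanSpace ℝ (Fin n) :=
  mfderiv (𝓡 n) 𝓘(ℝ, EuclideanSpace ℝ (Fin n)) (extChartAt (𝓡 n) x) y

lemma chartDeriv_eq {x y : M} (hy : y ∈ (chartAt (EuclideanSpace ℝ (Fin n)) x).source) :
    chartDeriv x y = (trivializationAt (EuclideanSpace ℝ (Fin n))
      (TangentSpace (𝓡 n) : M → Type _) x).continuousLinearMapAt ℝ y :=
  (TangentBundle.continuousLinearMapAt_trivializationAt hy).symm

lemma chartDeriv_self (x : M) (v : TangentSpace (𝓡 n) x) :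
    toTangent x (chartDeriv x x v) = v := by
  unfold chartDeriv
  rw [mfderiv_extChartAt_self]
  rfl

lemma toTangent_eq (x : M) (e : EuclideanSpace ℝ (Fin n)) :
    (trivializationAt (EuclideanSpace ℝ (Fin n))
      (TangentSpace (𝓡 n) : M → Type _) x).symmL ℝ x e = toTangent x e := by
  have hx : x ∈ (chartAt (EuclideanSpace ℝ (Fin n)) x).source := mem_chart_source _ x
  have h := chartDeriv_self x ((trivializationAt (EuclideanSpace ℝ (Fin n))
      (TangentSpace (𝓡 n) : M → Type _) x).symmL ℝ x e)
  rw [chartDeriv_eq hx, Trivialization.continuousLinearMapAt_symmL] at h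
  · exact h.symm
  · simp

variable [RiemannianBundle (fun x : M => TangentSpace (𝓡 n) x)]
  [IsContMDiffRiemannianBundle (𝓡 n) ∞ (EuclideanSpace ℝ (Fin n))
      (fun x : M => TangentSpace (𝓡 n) x)]

instance isContinuousRiemannianBundle_tangent :
    IsContinuousRiemannianBundle (EuclideanSpace ℝ (Fin n))
      (fun x : M => TangentSpace (𝓡 n) x) := by
  obtain ⟨g, hg, h⟩ := IsContMDiffRiemannianBundle.exists_contMDiff (IB := 𝓡 n) (n := ∞)
    (F := EuclideanSpace ℝ (Fin n)) (E := fun x : M => TangentSpace (𝓡 n) x)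
  exact ⟨g, hg.continuous, h⟩

/-- The preferred chart at `x`, measured in the norm of the tangent space at `x`, has derivative
close to an isometry at all points near `x`. -/
lemma eventually_norm_chartDeriv (x : M) {c : ℝ} (hc : 1 < c) :
    ∀ᶠ y in 𝓝 x, ∀ v : TangentSpace (𝓡 n) y,
      ‖toTangent x (chartDeriv x y v)‖ ≤ c * ‖v‖ ∧ ‖v‖ ≤ c * ‖toTangent x (chartDeriv x y v)‖ := by
  have h1 := eventually_norm_symmL_trivializationAt_self_comp_lt (EuclideanSpace ℝ (Fin n))
    (fun x : M => TangentSpace (𝓡 n) x) x hc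
  have h2 := eventually_norm_symmL_trivializationAt_comp_self_lt (EuclideanSpace ℝ (Fin n))
    (fun x : M => TangentSpace (𝓡 n) x) x hc
  have hx : x ∈ (chartAt (EuclideanSpace ℝ (Fin n)) x).source := mem_chart_source _ x
  filter_upwards [h1, h2, (chartAt (EuclideanSpace ℝ (Fin n)) x).open_source.mem_nhds hx]
    with y h1 h2 hy v
  constructor
  · rw [chartDeriv_eq hy, ← toTangent_eq]
    exact (ContinuousLinearMap.le_of_opNorm_le _ h1.le v)
  · have := (ContinuousLinearMap.le_of_opNorm_le _ h2.le (toTangent x (chartDeriv x y v)))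
    rw [ContinuousLinearMap.comp_apply, ← chartDeriv_eq hx] at this
    have h3 : chartDeriv x x (toTangent x (chartDeriv x y v)) = chartDeriv x y v := by
      apply (toTangent x).injective
      rw [chartDeriv_self]
    rw [h3, chartDeriv_eq hy, Trivialization.symmL_continuousLinearMapAt] at this
    · rwa [chartDeriv_eq hy]
    · simpa using hy

omit [RiemannianBundle (fun x : M => TangentSpace (𝓡 n) x)]
  [IsContMDiffRiemannianBundle (𝓡 n) ∞ (EuclideanSpace ℝ (Fin n))
      (fun x : M => TangentSpace (𝓡 n) x)] in
lemma hasDerivAt_chart_comp {x : M} {γ : ℝ → M} {t : ℝ}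
    (hγ : MDifferentiableAt 𝓘(ℝ, ℝ) (𝓡 n) γ t)
    (ht : γ t ∈ (chartAt (EuclideanSpace ℝ (Fin n)) x).source) :
    HasDerivAt (fun s => extChartAt (𝓡 n) x (γ s))
      (chartDeriv x (γ t) (mfderiv 𝓘(ℝ, ℝ) (𝓡 n) γ t 1)) t := by
  have h1 : MDifferentiableAt (𝓡 n) 𝓘(ℝ, EuclideanSpace ℝ (Fin n)) (extChartAt (𝓡 n) x) (γ t) :=
    mdifferentiableAt_extChartAt ht
  have h2 := (h1.hasMFDerivAt.comp t hγ.hasMFDerivAt)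
  have h3 : HasFDerivAt (fun s => extChartAt (𝓡 n) x (γ s))
    ((chartDeriv x (γ t)).comp (mfderiv 𝓘(ℝ, ℝ) (𝓡 n) γ t) : ℝ →L[ℝ] EuclideanSpace ℝ (Fin n)) t :=
    h2.hasFDerivAt
  exact h3.hasDerivAt


omit [IsContMDiffRiemannianBundle (𝓡 n) ∞ (EuclideanSpace ℝ (Fin n))
      (fun x : M => TangentSpace (𝓡 n) x)] in
/-- The displacement of a path in the chart at `x`, measured in the tangent space at `x`, is
controlled by its Riemannian length. -/
lemma enorm_chart_sub_le_pathELength {x : M} {c : ℝ} {γ : ℝ → M} {a b : ℝ} (hab : a ≤ b)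
    (hγ : ContMDiffOn 𝓘(ℝ, ℝ) (𝓡 n) 1 γ (Icc a b))
    (hs : ∀ t ∈ Icc a b, γ t ∈ (chartAt (EuclideanSpace ℝ (Fin n)) x).source)
    (hc : ∀ t ∈ Icc a b, ∀ v : TangentSpace (𝓡 n) (γ t),
      ‖toTangent x (chartDeriv x (γ t) v)‖ ≤ c * ‖v‖) :
    ‖toTangent x (extChartAt (𝓡 n) x (γ b) - extChartAt (𝓡 n) x (γ a))‖ₑ ≤
      ENNReal.ofReal c * pathELength (𝓡 n) γ a b := by
  let e : ℝ → TangentSpace (𝓡 n) x := fun s => toTangent x (extChartAt (𝓡 n) x (γ s))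
  have h1 : ContDiffOn ℝ 1 (fun s => extChartAt (𝓡 n) x (γ s)) (Icc a b) := by
    rw [← contMDiffOn_iff_contDiffOn]
    exact contMDiffOn_extChartAt.comp (t := (chartAt (EuclideanSpace ℝ (Fin n)) x).source) hγ
      (fun t ht => hs t ht)
  have h2 : ContDiffOn ℝ 1 e (Icc a b) := 
    (toTangent (n := n) x).contDiff.comp_contDiffOn (s := Icc a b) h1
  rw [map_sub, pathELength_eq_lintegral_mfderiv_Ioo, ← lintegral_const_mul' _ _
    ENNReal.ofReal_ne_top]
  refine (enorm_sub_le_lintegral_derivWithin_Icc_of_contDiffOn_Icc h2 hab).trans ?_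
  rw [← restrict_Ioo_eq_restrict_Icc]
  refine setLIntegral_mono' measurableSet_Ioo fun t ht => ?_
  have hnhds : Icc a b ∈ 𝓝 t := Icc_mem_nhds ht.1 ht.2
  have hmd : MDifferentiableAt 𝓘(ℝ, ℝ) (𝓡 n) γ t :=
    ((hγ t (Ioo_subset_Icc_self ht)).contMDiffAt hnhds).mdifferentiableAt one_ne_zero
  have h3 := (toTangent x).hasFDerivAt.comp_hasDerivAt t
    (hasDerivAt_chart_comp hmd (hs t (Ioo_subset_Icc_self ht)))
  rw [derivWithin_of_mem_nhds hnhds]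
  have h4 : deriv e t = toTangent x (chartDeriv x (γ t) (mfderiv 𝓘(ℝ, ℝ) (𝓡 n) γ t 1)) := h3.deriv
  rw [h4]
  have h5 := hc t (Ioo_subset_Icc_self ht) (mfderiv 𝓘(ℝ, ℝ) (𝓡 n) γ t 1)
  rw [← ofReal_norm, ← ofReal_norm, ← ENNReal.ofReal_mul' (norm_nonneg _)]
  exact ENNReal.ofReal_le_ofReal h5

variable [IsRiemannianManifold (𝓡 n) M]

omit [IsManifold (𝓡 n) ∞ M] [IsContMDiffRiemannianBundle (𝓡 n) ∞ (EuclideanSpace ℝ (Fin n))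
      (fun x : M => TangentSpace (𝓡 n) x)] in
lemma edist_le_pathELength {γ : ℝ → M} {a b : ℝ} (hab : a ≤ b)
    (hγ : ContMDiffOn 𝓘(ℝ, ℝ) (𝓡 n) 1 γ (Icc a b)) :
    edist (γ a) (γ b) ≤ pathELength (𝓡 n) γ a b := by
  rw [IsRiemannianManifold.out (I := 𝓡 n)]
  exact riemannianEDist_le_pathELength hγ rfl rfl hab

/-- To first order at `x`, the Riemannian distance is the distance in the chart at `x` for the inner
product of the tangent space at `x`. -/
lemma exists_dist_chart_le (x : M) {c : ℝ} (hc : 1 < c) :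
    ∃ ρ > 0, Metric.ball x ρ ⊆ (chartAt (EuclideanSpace ℝ (Fin n)) x).source ∧
      ∀ y ∈ Metric.ball x ρ, ∀ z ∈ Metric.ball x ρ,
      ‖toTangent x (extChartAt (𝓡 n) x y - extChartAt (𝓡 n) x z)‖ ≤ c * dist y z ∧
      dist y z ≤ c * ‖toTangent x (extChartAt (𝓡 n) x y - extChartAt (𝓡 n) x z)‖ := by
  have hc0 : 0 < c := by linarith
  have hx : x ∈ (chartAt (EuclideanSpace ℝ (Fin n)) x).source := mem_chart_source _ x
  obtain ⟨R, hR, hball⟩ := Metric.mem_nhds_iff.1 (inter_mem (eventually_norm_chartDeriv (n := n) x hc)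
    ((chartAt (EuclideanSpace ℝ (Fin n)) x).open_source.mem_nhds hx))
  -- a convex neighborhood in the chart, on which the inverse chart is controlled
  have hsymm : (extChartAt (𝓡 n) x).symm ⁻¹' Metric.ball x R ∩ (extChartAt (𝓡 n) x).target ∈
      𝓝 (extChartAt (𝓡 n) x x) := by
    refine inter_mem ((continuousAt_extChartAt_symm x).preimage_mem_nhds ?_)
      (extChartAt_target_mem_nhds x)
    rw [extChartAt_to_inv x]
    exact Metric.ball_mem_nhds x hR
  obtain ⟨s, hs, hsball⟩ := Metric.mem_nhds_iff.1 hsymm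
  obtain ⟨ρ', hρ', hρ'ball⟩ := Metric.mem_nhds_iff.1
    ((continuousAt_extChartAt (I := 𝓡 n) x).preimage_mem_nhds (Metric.ball_mem_nhds _ hs))
  have hρ : 0 < min ρ' (R / 3) := lt_min hρ' (by positivity)
  have hsub : Metric.ball x (min ρ' (R / 3)) ⊆ Metric.ball x R :=
    Metric.ball_subset_ball ((min_le_right _ _).trans (by linarith))
  refine ⟨min ρ' (R / 3), hρ, fun y hy => (hball (hsub hy)).2, fun y hy z hz => ⟨?_, ?_⟩⟩
  · have hyR : dist y x < R / 3 := lt_of_lt_of_le hy (min_le_right _ _)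
    have hzR : dist z x < R / 3 := lt_of_lt_of_le hz (min_le_right _ _)
    -- compare with the lengths of almost minimizing paths
    have key : ∀ r : ℝ, dist y z < r → r < 2 * R / 3 →
        ‖toTangent x (extChartAt (𝓡 n) x y - extChartAt (𝓡 n) x z)‖ ≤ c * r := by
      intro r hr hrR
      have hr0 : 0 < r := dist_nonneg.trans_lt hr
      have h1 : riemannianEDist (𝓡 n) z y < ENNReal.ofReal r := by
        rw [← IsRiemannianManifold.out (I := 𝓡 n), edist_dist, dist_comm]
        exact (ENNReal.ofReal_lt_ofReal_iff hr0).2 hr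
      obtain ⟨γ, h0, h1, hγ, hlen⟩ := exists_lt_of_riemannianEDist_lt h1
      have hin : ∀ t ∈ Icc (0 : ℝ) 1, γ t ∈ Metric.ball x R := by
        intro t ht
        have h2 : edist (γ 0) (γ t) < ENNReal.ofReal r :=
          ((edist_le_pathELength ht.1 (hγ.mono (Icc_subset_Icc_right ht.2))).trans
            (pathELength_mono le_rfl ht.2)).trans_lt hlen
        rw [edist_dist, ENNReal.ofReal_lt_ofReal_iff hr0, h0] at h2
        have h3 := dist_triangle_left (γ t) x z
        rw [Metric.mem_ball]
        linarith
      have h2 := enorm_chart_sub_le_pathELength (x := x) zero_le_one hγ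
        (fun t ht => (hball (hin t ht)).2) (fun t ht v => ((hball (hin t ht)).1 v).1)
      rw [h0, h1] at h2
      have h3 := h2.trans (mul_le_mul_right hlen.le (ENNReal.ofReal c))
      rw [← ofReal_norm, ← ENNReal.ofReal_mul hc0.le] at h3
      exact (ENNReal.ofReal_le_ofReal_iff (by positivity)).1 h3
    have hyz : dist y z < 2 * R / 3 := by
      have := dist_triangle_right y z x
      linarith
    rw [← div_le_iff₀' hc0]
    refine le_of_forall_gt_imp_ge_of_dense fun r hr => ?_
    rcases lt_or_ge r (2 * R / 3) with h | h
    · rw [div_le_iff₀' hc0]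
      exact key r hr h
    · obtain ⟨r', h1, h2⟩ := exists_between hyz
      refine le_trans ?_ h
      refine le_trans ?_ h2.le
      rw [div_le_iff₀' hc0]
      exact key r' h1 h2
  · -- compare with the segment in the chart
    have hys : extChartAt (𝓡 n) x y ∈ Metric.ball (extChartAt (𝓡 n) x x) s :=
      hρ'ball (Metric.ball_subset_ball (min_le_left _ _) hy)
    have hzs : extChartAt (𝓡 n) x z ∈ Metric.ball (extChartAt (𝓡 n) x x) s :=
      hρ'ball (Metric.ball_subset_ball (min_le_left _ _) hz)
    set ey := extChartAt (𝓡 n) x y with hey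
    set ez := extChartAt (𝓡 n) x z with hez
    let ℓ : ℝ → EuclideanSpace ℝ (Fin n) := fun t => ey + t • (ez - ey)
    have hℓ : ∀ t ∈ Icc (0 : ℝ) 1, ℓ t ∈ Metric.ball (extChartAt (𝓡 n) x x) s := fun t ht =>
      (convex_ball _ _).add_smul_sub_mem hys hzs ht
    let γ : ℝ → M := fun t => (extChartAt (𝓡 n) x).symm (ℓ t)
    have hℓs : ContDiff ℝ 1 ℓ := by fun_prop
    have hγ : ContMDiffOn 𝓘(ℝ, ℝ) (𝓡 n) 1 γ (Icc 0 1) :=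
      (contMDiffOn_extChartAt_symm x).comp (contMDiff_iff_contDiff.2 hℓs).contMDiffOn
        fun t ht => (hsball (hℓ t ht)).2
    have hy0 : γ 0 = y := by
      have : (extChartAt (𝓡 n) x).symm ey = y := (extChartAt (𝓡 n) x).left_inv
        (by rw [extChartAt_source]; exact (hball (hsub hy)).2)
      simpa [γ, ℓ] using this
    have hz1 : γ 1 = z := by
      have : (extChartAt (𝓡 n) x).symm ez = z := (extChartAt (𝓡 n) x).left_inv
        (by rw [extChartAt_source]; exact (hball (hsub hz)).2)
      simpa [γ, ℓ] using this
    have hlen : edist y z ≤ ENNReal.ofReal (c * ‖toTangent x (ey - ez)‖) := by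
      have h1 := edist_le_pathELength zero_le_one hγ
      rw [hy0, hz1] at h1
      refine h1.trans ?_
      rw [pathELength_eq_lintegral_mfderiv_Ioo]
      refine (setLIntegral_mono' (g := fun _ => ENNReal.ofReal (c * ‖toTangent x (ey - ez)‖))
        measurableSet_Ioo fun t ht => ?_).trans ?_
      · have hnhds : Icc (0 : ℝ) 1 ∈ 𝓝 t := Icc_mem_nhds ht.1 ht.2
        have ht' := Ioo_subset_Icc_self ht
        have hmd : MDifferentiableAt 𝓘(ℝ, ℝ) (𝓡 n) γ t :=
          ((hγ t ht').contMDiffAt hnhds).mdifferentiableAt one_ne_zero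
        have hb := hball (hsball (hℓ t ht')).1
        have h3 := hasDerivAt_chart_comp (x := x) hmd hb.2
        have h4 : HasDerivAt (fun s => extChartAt (𝓡 n) x (γ s)) (ez - ey) t := by
          have h5 : HasDerivAt ℓ (ez - ey) t := by
            have h6 := ((hasDerivAt_id t).smul_const (ez - ey)).const_add ey
            rw [one_smul] at h6
            exact h6
          refine h5.congr_of_eventuallyEq ?_
          filter_upwards [hnhds] with u hu
          exact (extChartAt (𝓡 n) x).right_inv (hsball (hℓ u hu)).2
        have h5 := (hb.1 (mfderiv 𝓘(ℝ, ℝ) (𝓡 n) γ t 1)).2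
        rw [h3.unique h4] at h5
        rw [← ofReal_norm]
        refine ENNReal.ofReal_le_ofReal (h5.trans (le_of_eq ?_))
        rw [← neg_sub, map_neg, norm_neg]
      · simp
    rw [edist_dist] at hlen
    exact (ENNReal.ofReal_le_ofReal_iff (by positivity)).1 hlen


variable {k : ℕ}

/-- The derivative of a map from a Euclidean space to `M`. -/
noncomputable def immDeriv (H : EuclideanSpace ℝ (Fin k) → M) (p : EuclideanSpace ℝ (Fin k)) :
    EuclideanSpace ℝ (Fin k) →L[ℝ] TangentSpace (𝓡 n) (H p) :=
  mfderiv (𝓡 k) (𝓡 n) H p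

omit [RiemannianBundle (fun x : M => TangentSpace (𝓡 n) x)]
  [IsContMDiffRiemannianBundle (𝓡 n) ∞ (EuclideanSpace ℝ (Fin n))
      (fun x : M => TangentSpace (𝓡 n) x)] [IsRiemannianManifold (𝓡 n) M] in
lemma hasFDerivAt_chart_comp {x : M} {H : EuclideanSpace ℝ (Fin k) → M}
    {p : EuclideanSpace ℝ (Fin k)} (hH : MDifferentiableAt (𝓡 k) (𝓡 n) H p)
    (hp : H p ∈ (chartAt (EuclideanSpace ℝ (Fin n)) x).source) :
    HasFDerivAt (fun q => extChartAt (𝓡 n) x (H q))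
      ((chartDeriv x (H p)).comp (immDeriv (n := n) H p)) p := by
  have h1 : MDifferentiableAt (𝓡 n) 𝓘(ℝ, EuclideanSpace ℝ (Fin n)) (extChartAt (𝓡 n) x) (H p) :=
    mdifferentiableAt_extChartAt hp
  have h2 := (h1.hasMFDerivAt.comp p hH.hasMFDerivAt)
  exact h2.hasFDerivAt

omit [RiemannianBundle (fun x : M => TangentSpace (𝓡 n) x)]
  [IsContMDiffRiemannianBundle (𝓡 n) ∞ (EuclideanSpace ℝ (Fin n))
      (fun x : M => TangentSpace (𝓡 n) x)] [IsRiemannianManifold (𝓡 n) M] in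
lemma contDiffAt_chart_comp {x : M} {H : EuclideanSpace ℝ (Fin k) → M}
    {p : EuclideanSpace ℝ (Fin k)} (hH : ContMDiffAt (𝓡 k) (𝓡 n) 1 H p)
    (hp : H p ∈ (chartAt (EuclideanSpace ℝ (Fin n)) x).source) :
    ContDiffAt ℝ 1 (fun q => extChartAt (𝓡 n) x (H q)) p := by
  rw [← contMDiffAt_iff_contDiffAt]
  exact (contMDiffAt_extChartAt' hp).comp p hH

omit [IsContMDiffRiemannianBundle (𝓡 n) ∞ (EuclideanSpace ℝ (Fin n))
      (fun x : M => TangentSpace (𝓡 n) x)] [IsRiemannianManifold (𝓡 n) M] in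
lemma hasStrictFDerivAt_toTangent_chart {H : EuclideanSpace ℝ (Fin k) → M}
    {p : EuclideanSpace ℝ (Fin k)} (hH : ContMDiffAt (𝓡 k) (𝓡 n) 1 H p) :
    HasStrictFDerivAt (fun q => toTangent (n := n) (H p) (extChartAt (𝓡 n) (H p) (H q)))
      (immDeriv (n := n) H p) p := by
  have hs := mem_chart_source (EuclideanSpace ℝ (Fin n)) (H p)
  have h1 := (contDiffAt_chart_comp hH hs).hasStrictFDerivAt one_ne_zero
  rw [(hasFDerivAt_chart_comp (hH.mdifferentiableAt one_ne_zero) hs).fderiv] at h1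
  have h2 := (toTangent (n := n) (H p)).hasStrictFDerivAt.comp p h1
  refine h2.congr_fderiv ?_
  ext v
  exact chartDeriv_self _ _

/-- A `C¹` immersion is, close to a point, almost isometric to its derivative. -/
lemma exists_dist_immersion_le {H : EuclideanSpace ℝ (Fin k) → M}
    {p₀ : EuclideanSpace ℝ (Fin k)} (hH : ContMDiffAt (𝓡 k) (𝓡 n) 1 H p₀)
    (hinj : Function.Injective (immDeriv (n := n) H p₀)) {c : ℝ} (hc : 1 < c) :
    ∃ ρ > 0, ∀ p ∈ Metric.ball p₀ ρ, ∀ q ∈ Metric.ball p₀ ρ,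
      ‖immDeriv (n := n) H p₀ (p - q)‖ ≤ c * dist (H p) (H q) ∧
      dist (H p) (H q) ≤ c * ‖immDeriv (n := n) H p₀ (p - q)‖ := by
  set b := Real.sqrt c with hb
  have hb1 : 1 < b := Real.lt_sqrt_of_sq_lt (by simpa using hc)
  have hbc : b * b = c := Real.mul_self_sqrt (by linarith)
  obtain ⟨K, hK0, hK⟩ := (immDeriv (n := n) H p₀).toLinearMap.exists_antilipschitzWith
    (LinearMap.ker_eq_bot.2 hinj)
  have hK' : ∀ v, ‖v‖ ≤ K * ‖immDeriv (n := n) H p₀ v‖ := fun v => by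
    simpa [dist_eq_norm] using hK.le_mul_dist v 0
  have hη : 0 < (1 - b⁻¹) / K := div_pos (sub_pos.2 (inv_lt_one_of_one_lt₀ hb1)) hK0
  have hstrict := (hasStrictFDerivAt_toTangent_chart hH).isLittleO.def hη
  obtain ⟨ρ₁, hρ₁, h1⟩ := Metric.eventually_nhds_iff_ball.1 hstrict
  obtain ⟨R, hR, -, hd⟩ := exists_dist_chart_le (n := n) (H p₀) hb1
  obtain ⟨ρ₂, hρ₂, h2⟩ := Metric.mem_nhds_iff.1
    (hH.continuousAt.preimage_mem_nhds (Metric.ball_mem_nhds _ hR))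
  refine ⟨min ρ₁ ρ₂, lt_min hρ₁ hρ₂, fun p hp q hq => ?_⟩
  have hpq : (p, q) ∈ Metric.ball (p₀, p₀) ρ₁ := by
    rw [← ball_prod_same]
    exact ⟨Metric.ball_subset_ball (min_le_left _ _) hp,
      Metric.ball_subset_ball (min_le_left _ _) hq⟩
  have h3 := h1 _ hpq
  have h4 := hd _ (h2 (Metric.ball_subset_ball (min_le_right _ _) hp)) _
    (h2 (Metric.ball_subset_ball (min_le_right _ _) hq))
  simp only at h3
  rw [← map_sub] at h3
  set T := toTangent (H p₀) (extChartAt (𝓡 n) (H p₀) (H p) - extChartAt (𝓡 n) (H p₀) (H q))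
  set a := ‖immDeriv (n := n) H p₀ (p - q)‖ with ha
  have h5 : ‖T - immDeriv (n := n) H p₀ (p - q)‖ ≤ (1 - b⁻¹) * a := by
    refine h3.trans ?_
    calc (1 - b⁻¹) / K * ‖p - q‖ ≤ (1 - b⁻¹) / K * (K * a) := by gcongr; exact hK' _
      _ = (1 - b⁻¹) * a := by field_simp
  have ha0 : 0 ≤ a := norm_nonneg _
  have hbi : b⁻¹ * b = 1 := inv_mul_cancel₀ (by positivity)
  have h6 : a ≤ b * ‖T‖ := by
    have := norm_sub_norm_le (immDeriv (n := n) H p₀ (p - q)) T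
    rw [norm_sub_rev] at this
    have h7 : b⁻¹ * a ≤ ‖T‖ := by linarith
    calc a = b * (b⁻¹ * a) := by rw [← mul_assoc, mul_comm b, hbi, one_mul]
      _ ≤ b * ‖T‖ := by gcongr
  have h7 : ‖T‖ ≤ b * a := by
    have := norm_sub_norm_le T (immDeriv (n := n) H p₀ (p - q))
    have h8 : 2 - b⁻¹ ≤ b := by
      have : 0 < b⁻¹ := by positivity
      nlinarith [sq_nonneg (b - 1)]
    nlinarith
  constructor
  · calc a ≤ b * ‖T‖ := h6
      _ ≤ b * (b * dist (H p) (H q)) := by gcongr; exact h4.1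
      _ = c * dist (H p) (H q) := by rw [← mul_assoc, hbc]
  · calc dist (H p) (H q) ≤ b * ‖T‖ := h4.2
      _ ≤ b * (b * a) := by gcongr
      _ = c * a := by rw [← mul_assoc, hbc]

variable [MeasurableSpace M] [BorelSpace M]

/-- Area formula to first order: near `p₀`, a `C¹` immersion multiplies volumes by almost the
determinant of its derivative at `p₀`. -/
lemma exists_euclideanHausdorffMeasure_immersion_le {H : EuclideanSpace ℝ (Fin k) → M}
    {p₀ : EuclideanSpace ℝ (Fin k)} (hH : ContMDiffAt (𝓡 k) (𝓡 n) 1 H p₀)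
    (hinj : Function.Injective (immDeriv (n := n) H p₀)) {c : ℝ} (hc : 1 < c) :
    ∃ ρ > 0, ∀ S ⊆ Metric.ball p₀ ρ,
      μHE[k] (H '' S) ≤ ENNReal.ofReal c *
        (ENNReal.ofReal (immDeriv (n := n) H p₀).toLinearMap.normDet * volume S) ∧
      ENNReal.ofReal (immDeriv (n := n) H p₀).toLinearMap.normDet * volume S ≤
        ENNReal.ofReal c * μHE[k] (H '' S) := by
  obtain ⟨b, hb1, hbc⟩ : ∃ b : ℝ≥0, 1 < b ∧ ((b : ℝ≥0∞) ^ (k : ℝ)) ≤ ENNReal.ofReal c := by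
    have h1 : Tendsto (fun b : ℝ≥0 => ((b : ℝ≥0∞) ^ (k : ℝ))) (𝓝[>] 1) (𝓝 (1 : ℝ≥0∞)) := by
      have : ContinuousAt (fun b : ℝ≥0 => ((b : ℝ≥0∞) ^ (k : ℝ))) 1 :=
        (ENNReal.continuous_rpow_const.comp ENNReal.continuous_coe).continuousAt
      have h2 := this.tendsto.mono_left (nhdsWithin_le_nhds (s := Ioi (1 : ℝ≥0)))
      simpa using h2
    have h2 : (1 : ℝ≥0∞) < ENNReal.ofReal c := by
      rw [← ENNReal.ofReal_one]; exact (ENNReal.ofReal_lt_ofReal_iff (by linarith)).2 hc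
    obtain ⟨b, hb, hb'⟩ := ((h1.eventually_lt_const h2).and self_mem_nhdsWithin).exists
    exact ⟨b, hb', hb.le⟩
  obtain ⟨ρ, hρ, h⟩ := exists_dist_immersion_le hH hinj (c := (b : ℝ)) (by exact_mod_cast hb1)
  refine ⟨ρ, hρ, fun S hS => ?_⟩
  have h1 := euclideanHausdorffMeasure_image_of_dist_le (A := (immDeriv (n := n) H p₀).toLinearMap) hinj
    (fun p hp q hq => (h p (hS hp) q (hS hq)).1) (fun p hp q hq => (h p (hS hp) q (hS hq)).2)
  exact ⟨h1.1.trans (by gcongr), h1.2.trans (by gcongr)⟩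

omit [IsRiemannianManifold (𝓡 n) M] [MeasurableSpace M] [BorelSpace M] in
lemma eventually_norm_mfderiv_le {g : M → M} (hg : ContMDiff (𝓡 n) (𝓡 n) 1 g) (x : M) :
    ∃ L : ℝ, ∀ᶠ y in 𝓝 x, ∀ v : TangentSpace (𝓡 n) y, ‖mfderiv (𝓡 n) (𝓡 n) g y v‖ ≤ L * ‖v‖ := by
  let G : EuclideanSpace ℝ (Fin n) → EuclideanSpace ℝ (Fin n) :=
    extChartAt (𝓡 n) (g x) ∘ g ∘ (extChartAt (𝓡 n) x).symm
  have hG : ContDiffAt ℝ 1 G (extChartAt (𝓡 n) x x) := by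
    have := (contMDiffAt_iff.1 (hg x)).2
    rwa [ModelWithCorners.range_eq_univ, contDiffWithinAt_univ] at this
  have hG1 : ∀ᶠ e in 𝓝 (extChartAt (𝓡 n) x x), DifferentiableAt ℝ G e :=
    (hG.eventually (by simp)).mono fun e he => he.differentiableAt one_ne_zero
  have hG2 : ∀ᶠ e in 𝓝 (extChartAt (𝓡 n) x x),
      ‖fderiv ℝ G e‖ < ‖fderiv ℝ G (extChartAt (𝓡 n) x x)‖ + 1 :=
    (hG.continuousAt_fderiv one_ne_zero).norm.eventually_lt_const (lt_add_one _)
  set L := ‖fderiv ℝ G (extChartAt (𝓡 n) x x)‖ + 1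
  obtain ⟨a, ha⟩ : ∃ a : ℝ, ∀ e : EuclideanSpace ℝ (Fin n), ‖toTangent (g x) e‖ ≤ a * ‖e‖ :=
    ⟨_, fun e => (toTangent (n := n) (g x)).toContinuousLinearMap.le_opNorm e⟩
  obtain ⟨b, hb⟩ : ∃ b : ℝ, ∀ v : TangentSpace (𝓡 n) x, ‖(toTangent x).symm v‖ ≤ b * ‖v‖ :=
    ⟨_, fun e => (toTangent (n := n) x).symm.toContinuousLinearMap.le_opNorm e⟩
  have hcx := continuousAt_extChartAt (I := 𝓡 n) x
  have hs : ∀ᶠ y in 𝓝 x, y ∈ (chartAt (EuclideanSpace ℝ (Fin n)) x).source :=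
    (chartAt (EuclideanSpace ℝ (Fin n)) x).open_source.mem_nhds (mem_chart_source _ x)
  have hs' : ∀ᶠ y in 𝓝 x, g y ∈ (chartAt (EuclideanSpace ℝ (Fin n)) (g x)).source :=
    hg.continuous.continuousAt.preimage_mem_nhds
      ((chartAt (EuclideanSpace ℝ (Fin n)) (g x)).open_source.mem_nhds (mem_chart_source _ (g x)))
  refine ⟨2 * (|a| * (L * (|b| * 2))), ?_⟩
  filter_upwards [eventually_norm_chartDeriv (n := n) x one_lt_two,
    hg.continuous.continuousAt.eventually (eventually_norm_chartDeriv (n := n) (g x) one_lt_two),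
    hcx.eventually hG1, hcx.eventually hG2, hs, hs', hs.eventually_nhds] with y h1 h2 h3 h4 h5 h6 h7 v
  have hL0 : 0 ≤ L := by positivity
  have key : chartDeriv (g x) (g y) (mfderiv (𝓡 n) (𝓡 n) g y v) =
      fderiv ℝ G (extChartAt (𝓡 n) x y) (chartDeriv x y v) := by
    have hgy : MDifferentiableAt (𝓡 n) (𝓡 n) g y := (hg y).mdifferentiableAt one_ne_zero
    have e1 : MDifferentiableAt (𝓡 n) 𝓘(ℝ, EuclideanSpace ℝ (Fin n)) (extChartAt (𝓡 n) x) y :=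
      mdifferentiableAt_extChartAt h5
    have e2 : MDifferentiableAt (𝓡 n) 𝓘(ℝ, EuclideanSpace ℝ (Fin n))
      (extChartAt (𝓡 n) (g x)) (g y) := mdifferentiableAt_extChartAt h6
    have e3 := e2.hasMFDerivAt.comp y hgy.hasMFDerivAt
    have e4 := h3.hasFDerivAt.hasMFDerivAt.comp y e1.hasMFDerivAt
    have e5 : G ∘ extChartAt (𝓡 n) x =ᶠ[𝓝 y] extChartAt (𝓡 n) (g x) ∘ g := by
      filter_upwards [h7] with z hz
      have : (extChartAt (𝓡 n) x).symm (extChartAt (𝓡 n) x z) = z :=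
        (extChartAt (𝓡 n) x).left_inv (by rwa [extChartAt_source])
      simp only [G, Function.comp_apply, this]
    have e6 := hasMFDerivAt_unique (e4.congr_of_eventuallyEq e5.symm) e3
    exact (congrArg (fun T => T v) e6).symm
  calc ‖mfderiv (𝓡 n) (𝓡 n) g y v‖
      ≤ 2 * ‖toTangent (g x) (chartDeriv (g x) (g y) (mfderiv (𝓡 n) (𝓡 n) g y v))‖ := (h2 _).2
    _ ≤ 2 * (|a| * (L * (|b| * (2 * ‖v‖)))) := by
        rw [key]
        gcongr
        refine (ha _).trans ?_
        gcongr
        · exact le_abs_self a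
        refine (ContinuousLinearMap.le_of_opNorm_le _ h4.le _).trans ?_
        gcongr
        have := hb (toTangent x (chartDeriv x y v))
        rw [ContinuousLinearEquiv.symm_apply_apply] at this
        refine this.trans ?_
        gcongr
        · exact le_abs_self b
        · exact (h1 v).1
    _ = 2 * (|a| * (L * (|b| * 2))) * ‖v‖ := by ring

omit [IsRiemannianManifold (𝓡 n) M] [MeasurableSpace M] [BorelSpace M] in
lemma exists_norm_mfderiv_le [CompactSpace M] {g : M → M} (hg : ContMDiff (𝓡 n) (𝓡 n) 1 g) :
    ∃ L : ℝ, 1 ≤ L ∧ ∀ (y : M) (v : TangentSpace (𝓡 n) y),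
      ‖mfderiv (𝓡 n) (𝓡 n) g y v‖ ≤ L * ‖v‖ := by
  choose L hL using eventually_norm_mfderiv_le hg
  obtain ⟨t, -, ht⟩ := isCompact_univ.elim_nhds_subcover _ fun x _ => hL x
  refine ⟨1 + ∑ x ∈ t, |L x|, le_add_of_nonneg_right (Finset.sum_nonneg fun _ _ => abs_nonneg _),
    fun y v => ?_⟩
  obtain ⟨x, hx, hy⟩ := mem_iUnion₂.1 (ht (mem_univ y))
  refine (hy v).trans (mul_le_mul_of_nonneg_right ?_ (norm_nonneg v))
  have := Finset.single_le_sum (f := fun x => |L x|) (fun _ _ => abs_nonneg _) hx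
  have := le_abs_self (L x)
  simp only at *
  linarith

end Riemannian

/-! ### The distance along leaves -/

namespace Foliation

section LeafDistance

variable {n k : ℕ} {M : Type*} [MetricSpace M] [ChartedSpace (EuclideanSpace ℝ (Fin n)) M]
  [IsManifold (𝓡 n) ∞ M] (F : Foliation n k M)

lemma mem_leaf_self (x : M) : x ∈ F.leaf x := F.rel.refl x

lemma mem_leaf_symm {x y : M} (h : y ∈ F.leaf x) : x ∈ F.leaf y := F.rel.symm h

lemma mem_leaf_trans {x y z : M} (h : y ∈ F.leaf x) (h' : z ∈ F.leaf y) : z ∈ F.leaf x :=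
  F.rel.trans h h'

variable [RiemannianBundle (fun x : M => TangentSpace (𝓡 n) x)] {x y z : M}

lemma leafEDist_le_pathELength {γ : ℝ → M} {a b : ℝ}
    (hγ : ContMDiffOn 𝓘(ℝ, ℝ) (𝓡 n) 1 γ (Icc a b)) (hleaf : ∀ t ∈ Icc a b, γ t ∈ F.leaf (γ a))
    (hab : a ≤ b) : F.leafEDist (γ a) (γ b) ≤ pathELength (𝓡 n) γ a b := by
  let η : ℝ →ᴬ[ℝ] ℝ := ContinuousAffineMap.lineMap a b
  have hmaps : MapsTo η (Icc 0 1) (Icc a b) := by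
    rw [mapsTo_iff_image_subset, ContinuousAffineMap.coe_lineMap_eq,
      ← segment_eq_image_lineMap]
    simp [hab]
  have hη : ContMDiffOn 𝓘(ℝ, ℝ) (𝓡 n) 1 (γ ∘ η) (Icc 0 1) := by
    refine hγ.comp ?_ hmaps
    rw [contMDiffOn_iff_contDiffOn]
    exact η.contDiff.contDiffOn
  let f : unitInterval → M := fun t => (γ ∘ η) t
  have hf : ContMDiff (𝓡∂ 1) (𝓡 n) 1 f := by
    rw [← contMDiffOn_comp_projIcc_iff]
    refine hη.congr fun t ht => ?_
    simp only [Function.comp_apply, f, projIcc_of_mem, ht]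
  let g : Path (γ a) (γ b) := by
    refine ⟨⟨f, hf.continuous⟩, ?_, ?_⟩ <;>
    simp [f, η, ContinuousAffineMap.coe_lineMap_eq]
  have hg : ∀ s, g s ∈ F.leaf (γ a) := fun s => hleaf _ (hmaps s.2)
  refine (iInf₂_le g hf).trans ((iInf_le _ hg).trans ?_)
  rw [lintegral_norm_mfderiv_Icc_eq_pathELength_projIcc]
  have E : pathELength (𝓡 n) (g ∘ projIcc 0 1 zero_le_one) 0 1
      = pathELength (𝓡 n) (γ ∘ η) 0 1 := by
    refine pathELength_congr fun t ht => ?_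
    simp only [Function.comp_apply, ht, projIcc_of_mem]
    rfl
  rw [E, pathELength_comp_of_monotoneOn zero_le_one _ η.differentiableOn]
  · simp [η, ContinuousAffineMap.coe_lineMap_eq]
  · simpa [η, ContinuousAffineMap.coe_lineMap_eq] using hγ.mdifferentiableOn one_ne_zero
  · exact fun s _ t _ hst => AffineMap.lineMap_mono hab hst

/-- A leaf distance less than `r` is realized by a path in the leaf of length less than `r`, which
may be taken constant near its ends. -/
lemma exists_path_of_leafEDist_lt {r : ℝ≥0∞} (hr : F.leafEDist x y < r) {a b : ℝ} (hab : a < b) :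
    ∃ γ : ℝ → M, γ a = x ∧ γ b = y ∧ ContMDiff 𝓘(ℝ, ℝ) (𝓡 n) 1 γ ∧
      (∀ t, γ t ∈ F.leaf x) ∧ pathELength (𝓡 n) γ a b < r ∧
      γ =ᶠ[𝓝 a] (fun _ => x) ∧ γ =ᶠ[𝓝 b] (fun _ => y) := by
  simp only [leafEDist, iInf_lt_iff, exists_prop] at hr
  obtain ⟨γ₀, γ₀_smooth, hγ₀F, hγ₀⟩ := hr
  obtain ⟨γ, hγx, hγy, γ_smooth, hγF, hγ⟩ : ∃ γ : ℝ → M, γ 0 = x ∧ γ 1 = y ∧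
      ContMDiffOn 𝓘(ℝ, ℝ) (𝓡 n) 1 γ (Icc 0 1) ∧ (∀ t, γ t ∈ F.leaf x) ∧
      pathELength (𝓡 n) γ 0 1 < r := by
    refine ⟨γ₀ ∘ (projIcc 0 1 zero_le_one), by simp, by simp,
      contMDiffOn_comp_projIcc_iff.2 γ₀_smooth, fun t => hγ₀F _, ?_⟩
    rwa [← lintegral_norm_mfderiv_Icc_eq_pathELength_projIcc]
  rcases exists_between hab with ⟨a', haa', ha'b⟩
  rcases exists_between ha'b with ⟨b', ha'b', hb'b⟩
  let η (t : ℝ) : ℝ := Real.smoothTransition ((b' - a')⁻¹ * (t - a'))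
  have A (t) (ht : t < a') : η t = 0 := by
    simp only [η, Real.smoothTransition.zero_iff_nonpos]
    apply mul_nonpos_of_nonneg_of_nonpos
    · simpa using ha'b'.le
    · linarith
  have A' (t) (ht : t < a') : (γ ∘ η) t = x := by simp [A t ht, hγx]
  have B (t) (ht : b' < t) : η t = 1 := by
    simp only [η, Real.smoothTransition.eq_one_iff_one_le, inv_mul_eq_div]
    rw [one_le_div₀] <;> linarith
  have B' (t) (ht : b' < t) : (γ ∘ η) t = y := by simp [B t ht, hγy]
  refine ⟨γ ∘ η, A' _ haa', B' _ hb'b, ?_, fun t => hγF _, ?_, ?_, ?_⟩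
  · rw [← contMDiffOn_univ]
    apply γ_smooth.comp
    · rw [contMDiffOn_univ, contMDiff_iff_contDiff]
      fun_prop
    · intro t ht
      exact ⟨Real.smoothTransition.nonneg _, Real.smoothTransition.le_one _⟩
  · convert! hγ using 1
    rw [← A a haa', ← B b hb'b]
    apply pathELength_comp_of_monotoneOn hab.le
    · apply Monotone.monotoneOn
      apply Real.smoothTransition.monotone.comp
      intro t u htu
      dsimp only
      gcongr
    · simp only [η]
      apply (ContDiff.contDiffOn _).differentiableOn one_ne_zero
      fun_prop
    · rw [A a haa', B b hb'b]
      apply γ_smooth.mdifferentiableOn one_ne_zero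
  · filter_upwards [Iio_mem_nhds haa'] with t ht using A' t ht
  · filter_upwards [Ioi_mem_nhds hb'b] with t ht using B' t ht

@[simp] lemma leafEDist_self : F.leafEDist x x = 0 := by
  have := F.leafEDist_le_pathELength (γ := fun _ : ℝ => x) (a := 0) (b := 0) contMDiffOn_const
    (fun t _ => F.mem_leaf_self x) le_rfl
  simpa using this

lemma leafEDist_comm : F.leafEDist x y = F.leafEDist y x := by
  suffices H : ∀ x y, F.leafEDist y x ≤ F.leafEDist x y from le_antisymm (H y x) (H x y)
  intro x y
  refine le_of_forall_gt fun r hr => ?_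
  obtain ⟨γ, γ0, γ1, γ_smooth, γF, hγ, -⟩ := F.exists_path_of_leafEDist_lt hr zero_lt_one
  let η : ℝ → ℝ := fun t => -t
  have h_smooth : ContMDiff 𝓘(ℝ, ℝ) (𝓡 n) 1 (γ ∘ η) := by
    apply γ_smooth.comp ?_
    simp only [contMDiff_iff_contDiff]
    fun_prop
  have h1 : F.leafEDist ((γ ∘ η) (η 1)) ((γ ∘ η) (η 0)) ≤ pathELength (𝓡 n) (γ ∘ η) (η 1) (η 0) :=
    F.leafEDist_le_pathELength h_smooth.contMDiffOn
      (fun t _ => F.mem_leaf_trans (F.mem_leaf_symm (γF _)) (γF _)) (by simp [η])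
  rw [← pathELength_comp_of_antitoneOn zero_le_one] at h1; rotate_left
  · exact monotone_id.neg.antitoneOn _
  · exact differentiableOn_neg _
  · exact h_smooth.contMDiffOn.mdifferentiableOn one_ne_zero
  have h2 : (γ ∘ η) ∘ η = γ := by ext t; simp [η]
  simp only [Function.comp_apply, η, neg_neg, neg_zero, γ0, γ1] at h1
  refine h1.trans_lt ?_
  convert! hγ

lemma leafEDist_triangle : F.leafEDist x z ≤ F.leafEDist x y + F.leafEDist y z := by
  refine le_of_forall_gt fun r hr => ?_
  obtain ⟨u, hu, v, hv, huv⟩ := ENNReal.exists_add_lt_of_add_lt hr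
  obtain ⟨γ₁, hγ₁0, hγ₁1, hγ₁_smooth, hγ₁F, hγ₁, -, hγ₁_const⟩ :=
    F.exists_path_of_leafEDist_lt hu zero_lt_one
  obtain ⟨γ₂, hγ₂1, hγ₂2, hγ₂_smooth, hγ₂F, hγ₂, hγ₂_const, -⟩ :=
    F.exists_path_of_leafEDist_lt hv one_lt_two
  let γ := piecewise (Iic 1) γ₁ γ₂
  have hxy : y ∈ F.leaf x := hγ₁1 ▸ hγ₁F 1
  have h0 : γ 0 = x := by simp [γ, hγ₁0]
  have h2 : γ 2 = z := by simp [γ, hγ₂2]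
  have : F.leafEDist (γ 0) (γ 2) ≤ pathELength (𝓡 n) γ 0 2 := by
    refine F.leafEDist_le_pathELength ?_ (fun t _ => ?_) zero_le_two
    · apply ContMDiff.contMDiffOn
      exact ContMDiff.piecewise_Iic hγ₁_smooth hγ₂_smooth (hγ₁_const.trans hγ₂_const.symm)
    · rw [h0]
      by_cases ht : t ≤ 1
      · simpa [γ, ht] using hγ₁F t
      · simpa [γ, ht] using F.mem_leaf_trans hxy (hγ₂F t)
  rw [h0, h2] at this
  apply this.trans_lt (lt_trans ?_ huv)
  rw [← pathELength_add zero_le_one one_le_two]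
  gcongr
  · convert! hγ₁ using 1
    apply pathELength_congr
    intro t ht
    simp [γ, ht.2]
  · convert! hγ₂ using 1
    apply pathELength_congr_Ioo
    intro t ht
    simp [γ, ht.1]

lemma edist_le_leafEDist [IsRiemannianManifold (𝓡 n) M] : edist x y ≤ F.leafEDist x y := by
  refine le_of_forall_gt fun r hr => ?_
  obtain ⟨γ, γ0, γ1, γ_smooth, -, hγ, -⟩ := F.exists_path_of_leafEDist_lt hr zero_lt_one
  rw [← γ0, ← γ1]
  exact (edist_le_pathELength zero_le_one γ_smooth.contMDiffOn).trans_lt hγ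

lemma dist_lt_of_leafEDist_lt [IsRiemannianManifold (𝓡 n) M] {r : ℝ}
    (h : F.leafEDist x y < ENNReal.ofReal r) : dist x y < r := by
  have := (F.edist_le_leafEDist).trans_lt h
  rw [edist_dist] at this
  exact (ENNReal.ofReal_lt_ofReal_iff_of_nonneg dist_nonneg).1 this

end LeafDistance

end Foliation

/-! ### Plaques of foliated charts -/

section Plaques

variable {n k : ℕ} {M : Type*} [MetricSpace M] [ChartedSpace (EuclideanSpace ℝ (Fin n)) M]
  [IsManifold (𝓡 n) ∞ M] {rel : Setoid M}
  {h : EuclideanSpace ℝ (Fin k) × EuclideanSpace ℝ (Fin (n - k)) → M}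

omit [IsManifold (𝓡 n) ∞ M] in
lemma mfderiv_comp_one {H : EuclideanSpace ℝ (Fin k) → M} {ℓ : ℝ → EuclideanSpace ℝ (Fin k)}
    {s : ℝ} {v : EuclideanSpace ℝ (Fin k)} (hH : MDifferentiableAt (𝓡 k) (𝓡 n) H (ℓ s))
    (hℓ : HasDerivAt ℓ v s) :
    mfderiv 𝓘(ℝ, ℝ) (𝓡 n) (fun s => H (ℓ s)) s 1 = immDeriv (n := n) H (ℓ s) v := by
  have h1 := (hH.hasMFDerivAt.comp s hℓ.hasFDerivAt.hasMFDerivAt).mfderiv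
  have h2 := congrArg (fun T => T 1) h1
  refine h2.trans ?_
  exact congrArg (immDeriv (n := n) H (ℓ s)) (one_smul ℝ v)

/-- A path inside a leaf and inside the domain of a foliated chart stays in one plaque, since the
leaf has countably many plaques in the chart. -/
lemma IsFoliatedChart.exists_lift (hh : IsFoliatedChart (n := n) k rel h) {γ : ℝ → M} {S : Set ℝ}
    (hS : IsPreconnected S) (hγ : ContinuousOn γ S) (hrange : ∀ s ∈ S, γ s ∈ range h) {x : M}
    (hx : ∀ s ∈ S, rel x (γ s)) :
    ∃ (c : ℝ → EuclideanSpace ℝ (Fin k)) (t : EuclideanSpace ℝ (Fin (n - k))),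
      ContinuousOn c S ∧ ∀ s ∈ S, γ s = h (c s, t) := by
  let e := hh.isOpenEmbedding.toOpenPartialHomeomorph h
  have hcont : ContinuousOn (fun s => e.symm (γ s)) S := by
    have h1 : ContinuousOn e.symm (range h) := by
      have := e.continuousOn_symm
      rwa [IsOpenEmbedding.toOpenPartialHomeomorph_target] at this
    exact h1.comp hγ hrange
  have hinv : ∀ s ∈ S, h (e.symm (γ s)) = γ s := fun s hs =>
    hh.isOpenEmbedding.toOpenPartialHomeomorph_right_inv h (hrange s hs)
  have hsub : ((fun s => (e.symm (γ s)).2) '' S).Subsingleton := by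
    refine (hh.countable_plaques x).isTotallyDisconnected _ ?_ (hS.image _ hcont.snd)
    rintro _ ⟨s, hs, rfl⟩
    exact ⟨(e.symm (γ s)).1, by rw [Prod.mk.eta, hinv s hs]; exact hx s hs⟩
  rcases S.eq_empty_or_nonempty with rfl | ⟨s₀, hs₀⟩
  · exact ⟨fun _ => 0, 0, by simp, by simp⟩
  refine ⟨fun s => (e.symm (γ s)).1, (e.symm (γ s₀)).2, hcont.fst, fun s hs => ?_⟩
  rw [← hsub (mem_image_of_mem _ hs) (mem_image_of_mem _ hs₀), Prod.mk.eta, hinv s hs]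

lemma IsFoliatedChart.injective_immDeriv (hh : IsFoliatedChart (n := n) k rel h)
    (p : EuclideanSpace ℝ (Fin k)) (t : EuclideanSpace ℝ (Fin (n - k))) :
    Function.Injective (immDeriv (n := n) (fun q => h (q, t)) p) :=
  hh.injective_mfderiv p t

/-- In a chart of the manifold, the derivative along the plaques is a continuous function of the
point. -/
lemma IsFoliatedChart.continuousAt_deriv (hh : IsFoliatedChart (n := n) k rel h)
    (a : EuclideanSpace ℝ (Fin k) × EuclideanSpace ℝ (Fin (n - k))) :
    ContinuousAt (fun b : EuclideanSpace ℝ (Fin k) × EuclideanSpace ℝ (Fin (n - k)) =>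
      (chartDeriv (h a) (h b)).comp (immDeriv (n := n) (fun q => h (q, b.2)) b.1)) a := by
  rw [continuousAt_clm_apply]
  intro v
  have h1 : Continuous (fun b : EuclideanSpace ℝ (Fin k) × EuclideanSpace ℝ (Fin (n - k)) =>
      (⟨h b, immDeriv (n := n) (fun q => h (q, b.2)) b.1 v⟩ : TangentBundle (𝓡 n) M)) :=
    hh.continuous_mfderiv.comp (f := fun b : EuclideanSpace ℝ (Fin k) ×
      EuclideanSpace ℝ (Fin (n - k)) => (b.1, b.2, v)) (by fun_prop)
  have h2 := (FiberBundle.continuousAt_totalSpace _ _).1 (h1.continuousAt (x := a))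
  refine h2.2.congr ?_
  have h3 : ∀ᶠ b in 𝓝 a, h b ∈ (chartAt (EuclideanSpace ℝ (Fin n)) (h a)).source :=
    hh.isOpenEmbedding.continuous.continuousAt.preimage_mem_nhds
      ((chartAt (EuclideanSpace ℝ (Fin n)) (h a)).open_source.mem_nhds (mem_chart_source _ _))
  filter_upwards [h3] with b hb
  rw [chartDeriv_eq hb]
  rw [ContinuousLinearMap.comp_apply, Trivialization.continuousLinearMapAt_apply,
    Trivialization.linearMapAt_apply]
  rw [if_pos (by simpa using hb)]

end Plaques

namespace Foliation

section Plaques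

variable {n k : ℕ} {M : Type*} [MetricSpace M] [ChartedSpace (EuclideanSpace ℝ (Fin n)) M]
  [IsManifold (𝓡 n) ∞ M] (F : Foliation n k M)
  [RiemannianBundle (fun x : M => TangentSpace (𝓡 n) x)]
  [IsContMDiffRiemannianBundle (𝓡 n) ∞ (EuclideanSpace ℝ (Fin n))
      (fun x : M => TangentSpace (𝓡 n) x)]
  [IsRiemannianManifold (𝓡 n) M]
  {h : EuclideanSpace ℝ (Fin k) × EuclideanSpace ℝ (Fin (n - k)) → M}

/-- Locally uniformly in the plaque, the coordinate of a foliated chart along the plaques, the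
distance of the manifold and the leaf distance are Lipschitz equivalent on plaques. -/
lemma exists_plaque_bounds (hh : IsFoliatedChart (n := n) k F.rel h)
    (p₀ : EuclideanSpace ℝ (Fin k)) (t₀ : EuclideanSpace ℝ (Fin (n - k))) :
    ∃ a > 0, ∃ C : ℝ, 1 ≤ C ∧ ∀ t ∈ Metric.ball t₀ a, ∀ p ∈ Metric.ball p₀ a,
      ∀ q ∈ Metric.ball p₀ a, dist p q ≤ C * dist (h (p, t)) (h (q, t)) ∧
      F.leafEDist (h (p, t)) (h (q, t)) ≤ ENNReal.ofReal (C * dist p q) := by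
  set x := h (p₀, t₀) with hx
  set D := fun b : EuclideanSpace ℝ (Fin k) × EuclideanSpace ℝ (Fin (n - k)) =>
    (chartDeriv x (h b)).comp (immDeriv (n := n) (fun q => h (q, b.2)) b.1) with hD
  have hDc : ContinuousAt D (p₀, t₀) := hh.continuousAt_deriv (p₀, t₀)
  have hinj : Function.Injective (D (p₀, t₀)) := by
    intro v w hvw
    apply hh.injective_immDeriv p₀ t₀
    have := congrArg (toTangent x) hvw
    rwa [hD, ContinuousLinearMap.comp_apply, ContinuousLinearMap.comp_apply, chartDeriv_self,
      chartDeriv_self] at this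
  obtain ⟨K, hK0, hK⟩ := (D (p₀, t₀)).toLinearMap.exists_antilipschitzWith
    (LinearMap.ker_eq_bot.2 hinj)
  have hK' : ∀ v, ‖v‖ ≤ K * ‖D (p₀, t₀) v‖ := fun v => by
    simpa [dist_eq_norm] using hK.le_mul_dist v 0
  have hη : (0 : ℝ) < 1 / (2 * K) := by have : (0 : ℝ) < K := hK0; positivity
  have hDη := Metric.continuousAt_iff'.1 hDc _ hη
  obtain ⟨R, hR, hsrc, hd⟩ := exists_dist_chart_le (n := n) x one_lt_two
  have hhc : ContinuousAt h (p₀, t₀) := hh.isOpenEmbedding.continuous.continuousAt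
  have hball : ∀ᶠ b in 𝓝 (p₀, t₀), h b ∈ Metric.ball x R :=
    hhc.preimage_mem_nhds (Metric.ball_mem_nhds _ hR)
  have hnorm := hhc.eventually (eventually_norm_chartDeriv (n := n) x one_lt_two)
  obtain ⟨a, ha, hab⟩ := Metric.eventually_nhds_iff_ball.1 ((hDη.and hball).and hnorm)
  have hab' : ∀ t ∈ Metric.ball t₀ a, ∀ p ∈ Metric.ball p₀ a, (p, t) ∈ Metric.ball (p₀, t₀) a :=
    fun t ht p hp => by rw [← ball_prod_same]; exact ⟨hp, ht⟩
  obtain ⟨b₁, hb₁, hb⟩ : ∃ b, 0 ≤ b ∧ ∀ e : EuclideanSpace ℝ (Fin n),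
      ‖toTangent x e‖ ≤ b * ‖e‖ :=
    ⟨_, norm_nonneg _, fun e => (toTangent (n := n) x).toContinuousLinearMap.le_opNorm e⟩
  obtain ⟨b₂, hb₂, hb'⟩ : ∃ b, 0 ≤ b ∧ ∀ v : TangentSpace (𝓡 n) x,
      ‖(toTangent x).symm v‖ ≤ b * ‖v‖ :=
    ⟨_, norm_nonneg _, fun e => (toTangent (n := n) x).symm.toContinuousLinearMap.le_opNorm e⟩
  set L := ‖D (p₀, t₀)‖ + 1 / (2 * K)
  have hL0 : 0 ≤ L := by positivity
  refine ⟨a, ha, 1 + 2 * K * (b₂ * 2) + 2 * (b₁ * L), by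
    have : (0 : ℝ) < K := hK0
    have : 0 ≤ 2 * K * (b₂ * 2) := by positivity
    have : 0 ≤ 2 * (b₁ * L) := by positivity
    linarith, fun t ht p hp q hq => ⟨?_, ?_⟩⟩
  · have hder : ∀ u ∈ Metric.ball p₀ a, HasFDerivWithinAt
        (fun q => extChartAt (𝓡 n) x (h (q, t))) (D (u, t)) (Metric.ball p₀ a) u := fun u hu =>
      (hasFDerivAt_chart_comp (H := fun q => h (q, t))
        ((hh.contMDiff_plaque t u).mdifferentiableAt one_ne_zero)
        (hsrc (hab _ (hab' t ht u hu)).1.2)).hasFDerivWithinAt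
    have h1 := (convex_ball p₀ a).norm_image_sub_le_of_norm_hasFDerivWithin_le' hder
      (fun u hu => by
        rw [← dist_eq_norm]; exact (hab _ (hab' t ht u hu)).1.1.le) hq hp
    have h2 := (hd _ (hab _ (hab' t ht p hp)).1.2 _ (hab _ (hab' t ht q hq)).1.2).1
    set e := extChartAt (𝓡 n) x (h (p, t)) - extChartAt (𝓡 n) x (h (q, t))
    have h3 : ‖e‖ ≤ b₂ * (2 * dist (h (p, t)) (h (q, t))) := by
      have := hb' (toTangent x e)
      rw [ContinuousLinearEquiv.symm_apply_apply] at this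
      exact this.trans (by gcongr)
    have h4 := hK' (p - q)
    have h5 : ‖D (p₀, t₀) (p - q)‖ ≤ ‖e‖ + 1 / (2 * K) * ‖p - q‖ := by
      have := norm_sub_norm_le (D (p₀, t₀) (p - q)) e
      rw [norm_sub_rev (D (p₀, t₀) (p - q)) e] at this
      linarith
    have hKr : (0 : ℝ) < K := hK0
    have h6 : ‖p - q‖ ≤ 2 * K * ‖e‖ := by
      have h7 : ‖p - q‖ ≤ K * (‖e‖ + 1 / (2 * K) * ‖p - q‖) := h4.trans (by gcongr)
      have h8 : K * (‖e‖ + 1 / (2 * K) * ‖p - q‖) = K * ‖e‖ + ‖p - q‖ / 2 := by field_simp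
      linarith
    rw [dist_eq_norm]
    calc ‖p - q‖ ≤ 2 * K * ‖e‖ := h6
      _ ≤ 2 * K * (b₂ * (2 * dist (h (p, t)) (h (q, t)))) := by gcongr
      _ = 2 * K * (b₂ * 2) * dist (h (p, t)) (h (q, t)) := by ring
      _ ≤ _ := by
        gcongr
        have : 0 ≤ 2 * (b₁ * L) := by positivity
        linarith
  · let ℓ : ℝ → EuclideanSpace ℝ (Fin k) := fun s => p + s • (q - p)
    have hℓ : ∀ s ∈ Icc (0 : ℝ) 1, ℓ s ∈ Metric.ball p₀ a := fun s hs =>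
      (convex_ball _ _).add_smul_sub_mem hp hq hs
    have hℓs : ContDiff ℝ 1 ℓ := by fun_prop
    have hγ : ContMDiff 𝓘(ℝ, ℝ) (𝓡 n) 1 (fun s => h (ℓ s, t)) :=
      (hh.contMDiff_plaque t).comp (contMDiff_iff_contDiff.2 hℓs)
    have h1 := F.leafEDist_le_pathELength (γ := fun s => h (ℓ s, t)) hγ.contMDiffOn
      (fun s _ => hh.rel_plaque _ _ _) zero_le_one
    have e0 : ℓ 0 = p := by simp [ℓ]
    have e1 : ℓ 1 = q := by simp [ℓ]
    simp only [e0, e1] at h1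
    refine h1.trans ?_
    rw [pathELength_eq_lintegral_mfderiv_Icc]
    refine (setLIntegral_mono' (g := fun _ => ENNReal.ofReal (2 * (b₁ * L) * dist p q))
      measurableSet_Icc fun s hs => ?_).trans ?_
    · have h2 := hab _ (hab' t ht _ (hℓ s hs))
      have h3 : mfderiv 𝓘(ℝ, ℝ) (𝓡 n) (fun s => h (ℓ s, t)) s 1 =
          immDeriv (n := n) (fun q => h (q, t)) (ℓ s) (q - p) := by
        have h4 : HasDerivAt ℓ (q - p) s := by
          have h6 := ((hasDerivAt_id s).smul_const (q - p)).const_add p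
          rw [one_smul] at h6
          exact h6
        exact mfderiv_comp_one (H := fun q => h (q, t))
          ((hh.contMDiff_plaque t (ℓ s)).mdifferentiableAt one_ne_zero) h4
      rw [h3]
      have h4 := (h2.2 (immDeriv (n := n) (fun q => h (q, t)) (ℓ s) (q - p))).2
      rw [← ofReal_norm]
      refine ENNReal.ofReal_le_ofReal (h4.trans ?_)
      have h5 : ‖D (ℓ s, t)‖ ≤ L := by
        have := norm_sub_norm_le (D (ℓ s, t)) (D (p₀, t₀))
        have h6 := h2.1.1.le
        rw [dist_eq_norm] at h6
        simp only [L]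
        linarith
      have h6 := hb (D (ℓ s, t) (q - p))
      rw [dist_comm, dist_eq_norm, mul_assoc, mul_assoc]
      gcongr
      refine h6.trans ?_
      gcongr
      exact ContinuousLinearMap.le_of_opNorm_le _ h5 _
    · rw [lintegral_const]
      simp only [MeasurableSet.univ, Measure.restrict_apply, univ_inter, Real.volume_Icc, sub_zero,
        ENNReal.ofReal_one, mul_one]
      refine ENNReal.ofReal_le_ofReal ?_
      gcongr
      have hKr : (0 : ℝ) < K := hK0
      have : 0 ≤ 2 * K * (b₂ * 2) := by positivity
      linarith

end Plaques

end Foliation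

/-! ### Uniform plaques -/

namespace Foliation

section UniformPlaques

variable {n k : ℕ} {M : Type*} [MetricSpace M] [ChartedSpace (EuclideanSpace ℝ (Fin n)) M]
  [IsManifold (𝓡 n) ∞ M] (F : Foliation n k M)
  [RiemannianBundle (fun x : M => TangentSpace (𝓡 n) x)]

/-- `H` parametrizes a plaque through `H p` on which, over the closed ball of radius `a` around `p`,
parameter distances, distances of `M` and leaf distances are `C`-Lipschitz equivalent, and which
contains the leaf ball of radius `r`. -/
structure IsUniformPlaque (C a r : ℝ) (H : EuclideanSpace ℝ (Fin k) → M)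
    (p : EuclideanSpace ℝ (Fin k)) : Prop where
  exists_chart : ∃ h t, IsFoliatedChart (n := n) k F.rel h ∧ H = fun q => h (q, t)
  dist_le : ∀ q ∈ Metric.closedBall p a, ∀ q' ∈ Metric.closedBall p a,
    dist q q' ≤ C * dist (H q) (H q')
  leafEDist_le : ∀ q ∈ Metric.closedBall p a, ∀ q' ∈ Metric.closedBall p a,
    F.leafEDist (H q) (H q') ≤ ENNReal.ofReal (C * dist q q')
  exists_eq : ∀ z, F.leafEDist (H p) z < ENNReal.ofReal r → ∃ q ∈ Metric.closedBall p a, H q = z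

namespace IsUniformPlaque

variable {F} {C a r : ℝ} {H : EuclideanSpace ℝ (Fin k) → M} {p : EuclideanSpace ℝ (Fin k)}

lemma contMDiff (hH : F.IsUniformPlaque C a r H p) : ContMDiff (𝓡 k) (𝓡 n) 1 H := by
  obtain ⟨h, t, hh, rfl⟩ := hH.exists_chart
  exact hh.contMDiff_plaque t

lemma injective_immDeriv (hH : F.IsUniformPlaque C a r H p) (q : EuclideanSpace ℝ (Fin k)) :
    Function.Injective (immDeriv (n := n) H q) := by
  obtain ⟨h, t, hh, rfl⟩ := hH.exists_chart
  exact hh.injective_immDeriv q t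

lemma mono [IsRiemannianManifold (𝓡 n) M] (hH : F.IsUniformPlaque C a r H p) {C' a' r' : ℝ}
    (hC0 : 0 ≤ C) (ha0 : 0 ≤ a) (hC : C ≤ C') (ha : a' ≤ a) (hr : r' ≤ r) (h : C' * r' ≤ a') :
    F.IsUniformPlaque C' a' r' H p where
  exists_chart := hH.exists_chart
  dist_le q hq q' hq' := (hH.dist_le q (Metric.closedBall_subset_closedBall ha hq) q'
    (Metric.closedBall_subset_closedBall ha hq')).trans (by gcongr)
  leafEDist_le q hq q' hq' := (hH.leafEDist_le q (Metric.closedBall_subset_closedBall ha hq) q'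
    (Metric.closedBall_subset_closedBall ha hq')).trans (by gcongr)
  exists_eq z hz := by
    obtain ⟨q, hq, rfl⟩ := hH.exists_eq z (hz.trans_le (ENNReal.ofReal_le_ofReal hr))
    refine ⟨q, ?_, rfl⟩
    rw [Metric.mem_closedBall, dist_comm]
    refine le_trans ?_ h
    have h1 := F.dist_lt_of_leafEDist_lt hz
    calc dist p q ≤ C * dist (H p) (H q) :=
          hH.dist_le p (Metric.mem_closedBall_self ha0) q hq
      _ ≤ C' * dist (H p) (H q) := by gcongr
      _ ≤ C' * r' := by gcongr; linarith

end IsUniformPlaque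

variable [IsContMDiffRiemannianBundle (𝓡 n) ∞ (EuclideanSpace ℝ (Fin n))
      (fun x : M => TangentSpace (𝓡 n) x)]
  [IsRiemannianManifold (𝓡 n) M]

lemma exists_uniformPlaque_nhds (x : M) :
    ∃ C a r : ℝ, 1 ≤ C ∧ 0 < a ∧ 0 < r ∧ C * r ≤ a ∧
      ∀ᶠ y in 𝓝 x, ∃ H p, H p = y ∧ F.IsUniformPlaque C a r H p := by
  obtain ⟨h, hh, ⟨⟨p₀, t₀⟩, rfl⟩⟩ := F.exists_chart x
  obtain ⟨a, ha, C, hC, hbd⟩ := F.exists_plaque_bounds hh p₀ t₀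
  have hopen : ∀ s > 0, h '' (Metric.ball p₀ s ×ˢ Metric.ball t₀ a) ∈ 𝓝 (h (p₀, t₀)) := fun s hs =>
    (hh.isOpenEmbedding.isOpenMap _ (Metric.isOpen_ball.prod Metric.isOpen_ball)).mem_nhds
      (mem_image_of_mem h ⟨Metric.mem_ball_self hs, Metric.mem_ball_self ha⟩)
  obtain ⟨R, hR, hRsub⟩ := Metric.mem_nhds_iff.1 (hopen a ha)
  have hC0 : 0 < C := by linarith
  refine ⟨C, a / 2, min (R / 2) (a / (2 * C)), hC, by positivity, by positivity, ?_, ?_⟩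
  · calc C * min (R / 2) (a / (2 * C)) ≤ C * (a / (2 * C)) := by gcongr; exact min_le_right _ _
      _ = a / 2 := by field_simp
  filter_upwards [hopen (a / 4) (by positivity), Metric.ball_mem_nhds _ (half_pos hR)] with y hy hyR
  obtain ⟨⟨p, t⟩, ⟨hp, ht⟩, rfl⟩ := hy
  have hsub : Metric.closedBall p (a / 2) ⊆ Metric.ball p₀ a := by
    refine Metric.closedBall_subset_ball' ?_
    have : dist p p₀ < a / 4 := hp
    linarith
  have hpa : p ∈ Metric.ball p₀ a := hsub (Metric.mem_closedBall_self (by positivity))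
  refine ⟨fun q => h (q, t), p, rfl, ⟨h, t, hh, rfl⟩,
    fun q hq q' hq' => (hbd t ht q (hsub hq) q' (hsub hq')).1,
    fun q hq q' hq' => (hbd t ht q (hsub hq) q' (hsub hq')).2, fun z hz => ?_⟩
  obtain ⟨γ, h0, h1, hγ, hγF, hlen, -⟩ := F.exists_path_of_leafEDist_lt hz zero_lt_one
  have hr0 : 0 < min (R / 2) (a / (2 * C)) := by positivity
  have hγR : ∀ s ∈ Icc (0 : ℝ) 1, γ s ∈ h '' (Metric.ball p₀ a ×ˢ Metric.ball t₀ a) := by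
    intro s hs
    apply hRsub
    have h2 : edist (γ 0) (γ s) < ENNReal.ofReal (min (R / 2) (a / (2 * C))) :=
      ((edist_le_pathELength hs.1 hγ.contMDiffOn).trans (pathELength_mono le_rfl hs.2)).trans_lt
        hlen
    rw [edist_dist, ENNReal.ofReal_lt_ofReal_iff hr0, h0] at h2
    have h3 := dist_triangle_left (γ s) (h (p₀, t₀)) (h (p, t))
    have h4 := min_le_left (R / 2) (a / (2 * C))
    have h5 : dist (h (p, t)) (h (p₀, t₀)) < R / 2 := hyR
    rw [Metric.mem_ball]
    linarith
  obtain ⟨c, t', hc, hct⟩ := hh.exists_lift isPreconnected_Icc hγ.continuous.continuousOn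
    (fun s hs => image_subset_range _ _ (hγR s hs)) (fun s _ => hγF s)
  have hc0 : h (c 0, t') = h (p, t) := by rw [← hct 0 (by simp), h0]
  obtain ⟨h6, rfl⟩ := Prod.ext_iff.1 (hh.isOpenEmbedding.injective hc0)
  have hc1 : h (c 1, t') = z := by rw [← hct 1 (by simp), h1]
  obtain ⟨⟨q, t''⟩, ⟨hq, -⟩, hqz⟩ := hγR 1 (by simp)
  rw [h1, ← hc1] at hqz
  obtain rfl : q = c 1 := (Prod.ext_iff.1 (hh.isOpenEmbedding.injective hqz)).1
  refine ⟨c 1, ?_, hc1⟩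
  rw [Metric.mem_closedBall, dist_comm]
  have h7 := (hbd t' ht p hpa (c 1) hq).1
  have h8 := F.dist_lt_of_leafEDist_lt hz
  rw [← hc1] at h8
  calc dist p (c 1) ≤ C * dist (h (p, t')) (h (c 1, t')) := h7
    _ ≤ C * (a / (2 * C)) := by gcongr; exact h8.le.trans (min_le_right _ _)
    _ = a / 2 := by field_simp

/-- On a compact manifold, the plaque constants may be chosen independent of the point. -/
lemma exists_uniformPlaque [CompactSpace M] :
    ∃ C a r : ℝ, 1 ≤ C ∧ 0 < a ∧ 0 < r ∧ C * r ≤ a ∧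
      ∀ y, ∃ H p, H p = y ∧ F.IsUniformPlaque C a r H p := by
  suffices h : ∃ C a r : ℝ, 1 ≤ C ∧ 0 < a ∧ 0 < r ∧ C * r ≤ a ∧
      ∀ y ∈ (univ : Set M), ∃ H p, H p = y ∧ F.IsUniformPlaque C a r H p by
    simpa using h
  refine isCompact_univ.induction_on (p := fun S : Set M => ∃ C a r : ℝ, 1 ≤ C ∧ 0 < a ∧ 0 < r ∧
    C * r ≤ a ∧ ∀ y ∈ S, ∃ H p, H p = y ∧ F.IsUniformPlaque C a r H p) ?_ ?_ ?_ ?_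
  · exact ⟨1, 1, 1, le_rfl, one_pos, one_pos, by norm_num, by simp⟩
  · rintro S T hST ⟨C, a, r, h1, h2, h3, h4, h⟩
    exact ⟨C, a, r, h1, h2, h3, h4, fun y hy => h y (hST hy)⟩
  · rintro S T ⟨C, a, r, h1, h2, h3, h4, h⟩ ⟨C', a', r', h1', h2', h3', h4', h'⟩
    have hC : 0 < max C C' := lt_max_of_lt_left (by linarith)
    have hr : 0 < min (min r r') (min a a' / max C C') := by positivity
    have hle : max C C' * min (min r r') (min a a' / max C C') ≤ min a a' := by
      calc max C C' * min (min r r') (min a a' / max C C')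
          ≤ max C C' * (min a a' / max C C') := by gcongr; exact min_le_right _ _
        _ = min a a' := by field_simp
    refine ⟨max C C', min a a', min (min r r') (min a a' / max C C'), le_max_of_le_left h1,
      by positivity, hr, hle, ?_⟩
    rintro y (hy | hy)
    · obtain ⟨H, p, hp, hH⟩ := h y hy
      exact ⟨H, p, hp, hH.mono (by linarith) h2.le (le_max_left _ _) (min_le_left _ _)
        ((min_le_left _ _).trans (min_le_left _ _)) hle⟩
    · obtain ⟨H, p, hp, hH⟩ := h' y hy
      exact ⟨H, p, hp, hH.mono (by linarith) h2'.le (le_max_right _ _) (min_le_right _ _)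
        ((min_le_left _ _).trans (min_le_right _ _)) hle⟩
  · intro x _
    obtain ⟨C, a, r, h1, h2, h3, h4, h⟩ := F.exists_uniformPlaque_nhds x
    exact ⟨_, nhdsWithin_le_nhds h, C, a, r, h1, h2, h3, h4, fun y hy => hy⟩

end UniformPlaques

end Foliation

/-! ### Leaf balls -/

section PathLength

variable {n : ℕ} {M : Type*} [MetricSpace M] [ChartedSpace (EuclideanSpace ℝ (Fin n)) M]
  [RiemannianBundle (fun x : M => TangentSpace (𝓡 n) x)]

lemma continuousOn_pathELength {γ : ℝ → M} {a b : ℝ} (h : pathELength (𝓡 n) γ a b ≠ ⊤) :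
    ContinuousOn (fun t => pathELength (𝓡 n) γ a t) (Icc a b) := by
  have key : ∀ ε > (0 : ℝ≥0∞), ∃ d > 0, ∀ s ∈ Icc a b, ∀ t ∈ Icc a b, s ≤ t → t - s < d →
      pathELength (𝓡 n) γ s t < ε := by
    intro ε hε
    rw [pathELength_eq_lintegral_mfderiv_Icc] at h
    obtain ⟨d, hd, hd'⟩ := exists_pos_setLIntegral_lt_of_measure_lt h hε.ne'
    obtain ⟨d', hd'0, hd'd⟩ := ENNReal.lt_iff_exists_real_btwn.1 hd
    refine ⟨d', ENNReal.ofReal_pos.1 hd'd.1, fun s hs t ht hst hd'' => ?_⟩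
    rw [pathELength_eq_lintegral_mfderiv_Icc]
    have h1 := hd' (Icc s t) ?_
    · rwa [Measure.restrict_restrict measurableSet_Icc,
        inter_eq_left.2 (Icc_subset_Icc hs.1 ht.2)] at h1
    · rw [Measure.restrict_apply measurableSet_Icc, inter_eq_left.2 (Icc_subset_Icc hs.1 ht.2),
        Real.volume_Icc]
      exact (ENNReal.ofReal_lt_ofReal_iff (ENNReal.ofReal_pos.1 hd'd.1)).2 hd'' |>.trans hd'd.2
  intro t ht
  have hfin : ∀ s ∈ Icc a b, pathELength (𝓡 n) γ a s ≠ ⊤ := fun s hs =>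
    ne_top_of_le_ne_top h (pathELength_mono le_rfl hs.2)
  refine (ENNReal.tendsto_nhds (hfin t ht)).2 fun ε hε => ?_
  obtain ⟨d, hd, hd'⟩ := key ε hε
  filter_upwards [self_mem_nhdsWithin, nhdsWithin_le_nhds (Metric.ball_mem_nhds t hd)] with s hs hsd
  rw [Metric.mem_ball, Real.dist_eq, abs_lt] at hsd
  rcases le_total s t with hst | hts
  · refine ⟨?_, (pathELength_mono le_rfl hst).trans le_self_add⟩
    rw [tsub_le_iff_right, ← pathELength_add hs.1 hst]
    gcongr
    exact (hd' s hs t ht hst (by linarith)).le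
  · refine ⟨tsub_le_self.trans (pathELength_mono le_rfl hts), ?_⟩
    rw [← pathELength_add ht.1 hts]
    gcongr
    exact (hd' t ht s hs hts (by linarith)).le

/-- The length of a path takes all intermediate values along the path. -/
lemma exists_pathELength_eq {γ : ℝ → M} {a b : ℝ} (hab : a ≤ b) (h : pathELength (𝓡 n) γ a b ≠ ⊤)
    {c : ℝ≥0∞} (hc : c ≤ pathELength (𝓡 n) γ a b) : ∃ t ∈ Icc a b, pathELength (𝓡 n) γ a t = c :=
  intermediate_value_Icc hab (continuousOn_pathELength h) ⟨by simp, hc⟩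

end PathLength

namespace Foliation

section LeafBalls

variable {n k : ℕ} {M : Type*} [MetricSpace M] [ChartedSpace (EuclideanSpace ℝ (Fin n)) M]
  [IsManifold (𝓡 n) ∞ M] (F : Foliation n k M)
  [RiemannianBundle (fun x : M => TangentSpace (𝓡 n) x)]

variable {F} in
lemma mem_ball {x y : M} {δ : ℝ} : y ∈ F.ball x δ ↔ F.leafEDist x y < ENNReal.ofReal δ := Iff.rfl

lemma mem_ball_comm {x y : M} {δ : ℝ} : y ∈ F.ball x δ ↔ x ∈ F.ball y δ := by
  rw [mem_ball, mem_ball, leafEDist_comm]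

lemma mem_ball_self (x : M) {δ : ℝ} (hδ : 0 < δ) : x ∈ F.ball x δ := by
  simpa [mem_ball] using hδ

lemma ball_mono (x : M) {δ δ' : ℝ} (h : δ ≤ δ') : F.ball x δ ⊆ F.ball x δ' := fun _ hy =>
  lt_of_lt_of_le hy (ENNReal.ofReal_le_ofReal h)

variable {F} in
lemma mem_ball_add {x y z : M} {δ δ' : ℝ} (h : y ∈ F.ball x δ) (h' : z ∈ F.ball y δ') :
    z ∈ F.ball x (δ + δ') := by
  have h0 : 0 < δ := ENNReal.ofReal_pos.1 (bot_le.trans_lt h)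
  have h1 : 0 < δ' := ENNReal.ofReal_pos.1 (bot_le.trans_lt h')
  rw [mem_ball, ENNReal.ofReal_add h0.le h1.le]
  exact F.leafEDist_triangle.trans_lt (ENNReal.add_lt_add h h')

/-- Leaves are length spaces. -/
lemma exists_leafEDist_lt_lt {x y : M} {u v : ℝ≥0∞} (hu : 0 < u) (hv : 0 < v)
    (h : F.leafEDist x y < u + v) : ∃ w, F.leafEDist x w < u ∧ F.leafEDist w y < v := by
  obtain ⟨γ, h0, h1, hγ, hγF, hlen, -⟩ := F.exists_path_of_leafEDist_lt h zero_lt_one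
  set ℓ := pathELength (𝓡 n) γ 0 1
  have hℓ : ℓ ≠ ⊤ := hlen.ne_top
  rcases lt_or_ge ℓ v with hv' | hv'
  · refine ⟨x, by simpa using hu, ?_⟩
    have := F.leafEDist_le_pathELength hγ.contMDiffOn
      (fun t _ => F.mem_leaf_trans (F.mem_leaf_symm (hγF 0)) (hγF t)) zero_le_one
    rw [h0, h1] at this
    exact this.trans_lt hv'
  have h2 : ℓ - v < u := by
    refine ENNReal.sub_lt_of_lt_add hv' hlen
  obtain ⟨c, hc1, hc2⟩ := exists_between (lt_min h2 (ENNReal.sub_lt_self hℓ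
    (hv.trans_le hv').ne' hv.ne'))
  obtain ⟨t, ht, htc⟩ := exists_pathELength_eq zero_le_one hℓ (hc2.trans_le (min_le_right _ _)).le
  have h3 := F.leafEDist_le_pathELength (a := 0) (b := t) hγ.contMDiffOn
      (fun t _ => F.mem_leaf_trans (F.mem_leaf_symm (hγF 0)) (hγF t)) ht.1
  have h4 := F.leafEDist_le_pathELength (a := t) (b := 1) hγ.contMDiffOn
      (fun s _ => F.mem_leaf_trans (F.mem_leaf_symm (hγF t)) (hγF s)) ht.2
  rw [h0] at h3
  rw [h1] at h4
  refine ⟨γ t, h3.trans_lt (htc ▸ hc2.trans_le (min_le_left _ _)), h4.trans_lt ?_⟩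
  have h5 : c + pathELength (𝓡 n) γ t 1 = ℓ := by rw [← htc, pathELength_add ht.1 ht.2]
  have hcne : c ≠ ⊤ := (hc2.trans_le (min_le_left _ _)).ne_top
  rw [← ENNReal.add_lt_add_iff_left hcne, h5, add_comm]
  exact ENNReal.sub_lt_iff_lt_left (ne_top_of_le_ne_top hℓ hv') hv' |>.1 hc1

variable [IsContMDiffRiemannianBundle (𝓡 n) ∞ (EuclideanSpace ℝ (Fin n))
      (fun x : M => TangentSpace (𝓡 n) x)]
  [IsRiemannianManifold (𝓡 n) M]

namespace IsUniformPlaque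

variable {F} {C a r : ℝ} {H : EuclideanSpace ℝ (Fin k) → M} {p : EuclideanSpace ℝ (Fin k)}

omit [IsContMDiffRiemannianBundle (𝓡 n) ∞ (EuclideanSpace ℝ (Fin n))
      (fun x : M => TangentSpace (𝓡 n) x)] in
lemma dist_le' (hH : F.IsUniformPlaque C a r H p) (hC : 0 ≤ C) {q q' : EuclideanSpace ℝ (Fin k)}
    (hq : q ∈ Metric.closedBall p a) (hq' : q' ∈ Metric.closedBall p a) :
    dist (H q) (H q') ≤ C * dist q q' := by
  have h := (F.edist_le_leafEDist).trans (hH.leafEDist_le q hq q' hq')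
  rw [edist_dist] at h
  exact (ENNReal.ofReal_le_ofReal_iff (by positivity)).1 h

omit [IsContMDiffRiemannianBundle (𝓡 n) ∞ (EuclideanSpace ℝ (Fin n))
      (fun x : M => TangentSpace (𝓡 n) x)] [IsRiemannianManifold (𝓡 n) M] in
lemma isClosed_image (hH : F.IsUniformPlaque C a r H p) (s : ℝ) :
    IsClosed (H '' Metric.closedBall p s) :=
  ((isCompact_closedBall p s).image hH.contMDiff.continuous).isClosed

omit [IsContMDiffRiemannianBundle (𝓡 n) ∞ (EuclideanSpace ℝ (Fin n))
      (fun x : M => TangentSpace (𝓡 n) x)] [IsRiemannianManifold (𝓡 n) M] in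
lemma injective (hH : F.IsUniformPlaque C a r H p) : Function.Injective H := by
  obtain ⟨h, t, hh, rfl⟩ := hH.exists_chart
  exact fun q q' hq => (Prod.ext_iff.1 (hh.isOpenEmbedding.injective hq)).1

omit [IsContMDiffRiemannianBundle (𝓡 n) ∞ (EuclideanSpace ℝ (Fin n))
      (fun x : M => TangentSpace (𝓡 n) x)] [IsRiemannianManifold (𝓡 n) M] in
lemma continuousOn_leafEDist (hH : F.IsUniformPlaque C a r H p) (x : M) :
    ContinuousOn (fun q => F.leafEDist x (H q)) (Metric.closedBall p a) := by
  intro q hq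
  have hd : Tendsto (fun q' => ENNReal.ofReal (C * dist q q'))
      (𝓝[Metric.closedBall p a] q) (𝓝 0) := by
    have h1 : Continuous (fun q' => ENNReal.ofReal (C * dist q q')) :=
      ENNReal.continuous_ofReal.comp (by fun_prop)
    simpa using (h1.tendsto q).mono_left nhdsWithin_le_nhds
  have h1 : ∀ q' ∈ Metric.closedBall p a, F.leafEDist x (H q') ≤
      F.leafEDist x (H q) + ENNReal.ofReal (C * dist q q') := fun q' hq' =>
    F.leafEDist_triangle.trans (by gcongr; exact hH.leafEDist_le q hq q' hq')
  have h2 : ∀ q' ∈ Metric.closedBall p a, F.leafEDist x (H q) ≤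
      F.leafEDist x (H q') + ENNReal.ofReal (C * dist q q') := fun q' hq' =>
    F.leafEDist_triangle.trans (by
      gcongr
      rw [dist_comm]
      exact hH.leafEDist_le q' hq' q hq)
  change Tendsto (fun q => F.leafEDist x (H q)) _ (𝓝 (F.leafEDist x (H q)))
  by_cases htop : F.leafEDist x (H q) = ⊤
  · have h3 : ∀ q' ∈ Metric.closedBall p a, F.leafEDist x (H q') = ⊤ := fun q' hq' => by
      have := h2 q' hq'
      rw [htop, top_le_iff, ENNReal.add_eq_top] at this
      exact this.resolve_right ENNReal.ofReal_ne_top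
    rw [htop]
    exact tendsto_const_nhds.congr' (eventually_nhdsWithin_of_forall fun q' hq' => (h3 q' hq').symm)
  rw [ENNReal.tendsto_nhds htop]
  intro ε hε
  filter_upwards [self_mem_nhdsWithin, hd.eventually (ge_mem_nhds hε)] with q' hq' hε'
  exact ⟨tsub_le_iff_right.2 ((h2 q' hq').trans (by gcongr)), (h1 q' hq').trans (by gcongr)⟩

end IsUniformPlaque

variable [CompactSpace M]

/-- At small leaf distance, leaf distance and distance are comparable. -/
lemma exists_leafEDist_le_dist :
    ∃ r > 0, ∃ C : ℝ, 1 ≤ C ∧ ∀ y z, F.leafEDist y z < ENNReal.ofReal r →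
      F.leafEDist y z ≤ ENNReal.ofReal (C * dist y z) := by
  obtain ⟨C, a, r, hC, ha, hr, hCr, hU⟩ := F.exists_uniformPlaque
  refine ⟨r, hr, C * C, by nlinarith, fun y z hyz => ?_⟩
  obtain ⟨H, p, rfl, hH⟩ := hU y
  obtain ⟨q, hq, rfl⟩ := hH.exists_eq z hyz
  have hp := Metric.mem_closedBall_self (x := p) ha.le
  refine (hH.leafEDist_le p hp q hq).trans (ENNReal.ofReal_le_ofReal ?_)
  rw [mul_assoc]
  have := hH.dist_le p hp q hq
  gcongr

omit [IsContMDiffRiemannianBundle (𝓡 n) ∞ (EuclideanSpace ℝ (Fin n))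
      (fun x : M => TangentSpace (𝓡 n) x)] [IsRiemannianManifold (𝓡 n) M] [CompactSpace M] in
lemma exists_finite_ball_cover_of_small {C a r : ℝ} {H : EuclideanSpace ℝ (Fin k) → M}
    {p : EuclideanSpace ℝ (Fin k)} (hC : 1 ≤ C) (hH : F.IsUniformPlaque C a r H p) {η : ℝ}
    (hη : 0 < η) : ∃ t : Set M, t.Finite ∧ F.ball (H p) r ⊆ ⋃ z ∈ t, F.ball z η := by
  obtain ⟨T, hTs, hT, hcov⟩ := (isCompact_closedBall p a).finite_cover_balls
    (e := η / C) (by positivity)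
  refine ⟨H '' T, hT.image _, fun z hz => ?_⟩
  obtain ⟨q, hq, rfl⟩ := hH.exists_eq z hz
  obtain ⟨q', hq', hqq'⟩ := mem_iUnion₂.1 (hcov hq)
  refine mem_iUnion₂.2 ⟨H q', mem_image_of_mem _ hq', ?_⟩
  refine (hH.leafEDist_le q' (hTs hq') q hq).trans_lt
    ((ENNReal.ofReal_lt_ofReal_iff hη).2 ?_)
  rw [dist_comm]
  have hC0 : 0 < C := by linarith
  have : dist q q' < η / C := hqq'
  rw [lt_div_iff₀ hC0] at this
  linarith

/-- Leaf balls are totally bounded for the leaf distance. -/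
lemma exists_finite_ball_cover (x : M) (R : ℝ) {η : ℝ} (hη : 0 < η) :
    ∃ t : Set M, t.Finite ∧ F.ball x R ⊆ ⋃ z ∈ t, F.ball z η := by
  obtain ⟨C, a, r, hC, ha, hr, hCr, hU⟩ := F.exists_uniformPlaque
  have key : ∀ (j : ℕ), ∀ η > 0, ∃ t : Set M, t.Finite ∧
      F.ball x (j * (r / 2)) ⊆ ⋃ z ∈ t, F.ball z η := by
    intro j
    induction j with
    | zero => exact fun η hη => ⟨∅, finite_empty, fun y hy => by simp [mem_ball] at hy⟩
    | succ j ih =>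
      intro η hη
      have hsmall : ∀ z : M, ∃ t : Set M, t.Finite ∧ F.ball z r ⊆ ⋃ w ∈ t, F.ball w η := fun z => by
        obtain ⟨H, p, rfl, hH⟩ := hU z
        exact F.exists_finite_ball_cover_of_small hC hH hη
      choose T hT hcov using hsmall
      rcases Nat.eq_zero_or_pos j with rfl | hj
      · refine ⟨T x, hT x, (F.ball_mono x ?_).trans (hcov x)⟩
        push_cast; linarith
      obtain ⟨t, ht, htcov⟩ := ih (r / 2) (by positivity)
      refine ⟨⋃ z ∈ t, T z, ht.biUnion fun z _ => hT z, fun y hy => ?_⟩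
      have hjr : 0 < (j : ℝ) * (r / 2) := by positivity
      rw [mem_ball, Nat.cast_succ, add_one_mul, ENNReal.ofReal_add hjr.le (by positivity)] at hy
      obtain ⟨w, hw1, hw2⟩ := F.exists_leafEDist_lt_lt (ENNReal.ofReal_pos.2 hjr)
        (by simpa using half_pos hr) hy
      obtain ⟨z, hz, hzw⟩ := mem_iUnion₂.1 (htcov hw1)
      have h2 : y ∈ F.ball z r := add_halves r ▸ mem_ball_add hzw hw2
      obtain ⟨u, hu, huy⟩ := mem_iUnion₂.1 (hcov z h2)
      exact mem_iUnion₂.2 ⟨u, mem_iUnion₂.2 ⟨z, hz, hu⟩, huy⟩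
  obtain ⟨j, hj⟩ := exists_nat_ge (R / (r / 2))
  obtain ⟨t, ht, hcov⟩ := key j η hη
  exact ⟨t, ht, (F.ball_mono x ((div_le_iff₀ (by positivity)).1 hj)).trans hcov⟩

/-- On leaf balls, the topology of `M` and the leaf topology agree. -/
lemma exists_leafEDist_lt_of_mem_closure {A : Set M} {x : M} {R : ℝ} (hA : A ⊆ F.ball x R) {w : M}
    (hw : w ∈ closure A) {ι : ℝ} (hι : 0 < ι) : ∃ w' ∈ A, F.leafEDist w' w < ENNReal.ofReal ι := by
  obtain ⟨C, a, r, hC, ha, hr, hCr, hU⟩ := F.exists_uniformPlaque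
  obtain ⟨t, ht, hcov⟩ := F.exists_finite_ball_cover x R hr
  have hAt : A ⊆ ⋃ z ∈ t, A ∩ F.ball z r := fun y hy => by
    obtain ⟨z, hz, hzy⟩ := mem_iUnion₂.1 (hcov (hA hy))
    exact mem_iUnion₂.2 ⟨z, hz, hy, hzy⟩
  have h1 := closure_mono hAt hw
  rw [ht.closure_biUnion] at h1
  obtain ⟨z, hz, hwz⟩ := mem_iUnion₂.1 h1
  obtain ⟨H, p, rfl, hH⟩ := hU z
  have hsub : A ∩ F.ball (H p) r ⊆ H '' Metric.closedBall p a := fun y hy => hH.exists_eq y hy.2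
  obtain ⟨q, hq, rfl⟩ := closure_minimal hsub (hH.isClosed_image a) hwz
  have hC0 : 0 < C := by linarith
  obtain ⟨w', hw', hdist⟩ := Metric.mem_closure_iff.1 hwz (ι / (C * C)) (by positivity)
  obtain ⟨q', hq', rfl⟩ := hsub hw'
  refine ⟨H q', hw'.1, (hH.leafEDist_le q' hq' q hq).trans_lt
    ((ENNReal.ofReal_lt_ofReal_iff hι).2 ?_)⟩
  calc C * dist q' q ≤ C * (C * dist (H q') (H q)) := by gcongr; exact hH.dist_le q' hq' q hq
    _ < C * (C * (ι / (C * C))) := by rw [dist_comm]; gcongr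
    _ = ι := by field_simp

lemma closure_ball_subset (x : M) {R R' : ℝ} (h : R < R') : closure (F.ball x R) ⊆ F.ball x R' := by
  intro w hw
  obtain ⟨w', hw', hww'⟩ := F.exists_leafEDist_lt_of_mem_closure subset_rfl hw (sub_pos.2 h)
  have := mem_ball_add hw' hww'
  rwa [add_sub_cancel] at this

variable [MeasurableSpace M] [BorelSpace M]

lemma measurableSet_ball (x : M) (R : ℝ) : MeasurableSet (F.ball x R) := by
  obtain ⟨C, a, r, hC, ha, hr, hCr, hU⟩ := F.exists_uniformPlaque
  obtain ⟨t, ht, hcov⟩ := F.exists_finite_ball_cover x R hr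
  choose H p hp hH using hU
  have h1 : F.ball x R =
      ⋃ z ∈ t, H z '' {q ∈ Metric.closedBall (p z) a | F.leafEDist x (H z q) < ENNReal.ofReal R} := by
    ext y
    simp only [mem_iUnion, exists_prop]
    constructor
    · intro hy
      obtain ⟨z, hz, hzy⟩ := mem_iUnion₂.1 (hcov hy)
      obtain ⟨q, hq, rfl⟩ := (hH z).exists_eq y (by rw [hp]; exact hzy)
      exact ⟨z, hz, q, ⟨hq, hy⟩, rfl⟩
    · rintro ⟨z, -, q, ⟨-, hq⟩, rfl⟩
      exact hq
  rw [h1]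
  refine ht.measurableSet_biUnion fun z _ => ?_
  have h2 : MeasurableSet {q ∈ Metric.closedBall (p z) a |
      F.leafEDist x (H z q) < ENNReal.ofReal R} := by
    obtain ⟨U, hU, hU'⟩ := continuousOn_iff'.1 ((hH z).continuousOn_leafEDist x)
      (Iio (ENNReal.ofReal R)) isOpen_Iio
    have : {q ∈ Metric.closedBall (p z) a | F.leafEDist x (H z q) < ENNReal.ofReal R} =
        U ∩ Metric.closedBall (p z) a := by
      rw [← hU']; ext; simp [and_comm]
    rw [this]
    exact hU.measurableSet.inter Metric.isClosed_closedBall.measurableSet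
  exact h2.image_of_continuousOn_injOn (hH z).contMDiff.continuous.continuousOn
    (hH z).injective.injOn

/-- Leaf balls of a fixed small radius have bounded volume. -/
lemma exists_measure_ball_le : ∃ r > 0, ∃ D : ℝ, 0 < D ∧
    ∀ y, μHE[k] (F.ball y r) ≤ ENNReal.ofReal D := by
  obtain ⟨C, a, r, hC, ha, hr, hCr, hU⟩ := F.exists_uniformPlaque
  set V := (C.toNNReal : ℝ≥0∞) ^ (k : ℝ) *
    volume (Metric.closedBall (0 : EuclideanSpace ℝ (Fin k)) a)
  have hV : V ≠ ⊤ := ENNReal.mul_ne_top (by simp) measure_closedBall_lt_top.ne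
  refine ⟨r, hr, V.toReal + 1, by positivity, fun y => ?_⟩
  obtain ⟨H, p, rfl, hH⟩ := hU y
  refine (measure_mono (t := H '' Metric.closedBall p a) fun z hz => hH.exists_eq z hz).trans ?_
  have hlip : LipschitzOnWith C.toNNReal H (Metric.closedBall p a) :=
    LipschitzOnWith.of_dist_le_mul fun q hq q' hq' => by
      rw [Real.coe_toNNReal _ (by linarith)]
      exact hH.dist_le' (by linarith) hq hq'
  refine (hlip.euclideanHausdorffMeasure_image_le k).trans ?_
  rw [EuclideanSpace.euclideanHausdorffMeasure_eq_volume, Measure.addHaar_closedBall_center]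
  exact (ENNReal.ofReal_toReal hV).symm.le.trans (ENNReal.ofReal_le_ofReal (by linarith))

lemma measure_ball_lt_top (x : M) (R : ℝ) : μHE[k] (F.ball x R) < ⊤ := by
  obtain ⟨r, hr, D, hD, h⟩ := F.exists_measure_ball_le
  obtain ⟨t, ht, hcov⟩ := F.exists_finite_ball_cover x R hr
  exact (measure_mono hcov).trans_lt
    ((measure_biUnion_lt_top ht) fun z _ => (h z).trans_lt ENNReal.ofReal_lt_top)

/-- The volume of leaf balls of a fixed radius is bounded below. -/
lemma exists_le_measure_ball {ε : ℝ} (hε : 0 < ε) : ∃ c : ℝ, 0 < c ∧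
    ∀ y, ENNReal.ofReal c ≤ μHE[k] (F.ball y ε) := by
  obtain ⟨C, a, r, hC, ha, hr, hCr, hU⟩ := F.exists_uniformPlaque
  have hC0 : 0 < C := by linarith
  set s := min a (ε / C)
  have hs : 0 < s := by positivity
  set v := volume (Metric.ball (0 : EuclideanSpace ℝ (Fin k)) s)
  have hv : 0 < v := Metric.measure_ball_pos _ _ hs
  have hvt : v ≠ ⊤ := MeasureTheory.measure_ball_lt_top.ne
  set K : ℝ≥0∞ := (C.toNNReal : ℝ≥0∞) ^ (k : ℝ)
  have hK : K ≠ ⊤ := by simp [K]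
  have hK0 : K ≠ 0 := by simp [K, hC0]
  have hvK : v / K ≠ ⊤ := ENNReal.div_ne_top hvt hK0
  refine ⟨(v / K).toReal, ENNReal.toReal_pos (ENNReal.div_pos hv.ne' hK).ne' hvK, fun y => ?_⟩
  rw [ENNReal.ofReal_toReal hvK]
  obtain ⟨H, p, rfl, hH⟩ := hU y
  have hsub : Metric.ball p s ⊆ Metric.closedBall p a :=
    (Metric.ball_subset_ball (min_le_left _ _)).trans Metric.ball_subset_closedBall
  have hball : H '' Metric.ball p s ⊆ F.ball (H p) ε := by
    rintro _ ⟨q, hq, rfl⟩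
    refine (hH.leafEDist_le p (Metric.mem_closedBall_self ha.le) q (hsub hq)).trans_lt
      ((ENNReal.ofReal_lt_ofReal_iff hε).2 ?_)
    have h1 : dist q p < ε / C := lt_of_lt_of_le hq (min_le_right _ _)
    rw [lt_div_iff₀ hC0, dist_comm] at h1
    linarith
  refine le_trans ?_ (measure_mono hball)
  refine ENNReal.div_le_of_le_mul' ?_
  have hinv : ∀ q, Function.invFun H (H q) = q := Function.leftInverse_invFun hH.injective
  have hlip : LipschitzOnWith C.toNNReal (Function.invFun H) (H '' Metric.ball p s) := by
    refine LipschitzOnWith.of_dist_le_mul ?_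
    rintro _ ⟨q, hq, rfl⟩ _ ⟨q', hq', rfl⟩
    rw [hinv, hinv, Real.coe_toNNReal _ hC0.le]
    exact hH.dist_le q (hsub hq) q' (hsub hq')
  have h2 := hlip.euclideanHausdorffMeasure_image_le k
  rw [image_image] at h2
  simp only [hinv, image_id'] at h2
  rwa [EuclideanSpace.euclideanHausdorffMeasure_eq_volume, Measure.addHaar_ball_center] at h2

end LeafBalls

end Foliation

/-! ### Tangent spaces of leaves -/

section Tangent

variable {n k : ℕ} {M : Type*} [MetricSpace M] [ChartedSpace (EuclideanSpace ℝ (Fin n)) M]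
  [IsManifold (𝓡 n) ∞ M]

/-- The velocity of a differentiable path inside a leaf is tangent to the plaques: the coordinate of
the path along the plaque is differentiable by the inverse function theorem. -/
lemma IsFoliatedChart.exists_mfderiv_eq {rel : Setoid M}
    {h : EuclideanSpace ℝ (Fin k) × EuclideanSpace ℝ (Fin (n - k)) → M}
    (hh : IsFoliatedChart (n := n) k rel h) {γ : ℝ → M} (hγ : Continuous γ) {s : ℝ}
    (hd : MDifferentiableAt 𝓘(ℝ, ℝ) (𝓡 n) γ s) {x : M} (hx : ∀ u, rel x (γ u))
    {p : EuclideanSpace ℝ (Fin k)} {t : EuclideanSpace ℝ (Fin (n - k))} (hs : γ s = h (p, t)) :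
    ∃ w, (⟨h (p, t), immDeriv (n := n) (fun q => h (q, t)) p w⟩ : TangentBundle (𝓡 n) M) =
      ⟨γ s, mfderiv 𝓘(ℝ, ℝ) (𝓡 n) γ s 1⟩ := by
  obtain ⟨d, hd0, hd1⟩ := Metric.mem_nhds_iff.1
    (hγ.continuousAt.preimage_mem_nhds (t := range h)
      (hh.isOpenEmbedding.isOpen_range.mem_nhds (hs ▸ mem_range_self (p, t)) :
        range h ∈ 𝓝 (γ s)))
  obtain ⟨c, t', hc, hct⟩ := hh.exists_lift (convex_ball s d).isPreconnected hγ.continuousOn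
    (fun u hu => hd1 hu) (fun u _ => hx u)
  have hsd : s ∈ Metric.ball s d := Metric.mem_ball_self hd0
  have hcs : h (c s, t') = h (p, t) := by rw [← hct s hsd, hs]
  obtain ⟨hcp, rfl⟩ := Prod.ext_iff.1 (hh.isOpenEmbedding.injective hcs)
  simp only at hcp
  set H : EuclideanSpace ℝ (Fin k) → M := fun q => h (q, t') with hH
  have hHs : ContMDiffAt (𝓡 k) (𝓡 n) 1 H p := hh.contMDiff_plaque t' p
  have hsrc := mem_chart_source (EuclideanSpace ℝ (Fin n)) (H p)
  have h1 := (contDiffAt_chart_comp hHs hsrc).hasStrictFDerivAt one_ne_zero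
  rw [(hasFDerivAt_chart_comp (hHs.mdifferentiableAt one_ne_zero) hsrc).fderiv] at h1
  set D := (chartDeriv (H p) (H p)).comp (immDeriv (n := n) H p)
  have hinj : Function.Injective D := by
    intro v w hvw
    apply hh.injective_immDeriv p t'
    have := congrArg (toTangent (H p)) hvw
    rwa [ContinuousLinearMap.comp_apply, ContinuousLinearMap.comp_apply, chartDeriv_self,
      chartDeriv_self] at this
  obtain ⟨B, hB⟩ := D.toLinearMap.exists_leftInverse_of_injective (LinearMap.ker_eq_bot.2 hinj)
  have h2 : HasStrictFDerivAt (fun q => B.toContinuousLinearMap (extChartAt (𝓡 n) (H p) (H q)))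
      ((ContinuousLinearEquiv.refl ℝ (EuclideanSpace ℝ (Fin k)) :
        EuclideanSpace ℝ (Fin k) →L[ℝ] EuclideanSpace ℝ (Fin k))) p := by
    refine (B.toContinuousLinearMap.hasStrictFDerivAt.comp p h1).congr_fderiv ?_
    ext1 v
    exact congrArg (fun T => T v) hB
  have h3 := h2.to_localInverse.hasFDerivAt
  have hsγ : γ s ∈ (chartAt (EuclideanSpace ℝ (Fin n)) (H p)).source := by rw [hs]; exact hsrc
  have h4 := hasDerivAt_chart_comp hd hsγ
  have h5 := B.toContinuousLinearMap.hasFDerivAt.comp_hasDerivAt s h4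
  have hcc : ContinuousAt c s := hc.continuousAt (Metric.ball_mem_nhds s hd0)
  have h6 : ∀ᶠ u in 𝓝 s, c u = h2.localInverse _ _ _
      (B.toContinuousLinearMap (extChartAt (𝓡 n) (H p) (γ u))) := by
    have h7 : ∀ᶠ u in 𝓝 s, _ := hcc.eventually (by rw [hcp]; exact h2.eventually_left_inverse)
    filter_upwards [h7, Metric.ball_mem_nhds s hd0] with u hu hus
    rw [hct u hus]
    exact hu.symm
  have h8 : (⇑B.toContinuousLinearMap ∘ fun u => extChartAt (𝓡 n) (H p) (γ u)) s =
      B.toContinuousLinearMap (extChartAt (𝓡 n) (H p) (H p)) := by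
    simp only [Function.comp_apply, hs]; rfl
  have h9 := (HasFDerivAt.comp_hasDerivAt s (by rw [h8]; exact h3) h5).congr_of_eventuallyEq
    (f₁ := c) h6
  have h10 := mfderiv_comp_one (n := n) (H := H) (ℓ := c)
    ((hh.contMDiff_plaque t' _).mdifferentiableAt one_ne_zero) h9
  have h11 : γ =ᶠ[𝓝 s] fun u => H (c u) := by
    filter_upwards [Metric.ball_mem_nhds s hd0] with u hu using hct u hu
  have h12 := congrArg (fun T => T 1) (h11.mfderiv_eq (I := 𝓘(ℝ, ℝ)) (I' := 𝓡 n))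
  refine ⟨B.toContinuousLinearMap (chartDeriv (H p) (γ s) (mfderiv 𝓘(ℝ, ℝ) (𝓡 n) γ s 1)), ?_⟩
  · have h13 := congrArg (fun q => (⟨H q, immDeriv (n := n) H q (B.toContinuousLinearMap
      (chartDeriv (H p) (γ s) (mfderiv 𝓘(ℝ, ℝ) (𝓡 n) γ s 1)))⟩ : TangentBundle (𝓡 n) M)) hcp
    refine h13.symm.trans ?_
    exact congrArg₂ (fun (y : M) (v : EuclideanSpace ℝ (Fin n)) =>
      (⟨y, v⟩ : TangentBundle (𝓡 n) M)) (hct s hsd).symm (h12.trans h10).symm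

namespace Foliation

variable (F : Foliation n k M)

lemma mfderiv_mem_tangent {γ : ℝ → M} (hγ : ContMDiff 𝓘(ℝ, ℝ) (𝓡 n) 1 γ) {x : M}
    (hx : ∀ u, γ u ∈ F.leaf x) (s : ℝ) : mfderiv 𝓘(ℝ, ℝ) (𝓡 n) γ s 1 ∈ F.tangent (γ s) := by
  obtain ⟨h, hh, ⟨⟨p, t⟩, hp⟩⟩ := F.exists_chart (γ s)
  obtain ⟨w, hw⟩ := hh.exists_mfderiv_eq hγ.continuous ((hγ s).mdifferentiableAt one_ne_zero) hx
    hp.symm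
  exact Submodule.subset_span ⟨h, hh, p, t, w, hw⟩

lemma tangent_eq_range {h : EuclideanSpace ℝ (Fin k) × EuclideanSpace ℝ (Fin (n - k)) → M}
    (hh : IsFoliatedChart (n := n) k F.rel h) (p : EuclideanSpace ℝ (Fin k))
    (t : EuclideanSpace ℝ (Fin (n - k))) :
    F.tangent (h (p, t)) = LinearMap.range (immDeriv (n := n) (fun q => h (q, t)) p).toLinearMap := by
  apply le_antisymm
  · refine Submodule.span_le.2 ?_
    rintro v ⟨h', hh', p', t', w, hw⟩
    change EuclideanSpace ℝ (Fin k) at w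
    have e0 : h' (p', t') = h (p, t) := congrArg TotalSpace.proj hw
    let ℓ : ℝ → EuclideanSpace ℝ (Fin k) := fun s => p' + s • w
    have hℓs : ContDiff ℝ 1 ℓ := by fun_prop
    have hγ : ContMDiff 𝓘(ℝ, ℝ) (𝓡 n) 1 (fun s => h' (ℓ s, t')) :=
      (hh'.contMDiff_plaque t').comp (contMDiff_iff_contDiff.2 hℓs)
    have hℓ0 : ℓ 0 = p' := by simp [ℓ]
    have hℓd : HasDerivAt ℓ w 0 := by
      have h6 := ((hasDerivAt_id (0 : ℝ)).smul_const w).const_add p'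
      rw [one_smul] at h6
      exact h6
    obtain ⟨w', hw'⟩ := hh.exists_mfderiv_eq hγ.continuous
      ((hγ 0).mdifferentiableAt one_ne_zero) (x := h' (p', t')) (fun u => hh'.rel_plaque _ _ _)
      (p := p) (t := t) (by simp only [hℓ0, e0])
    rw [mfderiv_comp_one (n := n) (H := fun q => h' (q, t'))
      ((hh'.contMDiff_plaque t' _).mdifferentiableAt one_ne_zero) hℓd] at hw'
    have h1 := congrArg (fun q => (⟨h' (q, t'), immDeriv (n := n) (fun q => h' (q, t')) q w⟩ :
      TangentBundle (𝓡 n) M)) hℓ0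
    have h2 := (hw'.trans h1).trans hw
    exact ⟨w', eq_of_heq (TotalSpace.mk.inj h2).2⟩
  · rintro _ ⟨w, rfl⟩
    exact Submodule.subset_span ⟨h, hh, p, t, w, rfl⟩

lemma IsUniformPlaque.tangent_eq_range [RiemannianBundle (fun x : M => TangentSpace (𝓡 n) x)]
    {F : Foliation n k M} {C a r : ℝ}
    {H : EuclideanSpace ℝ (Fin k) → M} {p : EuclideanSpace ℝ (Fin k)}
    (hH : F.IsUniformPlaque C a r H p) (q : EuclideanSpace ℝ (Fin k)) :
    F.tangent (H q) = LinearMap.range (immDeriv (n := n) H q).toLinearMap := by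
  obtain ⟨h, t, hh, rfl⟩ := hH.exists_chart
  exact F.tangent_eq_range hh q t

end Foliation

end Tangent

/-! ### Invariant foliations -/

section Invariant

variable {n k : ℕ} {M : Type*} [MetricSpace M] [ChartedSpace (EuclideanSpace ℝ (Fin n)) M]

lemma Diffeomorph.contMDiff_iterate (f : M ≃ₘ^1⟮𝓡 n, 𝓡 n⟯ M) (j : ℕ) :
    ContMDiff (𝓡 n) (𝓡 n) 1 f^[j] := by
  induction j with
  | zero => exact contMDiff_id
  | succ j ih => exact ih.comp f.contMDiff

lemma Diffeomorph.leftInverse_iterate (f : M ≃ₘ^1⟮𝓡 n, 𝓡 n⟯ M) (j : ℕ) :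
    Function.LeftInverse f.symm^[j] f^[j] :=
  Function.LeftInverse.iterate f.symm_apply_apply j

lemma Diffeomorph.rightInverse_iterate (f : M ≃ₘ^1⟮𝓡 n, 𝓡 n⟯ M) (j : ℕ) :
    Function.RightInverse f.symm^[j] f^[j] :=
  Function.LeftInverse.iterate f.apply_symm_apply j

lemma Diffeomorph.mfderiv_symm_iterate (f : M ≃ₘ^1⟮𝓡 n, 𝓡 n⟯ M) (j : ℕ) (y : M)
    (v : TangentSpace (𝓡 n) y) :
    mfderiv (𝓡 n) (𝓡 n) f.symm^[j] (f^[j] y) (mfderiv (𝓡 n) (𝓡 n) f^[j] y v) = v := by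
  have h1 := mfderiv_comp y
    ((f.symm.contMDiff_iterate j (f^[j] y)).mdifferentiableAt one_ne_zero)
    ((f.contMDiff_iterate j y).mdifferentiableAt one_ne_zero)
  have h2 : f.symm^[j] ∘ f^[j] = id := funext (f.leftInverse_iterate j)
  rw [h2, mfderiv_id] at h1
  exact (congrArg (fun T => T v) h1).symm

lemma Diffeomorph.norm_mfderiv_symm_iterate [RiemannianBundle (fun x : M => TangentSpace (𝓡 n) x)]
    (f : M ≃ₘ^1⟮𝓡 n, 𝓡 n⟯ M) (j : ℕ) (y : M) (v : TangentSpace (𝓡 n) y) :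
    ‖mfderiv (𝓡 n) (𝓡 n) f.symm^[j] (f^[j] y) (mfderiv (𝓡 n) (𝓡 n) f^[j] y v)‖ = ‖v‖ := by
  rw [f.mfderiv_symm_iterate]
  exact congrArg (fun y' : M => ‖(show TangentSpace (𝓡 n) y' from v)‖) (f.leftInverse_iterate j y)

variable [IsManifold (𝓡 n) ∞ M]

namespace Foliation

variable {F : Foliation n k M} {f : M ≃ₘ^1⟮𝓡 n, 𝓡 n⟯ M}

lemma IsInvariant.map_mem_leaf (hF : F.IsInvariant f) {x y : M} (h : y ∈ F.leaf x) :
    f y ∈ F.leaf (f x) := hF x ▸ mem_image_of_mem f h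

lemma IsInvariant.symm (hF : F.IsInvariant f) : F.IsInvariant f.symm := by
  intro x
  have h := hF (f.symm x)
  rw [f.apply_symm_apply] at h
  rw [← h, image_image]
  simp

lemma IsInvariant.iterate_mem_leaf (hF : F.IsInvariant f) {x y : M} (h : y ∈ F.leaf x) (j : ℕ) :
    f^[j] y ∈ F.leaf (f^[j] x) := by
  induction j with
  | zero => exact h
  | succ j ih =>
    rw [Function.iterate_succ_apply', Function.iterate_succ_apply']
    exact hF.map_mem_leaf ih

variable [RiemannianBundle (fun x : M => TangentSpace (𝓡 n) x)]

omit [IsManifold (𝓡 n) ∞ M] in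
lemma _root_.pathELength_comp_le {g : M → M} (hg : ContMDiff (𝓡 n) (𝓡 n) 1 g) {γ : ℝ → M}
    (hγ : ContMDiff 𝓘(ℝ, ℝ) (𝓡 n) 1 γ) {a b C : ℝ} (hC : 0 ≤ C)
    (h : ∀ s ∈ Icc a b, ‖mfderiv (𝓡 n) (𝓡 n) g (γ s) (mfderiv 𝓘(ℝ, ℝ) (𝓡 n) γ s 1)‖ ≤
      C * ‖mfderiv 𝓘(ℝ, ℝ) (𝓡 n) γ s 1‖) :
    pathELength (𝓡 n) (fun s => g (γ s)) a b ≤ ENNReal.ofReal C * pathELength (𝓡 n) γ a b := by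
  rw [pathELength_eq_lintegral_mfderiv_Icc, pathELength_eq_lintegral_mfderiv_Icc,
    ← lintegral_const_mul' _ _ ENNReal.ofReal_ne_top]
  refine setLIntegral_mono' measurableSet_Icc fun s hs => ?_
  have h1 := mfderiv_comp s ((hg (γ s)).mdifferentiableAt one_ne_zero)
    ((hγ s).mdifferentiableAt one_ne_zero)
  have h2 : mfderiv 𝓘(ℝ, ℝ) (𝓡 n) (fun s => g (γ s)) s 1 =
      mfderiv (𝓡 n) (𝓡 n) g (γ s) (mfderiv 𝓘(ℝ, ℝ) (𝓡 n) γ s 1) :=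
    congrArg (fun T => T 1) h1
  rw [h2, ← ofReal_norm, ← ofReal_norm, ← ENNReal.ofReal_mul hC]
  exact ENNReal.ofReal_le_ofReal (h s hs)

lemma leafEDist_map_le {g : M → M} (hg : ContMDiff (𝓡 n) (𝓡 n) 1 g)
    (hgF : ∀ x, ∀ y ∈ F.leaf x, g y ∈ F.leaf (g x)) {L : ℝ} (hL : 0 < L)
    (h : ∀ (y : M) (v : TangentSpace (𝓡 n) y), ‖mfderiv (𝓡 n) (𝓡 n) g y v‖ ≤ L * ‖v‖) (y z : M) :
    F.leafEDist (g y) (g z) ≤ ENNReal.ofReal L * F.leafEDist y z := by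
  have hL0 : ENNReal.ofReal L ≠ 0 := by simpa using hL
  refine le_of_forall_gt fun c hc => ?_
  have hc' : F.leafEDist y z < c / ENNReal.ofReal L := by
    rw [ENNReal.lt_div_iff_mul_lt (.inl hL0) (.inl ENNReal.ofReal_ne_top), mul_comm]
    exact hc
  obtain ⟨γ, h0, h1, hγ, hγF, hlen, -⟩ := F.exists_path_of_leafEDist_lt hc' zero_lt_one
  have h2 := F.leafEDist_le_pathELength (γ := fun s => g (γ s)) (hg.comp hγ).contMDiffOn
    (fun t _ => hgF _ _ (F.mem_leaf_trans (F.mem_leaf_symm (hγF 0)) (hγF t))) zero_le_one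
  simp only [h0, h1] at h2
  refine (h2.trans (pathELength_comp_le hg hγ hL.le fun s _ => h _ _)).trans_lt ?_
  rw [mul_comm]
  exact (ENNReal.lt_div_iff_mul_lt (.inl hL0) (.inl ENNReal.ofReal_ne_top)).1 hlen

variable [IsContMDiffRiemannianBundle (𝓡 n) ∞ (EuclideanSpace ℝ (Fin n))
      (fun x : M => TangentSpace (𝓡 n) x)]
  [CompactSpace M]

/-- The map is Lipschitz for the leaf distance. -/
lemma IsInvariant.exists_leafEDist_le (hF : F.IsInvariant f) :
    ∃ L : ℝ, 1 ≤ L ∧ ∀ (y z : M), F.leafEDist (f y) (f z) ≤ ENNReal.ofReal L * F.leafEDist y z := by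
  obtain ⟨L, hL, h⟩ := exists_norm_mfderiv_le f.contMDiff
  exact ⟨L, hL, leafEDist_map_le f.contMDiff (fun x y hy => hF.map_mem_leaf hy) (by linarith) h⟩

lemma IsInvariant.exists_leafEDist_iterate_le (hF : F.IsInvariant f) (j : ℕ) :
    ∃ L : ℝ, 1 ≤ L ∧ ∀ (y z : M),
      F.leafEDist (f^[j] y) (f^[j] z) ≤ ENNReal.ofReal L * F.leafEDist y z := by
  obtain ⟨L, hL, h⟩ := exists_norm_mfderiv_le (f.contMDiff_iterate j)
  exact ⟨L, hL, leafEDist_map_le (f.contMDiff_iterate j) (fun x y hy => hF.iterate_mem_leaf hy j)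
    (by linarith) h⟩

/-- `f^{-j}`, for `j ≤ m`, does not expand leaf distances by more than `C` near a point `z` of
`f^m (W(x, δ/2))`, if its derivative is bounded by `C` along `f^m (W(x, δ))`. A short path
starting from `z` stays inside `f^m (W(x, δ))`, since its image by `f^{-m}` has to be short up to the
first exit. -/
lemma IsInvariant.leafEDist_symm_iterate_lt (hF : F.IsInvariant f) {x : M} {δ C : ℝ}
    (hC : 0 < C)
    {m : ℕ} (hX : ∀ j ≤ m, ∀ z, f.symm^[m] z ∈ F.ball x δ → ∀ v ∈ F.tangent z,
      ‖mfderiv (𝓡 n) (𝓡 n) f.symm^[j] z v‖ ≤ C * ‖v‖) {s : ℝ} (hCs : C * s ≤ δ / 2) {z w : M}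
    (hz : f.symm^[m] z ∈ F.ball x (δ / 2)) (hw : w ∈ F.ball z s) {j : ℕ} (hj : j ≤ m) :
    f.symm^[j] w ∈ F.ball (f.symm^[j] z) (C * s) := by
  obtain ⟨γ, h0, h1, hγ, hγF, hlen, -⟩ := F.exists_path_of_leafEDist_lt hw zero_lt_one
  have hs : 0 < s := ENNReal.ofReal_pos.1 (bot_le.trans_lt hlen)
  have hsm : ∀ j, ContMDiff 𝓘(ℝ, ℝ) (𝓡 n) 1 (fun u => f.symm^[j] (γ u)) := fun j =>
    (f.symm.contMDiff_iterate j).comp hγ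
  have hleaf : ∀ j t, f.symm^[j] (γ t) ∈ F.leaf (f.symm^[j] z) := fun j t =>
    hF.symm.iterate_mem_leaf (hγF t) j
  have hdist : ∀ j, ∀ t ≥ (0 : ℝ), F.leafEDist (f.symm^[j] z) (f.symm^[j] (γ t)) ≤
      pathELength (𝓡 n) (fun u => f.symm^[j] (γ u)) 0 t := fun j t ht => by
    have := F.leafEDist_le_pathELength (γ := fun u => f.symm^[j] (γ u)) (a := 0) (b := t)
      (hsm j).contMDiffOn
      (fun t _ => F.mem_leaf_trans (F.mem_leaf_symm (hleaf j 0)) (hleaf j t)) ht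
    simpa only [h0] using this
  have hbound : ∀ j ≤ m, ∀ t, (∀ u ∈ Icc 0 t, f.symm^[m] (γ u) ∈ F.ball x δ) →
      pathELength (𝓡 n) (fun u => f.symm^[j] (γ u)) 0 t ≤
        ENNReal.ofReal C * pathELength (𝓡 n) γ 0 t := fun j hj t ht =>
    pathELength_comp_le (f.symm.contMDiff_iterate j) hγ hC.le fun u hu =>
      hX j hj _ (ht u hu) _ (F.mfderiv_mem_tangent hγ hγF u)
  have hstay : ∀ t, (∀ u ∈ Icc 0 t, pathELength (𝓡 n) (fun u => f.symm^[m] (γ u)) 0 u <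
      ENNReal.ofReal (δ / 2)) → ∀ u ∈ Icc 0 t, f.symm^[m] (γ u) ∈ F.ball x δ :=
    fun t ht u hu => by
      have := mem_ball_add hz (mem_ball.2 ((hdist m u hu.1).trans_lt (ht u hu)))
      rwa [add_halves] at this
  have hCs' : ∀ t ≤ (1 : ℝ), ENNReal.ofReal C * pathELength (𝓡 n) γ 0 t < ENNReal.ofReal (C * s) := by
    intro t ht
    rw [ENNReal.ofReal_mul hC.le]
    exact ENNReal.mul_lt_mul_right (by simpa using hC) ENNReal.ofReal_ne_top
      ((pathELength_mono le_rfl ht).trans_lt hlen)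
  set ℓ := pathELength (𝓡 n) (fun u => f.symm^[m] (γ u)) 0 1
  have hℓfin : ℓ ≠ ⊤ := by
    obtain ⟨L, hL, h⟩ := exists_norm_mfderiv_le (f.symm.contMDiff_iterate m)
    refine ne_top_of_le_ne_top (ENNReal.mul_ne_top (ENNReal.ofReal_ne_top (r := L)) hlen.ne_top)
      (pathELength_comp_le (f.symm.contMDiff_iterate m) hγ (by linarith) fun u _ => h _ _)
  have hℓ : ℓ < ENNReal.ofReal (δ / 2) := by
    by_contra! hcon
    obtain ⟨v, hv1, hv2⟩ := exists_between
      ((hCs' 1 le_rfl).trans_le (ENNReal.ofReal_le_ofReal hCs))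
    obtain ⟨t, ht, htv⟩ := exists_pathELength_eq zero_le_one hℓfin (hv2.le.trans hcon)
    have h3 := hbound m le_rfl t (hstay t fun u hu =>
      ((pathELength_mono le_rfl hu.2).trans htv.le).trans_lt hv2)
    rw [htv] at h3
    exact absurd (h3.trans (mul_le_mul_right (pathELength_mono le_rfl ht.2) _)) hv1.not_ge
  have h4 := (hdist j 1 zero_le_one).trans ((hbound j hj 1 (hstay 1 fun u hu =>
    (pathELength_mono le_rfl hu.2).trans_lt hℓ)))
  rw [h1] at h4
  exact h4.trans_lt (hCs' 1 le_rfl)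

end Foliation

end Invariant

/-! ### Bounded backward derivatives for partially hyperbolic diffeomorphisms -/

section BackwardDerivatives

variable {n k : ℕ} {M : Type*} [MetricSpace M] [ChartedSpace (EuclideanSpace ℝ (Fin n)) M]
  [IsManifold (𝓡 n) ∞ M] {F : Foliation n k M} {f : M ≃ₘ^1⟮𝓡 n, 𝓡 n⟯ M}
  [RiemannianBundle (fun x : M => TangentSpace (𝓡 n) x)]

omit [IsManifold (𝓡 n) ∞ M] in
lemma IsPartiallyHyperbolic.exists_norm_mfderiv_symm_le
    {Es Ec Eu : ∀ x : M, Submodule ℝ (TangentSpace (𝓡 n) x)} (h : IsPartiallyHyperbolic f Es Ec Eu) :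
    ∃ C : ℝ, 1 ≤ C ∧ ∀ (j : ℕ) (z : M), ∀ v ∈ Eu z,
      ‖mfderiv (𝓡 n) (𝓡 n) f.symm^[j] z v‖ ≤ C * ‖v‖ := by
  obtain ⟨lam₁, lam₂, γ₁, γ₂, μ₁, μ₂, C, h1, h2, h3, h4, h5, h6, h7, hC, -, -, hu⟩ := h.exists_rates
  refine ⟨C, hC, fun j z v hv => ?_⟩
  have hlift : ∀ j (y : M), ∀ v ∈ Eu (f^[j] y), ∃ v' ∈ Eu y, mfderiv (𝓡 n) (𝓡 n) f^[j] y v' = v := by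
    intro j
    induction j with
    | zero => exact fun y v hv => ⟨v, hv, congrArg (fun T => T v) (mfderiv_id (I := 𝓡 n) (x := y))⟩
    | succ j ih =>
      intro y v hv
      obtain ⟨v₁, hv₁, rfl⟩ := ih (f y) v hv
      rw [← h.map_u y] at hv₁
      obtain ⟨v', hv', rfl⟩ := hv₁
      refine ⟨v', hv', ?_⟩
      have h8 := mfderiv_comp y ((f.contMDiff_iterate j (f y)).mdifferentiableAt one_ne_zero)
        ((f.contMDiff y).mdifferentiableAt one_ne_zero)
      exact congrArg (fun T => T v') h8
  obtain ⟨y, rfl⟩ := (f.rightInverse_iterate j).surjective z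
  obtain ⟨v', hv', rfl⟩ := hlift j y v hv
  rw [f.norm_mfderiv_symm_iterate]
  have h9 := (hu y v' hv' j).1
  have h10 : (1 : ℝ) ≤ μ₁ ^ j := one_le_pow₀ (by linarith)
  have hC0 : 0 < C := by linarith
  calc ‖v'‖ = C * (C⁻¹ * 1 * ‖v'‖) := by field_simp
    _ ≤ C * (C⁻¹ * μ₁ ^ j * ‖v'‖) := by gcongr
    _ ≤ C * ‖mfderiv (𝓡 n) (𝓡 n) f^[j] y v'‖ := by gcongr

end BackwardDerivatives

/-! ### Bounded backward derivatives along expanding foliations -/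

section ExpandingFoliations

variable {n k : ℕ} {M : Type*} [MetricSpace M] [ChartedSpace (EuclideanSpace ℝ (Fin n)) M]
  [IsManifold (𝓡 n) ∞ M] {F : Foliation n k M} {f : M ≃ₘ^1⟮𝓡 n, 𝓡 n⟯ M}
  [RiemannianBundle (fun x : M => TangentSpace (𝓡 n) x)]

/-- A function with positive derivative `σ` in the direction `w` at `p₀` grows at least at rate
`b < σ` in the direction `w`, near `p₀`. -/
lemma HasStrictFDerivAt.exists_le_sub {V : Type*} [NormedAddCommGroup V] [NormedSpace ℝ V]
    {u : V → ℝ} {u' : V →L[ℝ] ℝ} {p₀ w : V} (hu : HasStrictFDerivAt u u' p₀) {b : ℝ}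
    (hb : b < u' w) : ∃ κ > 0, ∀ p ∈ Metric.ball p₀ κ, ∀ s ≥ (0 : ℝ),
      p + s • w ∈ Metric.ball p₀ κ → b * s ≤ u (p + s • w) - u p := by
  obtain ⟨ι, hι, hι'⟩ := exists_pos_mul_lt (sub_pos.2 hb) ‖w‖
  have h1 := (Asymptotics.isLittleO_iff.1 hu.isLittleO) hι
  obtain ⟨κ, hκ, h2⟩ := Metric.eventually_nhds_iff_ball.1 h1
  refine ⟨κ, hκ, fun p hp s hs hps => ?_⟩
  have h3 := h2 (p + s • w, p) (by rw [← ball_prod_same]; exact ⟨hps, hp⟩)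
  simp only [add_sub_cancel_left, map_smul, smul_eq_mul, norm_smul, Real.norm_eq_abs,
    abs_of_nonneg hs] at h3
  have h4 := (abs_le.1 h3).1
  nlinarith

variable [IsContMDiffRiemannianBundle (𝓡 n) ∞ (EuclideanSpace ℝ (Fin n))
      (fun x : M => TangentSpace (𝓡 n) x)]
  [IsRiemannianManifold (𝓡 n) M]

omit [IsRiemannianManifold (𝓡 n) M] in
/-- In a plaque, moving the parameter in the direction of a unit vector `w` moves the point of the
leaf at speed at most `c`, near the base point. -/
lemma IsFoliatedChart.exists_leafEDist_add_smul_le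
    {h : EuclideanSpace ℝ (Fin k) × EuclideanSpace ℝ (Fin (n - k)) → M}
    (hh : IsFoliatedChart (n := n) k F.rel h) (p₀ w : EuclideanSpace ℝ (Fin k))
    (t : EuclideanSpace ℝ (Fin (n - k))) {c : ℝ} (hc : 1 < c)
    (hw : ‖immDeriv (n := n) (fun q => h (q, t)) p₀ w‖ = 1) :
    ∃ κ > 0, ∀ p ∈ Metric.ball p₀ κ, ∀ s ≥ (0 : ℝ), p + s • w ∈ Metric.ball p₀ κ →
      F.leafEDist (h (p, t)) (h (p + s • w, t)) ≤ ENNReal.ofReal (c * s) := by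
  set b := Real.sqrt c with hb
  have hb1 : 1 < b := Real.lt_sqrt_of_sq_lt (by simpa using hc)
  have hbc : b * b = c := Real.mul_self_sqrt (by linarith)
  have h1 := (hh.isOpenEmbedding.continuous.continuousAt (x := (p₀, t))).eventually
    (eventually_norm_chartDeriv (n := n) (h (p₀, t)) hb1)
  have h2 : ContinuousAt (fun a : EuclideanSpace ℝ (Fin k) × EuclideanSpace ℝ (Fin (n - k)) =>
      ‖toTangent (n := n) (h (p₀, t)) (((chartDeriv (h (p₀, t)) (h a)).comp
        (immDeriv (n := n) (fun q => h (q, a.2)) a.1)) w)‖) (p₀, t) :=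
    ((toTangent (n := n) (h (p₀, t))).continuous.continuousAt.comp
      ((hh.continuousAt_deriv (p₀, t)).clm_apply continuousAt_const)).norm
  have hlt : ‖toTangent (n := n) (h (p₀, t)) (((chartDeriv (h (p₀, t)) (h (p₀, t))).comp
        (immDeriv (n := n) (fun q => h (q, t)) p₀)) w)‖ < b := by
    rw [ContinuousLinearMap.comp_apply, chartDeriv_self, hw]
    exact hb1
  have h3 := Filter.Tendsto.eventually_lt_const hlt h2
  obtain ⟨κ, hκ, h4⟩ := Metric.eventually_nhds_iff_ball.1 (h1.and h3)
  refine ⟨κ, hκ, fun p hp s hs hps => ?_⟩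
  have h5 : ∀ q ∈ Metric.ball p₀ κ, ‖immDeriv (n := n) (fun q => h (q, t)) q w‖ ≤ c := by
    intro q hq
    obtain ⟨h6, h7⟩ := h4 (q, t) (by
      rw [← ball_prod_same]; exact ⟨hq, Metric.mem_ball_self hκ⟩)
    rw [← hbc]
    refine (h6 _).2.trans ?_
    gcongr
    exact h7.le
  let ℓ : ℝ → EuclideanSpace ℝ (Fin k) := fun u => p + u • w
  have hℓ : ∀ u ∈ Icc (0 : ℝ) s, ℓ u ∈ Metric.ball p₀ κ := fun u hu => by
    rcases hs.eq_or_lt with rfl | hs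
    · obtain rfl : u = 0 := le_antisymm hu.2 hu.1
      simpa [ℓ] using hp
    have h8 := (convex_ball p₀ κ).add_smul_mem hp hps (t := u / s)
      ⟨div_nonneg hu.1 hs.le, div_le_one_of_le₀ hu.2 hs.le⟩
    rwa [smul_smul, div_mul_cancel₀ _ hs.ne'] at h8
  have hℓs : ContDiff ℝ 1 ℓ := by fun_prop
  have hγ : ContMDiff 𝓘(ℝ, ℝ) (𝓡 n) 1 (fun s => h (ℓ s, t)) :=
    (hh.contMDiff_plaque t).comp (contMDiff_iff_contDiff.2 hℓs)
  have h9 := F.leafEDist_le_pathELength (γ := fun s => h (ℓ s, t)) (a := 0) (b := s) hγ.contMDiffOn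
    (fun s _ => hh.rel_plaque _ _ _) hs
  have e0 : ℓ 0 = p := by simp [ℓ]
  simp only [e0] at h9
  refine h9.trans ?_
  rw [pathELength_eq_lintegral_mfderiv_Icc]
  refine (setLIntegral_mono' (g := fun _ => ENNReal.ofReal c)
    measurableSet_Icc fun u hu => ?_).trans ?_
  · have h10 : HasDerivAt ℓ w u := by
      have h6 := ((hasDerivAt_id u).smul_const w).const_add p
      rw [one_smul] at h6
      exact h6
    rw [mfderiv_comp_one (H := fun q => h (q, t))
        ((hh.contMDiff_plaque t (ℓ u)).mdifferentiableAt one_ne_zero) h10, ← ofReal_norm]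
    exact ENNReal.ofReal_le_ofReal (h5 _ (hℓ u hu))
  · rw [lintegral_const, Measure.restrict_apply_univ, Real.volume_Icc, sub_zero,
      ENNReal.ofReal_mul (by linarith)]

variable [CompactSpace M]

set_option maxHeartbeats 1000000 in
/-- Along an expanding foliation, backward iterates do not expand tangent vectors. Otherwise, one
could remove from `f^m (W(x, δ))` the slab of the points near `z` with
`|⟨e, f^{-j} y - f^{-j} z⟩| < c ε`, where `e` is the direction of `D f^{-j} v`: since `D f^{-j}`
expands `v`, the remaining set is still an `ε`-net, while no point of its image by `f^{-j}` is
`ε`-close to `f^{-j} z`. -/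
lemma Foliation.IsExpanding.exists_norm_mfderiv_symm_le (hF : F.IsExpanding f) (x : M) {δ : ℝ}
    (hδ : 0 < δ) : ∃ N : ℕ, ∀ m ≥ N, ∀ j ≤ m, ∀ z, f.symm^[m] z ∈ F.ball x δ →
      ∀ v ∈ F.tangent z, ‖mfderiv (𝓡 n) (𝓡 n) f.symm^[j] z v‖ ≤ ‖v‖ := by
  obtain ⟨hinv, hexp⟩ := hF
  obtain ⟨N, -, hN⟩ := hexp x δ hδ
  refine ⟨N, fun m hm j hj z hz v hv => ?_⟩
  by_contra! hcon
  rcases Nat.eq_zero_or_pos j with rfl | hj0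
  · exact absurd (congrArg (fun T => ‖(T v : TangentSpace (𝓡 n) z)‖)
      (mfderiv_id (I := 𝓡 n) (x := z))) hcon.ne'
  obtain ⟨C, a, r, hC, ha, hr, hCr, hU⟩ := F.exists_uniformPlaque
  obtain ⟨H, p₀, rfl, hH⟩ := hU z
  obtain ⟨h, t, hh, rfl⟩ := hH.exists_chart
  set H : EuclideanSpace ℝ (Fin k) → M := fun q => h (q, t) with hHdef
  rw [hH.tangent_eq_range p₀] at hv
  obtain ⟨w, rfl⟩ := hv
  set G : EuclideanSpace ℝ (Fin k) → M := fun q => f.symm^[j] (H q) with hG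
  have hGs : ContMDiff (𝓡 k) (𝓡 n) 1 G := (f.symm.contMDiff_iterate j).comp hH.contMDiff
  have hGd : ∀ w, immDeriv (n := n) G p₀ w =
      mfderiv (𝓡 n) (𝓡 n) f.symm^[j] (H p₀) (immDeriv (n := n) H p₀ w) := fun w =>
    congrArg (fun T => T w) (mfderiv_comp p₀
      ((f.symm.contMDiff_iterate j (H p₀)).mdifferentiableAt one_ne_zero)
      ((hH.contMDiff p₀).mdifferentiableAt one_ne_zero))
  change ‖immDeriv (n := n) H p₀ w‖ < _ at hcon
  have hcon' : ‖immDeriv (n := n) H p₀ w‖ < ‖immDeriv (n := n) G p₀ w‖ := by rw [hGd]; exact hcon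
  have hv0 : 0 < ‖immDeriv (n := n) H p₀ w‖ := by
    rw [norm_pos_iff]
    intro h0
    rw [hGd, h0, map_zero, norm_zero, norm_zero] at hcon'
    exact lt_irrefl _ hcon'
  -- normalize the tangent vector
  obtain ⟨w₀, hw₀, hσ⟩ : ∃ w₀, ‖immDeriv (n := n) H p₀ w₀‖ = 1 ∧ 1 < ‖immDeriv (n := n) G p₀ w₀‖ := by
    refine ⟨‖immDeriv (n := n) H p₀ w‖⁻¹ • w, ?_, ?_⟩
    · rw [map_smul, norm_smul, norm_inv, norm_norm, inv_mul_cancel₀ hv0.ne']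
    · rw [map_smul, norm_smul, norm_inv, norm_norm, inv_mul_eq_div, one_lt_div hv0]
      exact hcon'
  clear hcon hcon' hv0
  set σ := ‖immDeriv (n := n) G p₀ w₀‖ with hσdef
  obtain ⟨b, hb1, hbσ⟩ := exists_between hσ
  obtain ⟨c, hc1, hcb⟩ : ∃ c : ℝ, 1 < c ∧ c * c < b := by
    obtain ⟨b', hb1', hb'⟩ := exists_between hb1
    refine ⟨Real.sqrt b', Real.lt_sqrt_of_sq_lt (by simpa using hb1'), ?_⟩
    rwa [Real.mul_self_sqrt (by linarith)]
  have hc0 : 0 < c := by linarith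
  have hb0 : 0 < b := by linarith
  -- the slab function
  set e := σ⁻¹ • immDeriv (n := n) G p₀ w₀ with he
  have hen : ‖e‖ = 1 := by
    rw [he, norm_smul, norm_inv, ← hσdef, norm_norm, inv_mul_cancel₀ (by linarith)]
  let χ : EuclideanSpace ℝ (Fin k) → TangentSpace (𝓡 n) (G p₀) := fun q =>
    toTangent (n := n) (G p₀) (extChartAt (𝓡 n) (G p₀) (G q))
  let u : EuclideanSpace ℝ (Fin k) → ℝ := fun q => inner ℝ e (χ q - χ p₀)
  have hu : HasStrictFDerivAt u ((innerSL ℝ e).comp (immDeriv (n := n) G p₀)) p₀ := by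
    have h1 := hasStrictFDerivAt_toTangent_chart (hGs p₀)
    exact (innerSL ℝ e).hasStrictFDerivAt.comp p₀ (h1.sub_const (χ p₀))
  have huw : b < ((innerSL ℝ e).comp (immDeriv (n := n) G p₀)) w₀ := by
    rw [ContinuousLinearMap.comp_apply, innerSL_apply_apply, he, real_inner_smul_left,
      real_inner_self_eq_norm_sq, ← hσdef]
    have : σ⁻¹ * σ ^ 2 = σ := by field_simp
    rw [this]; exact hbσ
  obtain ⟨κ₁, hκ₁, hgrow⟩ := hu.exists_le_sub huw
  obtain ⟨κ₂, hκ₂, hspeed⟩ := hh.exists_leafEDist_add_smul_le p₀ w₀ t hc1 hw₀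
  obtain ⟨ρ, hρ, -, hchart⟩ := exists_dist_chart_le (n := n) (G p₀) hc1
  -- the set `f^m (W(x, δ))` is a neighborhood of `z` in its leaf
  obtain ⟨Lm, hLm, hLm'⟩ := hinv.symm.exists_leafEDist_iterate_le m
  obtain ⟨δ', hδ', hδ'2⟩ := ENNReal.lt_iff_exists_real_btwn.1 hz
  have hδδ' : δ' < δ := (ENNReal.ofReal_lt_ofReal_iff hδ).1 hδ'2.2
  obtain ⟨κ₃, hκ₃, hκ₃'⟩ := exists_pos_mul_lt (sub_pos.2 hδδ') (Lm * C)
  have hp₀a := Metric.mem_closedBall_self (x := p₀) ha.le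
  have hnear : ∀ p ∈ Metric.ball p₀ (min κ₃ a), f.symm^[m] (H p) ∈ F.ball x δ := by
    intro p hp
    have hpd : dist p₀ p < κ₃ := by
      rw [dist_comm]; exact lt_of_lt_of_le hp (min_le_left _ _)
    have h1 : F.leafEDist (f.symm^[m] (H p₀)) (f.symm^[m] (H p)) < ENNReal.ofReal (δ - δ') := by
      refine (hLm' _ _).trans_lt ?_
      have h2 := hH.leafEDist_le p₀ hp₀a p
        (Metric.ball_subset_closedBall ((Metric.ball_subset_ball (min_le_right _ _)) hp))
      refine (mul_le_mul_right h2 _).trans_lt ?_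
      rw [← ENNReal.ofReal_mul (by linarith), ← mul_assoc]
      refine (ENNReal.ofReal_lt_ofReal_iff (by linarith)).2 (lt_of_le_of_lt ?_ hκ₃')
      gcongr
    have h3 := mem_ball_add (mem_ball.2 hδ'2.1) (mem_ball.2 h1)
    rwa [add_sub_cancel] at h3
  set κ := min (min κ₁ κ₂) (min κ₃ a) with hκ
  have hκ0 : 0 < κ := by positivity
  obtain ⟨Lj, hLj, hLj'⟩ := hinv.exists_leafEDist_iterate_le j
  obtain ⟨ε, hε, hε'⟩ := exists_pos_mul_lt
    (show 0 < min (κ / 2) (min r ρ) by positivity) (c / b * ‖w₀‖ + C * Lj + 1)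
  have hC0 : 0 < C := by linarith
  have hLj0 : 0 < Lj := by linarith
  have hA1 : 0 ≤ c / b * ‖w₀‖ * ε := by positivity
  have hA2 : 0 ≤ C * Lj * ε := by positivity
  have hA3 : Lj * ε ≤ C * Lj * ε := by
    rw [mul_assoc]; exact le_mul_of_one_le_left (by positivity) hC
  have hε1 : c / b * ‖w₀‖ * ε < κ / 2 := by
    have := hε'.trans_le (min_le_left _ _); linarith
  have hε2 : C * (Lj * ε) < κ / 2 := by
    have := hε'.trans_le (min_le_left _ _); linarith
  have hε3 : Lj * ε < r := by
    have := hε'.trans_le ((min_le_right _ _).trans (min_le_left _ _)); linarith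
  have hε4 : ε < ρ := by
    have := hε'.trans_le ((min_le_right _ _).trans (min_le_right _ _)); linarith
  set E : Set M := {y | f.symm^[m] y ∈ F.ball x δ ∧
    ∀ p ∈ Metric.ball p₀ (κ / 2), H p = y → c * ε ≤ |u p|} with hE
  have himage : ∀ y, y ∈ f^[m] '' F.ball x δ ↔ f.symm^[m] y ∈ F.ball x δ := fun y =>
    ⟨by rintro ⟨y, hy, rfl⟩; rwa [f.leftInverse_iterate], fun hy => ⟨_, hy, f.rightInverse_iterate _ _⟩⟩
  have hspan := hN m hm ε hε E (fun y hy => (himage y).2 hy.1) ?_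
  · -- no point of the image of the net is close to the preimage of `z`
    obtain ⟨e', he', hze⟩ := mem_iUnion₂.1 (hspan.2 hz)
    obtain ⟨y, hy, rfl⟩ := he'
    have h1 := hze (m - j) (by omega)
    have h2 : ∀ y, f^[m - j] (f.symm^[m] y) = f.symm^[j] y := fun y => by
      conv_lhs => rw [show m = (m - j) + j by omega, Nat.add_sub_cancel, Function.iterate_add_apply]
      exact f.rightInverse_iterate _ _
    rw [h2, h2] at h1
    have h3 : F.leafEDist (H p₀) y < ENNReal.ofReal (Lj * ε) := by
      have := hLj' (f.symm^[j] y) (f.symm^[j] (H p₀))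
      rw [f.rightInverse_iterate, f.rightInverse_iterate] at this
      rw [leafEDist_comm]
      refine this.trans_lt ?_
      rw [ENNReal.ofReal_mul (by linarith)]
      exact ENNReal.mul_lt_mul_right (by simpa using hLj0) ENNReal.ofReal_ne_top h1
    obtain ⟨q, hq, rfl⟩ := hH.exists_eq y (h3.trans_le (ENNReal.ofReal_le_ofReal hε3.le))
    have h4 : q ∈ Metric.ball p₀ (κ / 2) := by
      rw [Metric.mem_ball, dist_comm]
      have h5 := hH.dist_le p₀ hp₀a q hq
      have h6 := F.dist_lt_of_leafEDist_lt h3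
      nlinarith
    have h5 := hy.2 q h4 rfl
    have h6 : dist (G q) (G p₀) < ε := F.dist_lt_of_leafEDist_lt h1
    have h7 := (hchart (G q) (by rw [Metric.mem_ball]; linarith) (G p₀)
      (Metric.mem_ball_self hρ)).1
    rw [map_sub] at h7
    have h8 := abs_real_inner_le_norm e (χ q - χ p₀)
    rw [hen, one_mul] at h8
    have h9 : |u q| ≤ c * dist (G q) (G p₀) := h8.trans h7
    nlinarith
  · -- the net
    intro y hy
    rw [himage] at hy
    by_cases hyE : y ∈ E
    · exact mem_iUnion₂.2 ⟨y, hyE, F.mem_ball_self y hε⟩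
    simp only [hE, mem_ofPred_eq, not_and, not_forall, not_le] at hyE
    obtain ⟨p, hp, rfl, hup⟩ := hyE hy
    set s := c * ε / b with hs
    have hs0 : 0 < s := by positivity
    have hcs : c * s < ε := by
      rw [hs, ← mul_div_assoc, div_lt_iff₀ hb0]
      nlinarith
    have hbs : b * s = c * ε := by rw [hs]; field_simp
    have hsw : s * ‖w₀‖ < κ / 2 := by
      have : s * ‖w₀‖ = c / b * ‖w₀‖ * ε := by rw [hs]; ring
      rw [this]; exact hε1
    have hmove : ∀ p', ‖p' - p‖ = s * ‖w₀‖ → p' ∈ Metric.ball p₀ κ := by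
      intro p' hp'
      rw [Metric.mem_ball]
      have h1 := dist_triangle p' p p₀
      have h2 : dist p p₀ < κ / 2 := hp
      rw [dist_eq_norm p' p, hp'] at h1
      linarith
    have hEmem : ∀ p' ∈ Metric.ball p₀ κ, c * ε ≤ |u p'| → H p' ∈ E := by
      intro p' hp' hup'
      refine ⟨hnear p' (Metric.ball_subset_ball (min_le_right _ _) hp'), fun q _ hq => ?_⟩
      rw [hH.injective hq]
      exact hup'
    have hpκ : p ∈ Metric.ball p₀ κ := Metric.ball_subset_ball (by linarith) hp
    have hκ1 : Metric.ball p₀ κ ⊆ Metric.ball p₀ κ₁ :=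
      Metric.ball_subset_ball ((min_le_left _ _).trans (min_le_left _ _))
    have hκ2 : Metric.ball p₀ κ ⊆ Metric.ball p₀ κ₂ :=
      Metric.ball_subset_ball ((min_le_left _ _).trans (min_le_right _ _))
    rcases le_total 0 (u p) with h0 | h0
    · have hp' := hmove (p + s • w₀) (by
        rw [add_sub_cancel_left, norm_smul, Real.norm_eq_abs, abs_of_pos hs0])
      have h1 := hgrow p (hκ1 hpκ) s hs0.le (hκ1 hp')
      refine mem_iUnion₂.2 ⟨H (p + s • w₀), hEmem _ hp' ?_, ?_⟩
      · exact le_trans (by linarith) (le_abs_self _)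
      · rw [F.mem_ball_comm]
        exact (hspeed p (hκ2 hpκ) s hs0.le (hκ2 hp')).trans_lt
          ((ENNReal.ofReal_lt_ofReal_iff hε).2 hcs)
    · have hp' := hmove (p - s • w₀) (by
        rw [sub_sub_cancel_left, norm_neg, norm_smul, Real.norm_eq_abs, abs_of_pos hs0])
      have h1 := hgrow (p - s • w₀) (hκ1 hp') s hs0.le (by rw [sub_add_cancel]; exact hκ1 hpκ)
      have h2 := hspeed (p - s • w₀) (hκ2 hp') s hs0.le (by rw [sub_add_cancel]; exact hκ2 hpκ)
      rw [sub_add_cancel] at h1 h2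
      refine mem_iUnion₂.2 ⟨H (p - s • w₀), hEmem _ hp' ?_, ?_⟩
      · exact le_trans (by linarith) (neg_le_abs _)
      · exact h2.trans_lt ((ENNReal.ofReal_lt_ofReal_iff hε).2 hcs)

/-- Backward iterates are uniformly bounded on the tangent spaces of the unstable foliation. -/
lemma ConditionC1.exists_norm_mfderiv_symm_le [MeasurableSpace M] {l : ℕ} {Wu : Foliation n k M}
    {Wcs : Foliation n l M} (h : ConditionC1 f Wu Wcs) :
    Wu.IsInvariant f ∧ ∃ C : ℝ, 1 ≤ C ∧ ∀ x, ∀ δ > 0, ∃ N : ℕ, ∀ m ≥ N, ∀ j ≤ m, ∀ z,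
      f.symm^[m] z ∈ Wu.ball x δ → ∀ v ∈ Wu.tangent z,
        ‖mfderiv (𝓡 n) (𝓡 n) f.symm^[j] z v‖ ≤ C * ‖v‖ := by
  rcases h with ⟨Es, Ec, Eu, hph, hinv, hEu, -⟩ | ⟨-, hexp, -⟩
  · obtain ⟨C, hC, h⟩ := hph.exists_norm_mfderiv_symm_le
    exact ⟨hinv, C, hC, fun x δ _ => ⟨0, fun m _ j _ z _ v hv => h j z v (hEu z ▸ hv)⟩⟩
  · refine ⟨hexp.1, 1, le_rfl, fun x δ hδ => ?_⟩
    simpa only [one_mul] using hexp.exists_norm_mfderiv_symm_le x hδ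

end ExpandingFoliations

/-! ### Pressure along the unstable foliation -/

namespace Foliation

section PressureOn

variable {n k : ℕ} {M : Type*} [MetricSpace M] [ChartedSpace (EuclideanSpace ℝ (Fin n)) M]
  [IsManifold (𝓡 n) ∞ M] (F : Foliation n k M)
  [RiemannianBundle (fun x : M => TangentSpace (𝓡 n) x)]

/-- The variant of `Foliation.spanningSum` in which the centers of the Bowen balls covering `K` do
not have to be in `K`. -/
noncomputable def coverSum (f : M → M) (φ : M → ℝ) (K : Set M) (m : ℕ) (ε : ℝ) : ℝ≥0∞ :=
  ⨅ (E : Set M) (_ : K ⊆ ⋃ z ∈ E, F.bowenBall f z m ε),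
    ∑' z : E, ENNReal.ofReal (Real.exp (birkhoffSum f φ m z))

variable {F}

lemma coverSum_le_spanningSum (f : M → M) (φ : M → ℝ) (K : Set M) (m : ℕ) (ε : ℝ) :
    F.coverSum f φ K m ε ≤ F.spanningSum f φ K m ε :=
  le_iInf₂ fun E hE => iInf₂_le E hE.2

lemma coverSum_le_mul {f : M → M} {φ : M → ℝ} {B : ℝ} (hB : ∀ x, |φ x| ≤ B) (K : Set M) (m i : ℕ)
    (ε : ℝ) : F.coverSum f φ K m ε ≤
      ENNReal.ofReal (Real.exp (i * B)) * F.coverSum f φ K (m + i) ε := by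
  rw [mul_comm, ← ENNReal.div_le_iff_le_mul (.inl (ofReal_exp_ne_zero _)) (.inl ENNReal.ofReal_ne_top)]
  refine le_iInf₂ fun E hE => ENNReal.div_le_of_le_mul ?_
  refine (iInf₂_le E fun y hy => ?_).trans ?_
  · obtain ⟨z, hz, hzy⟩ := mem_iUnion₂.1 (hE hy)
    exact mem_iUnion₂.2 ⟨z, hz, fun j hj => hzy j (by omega)⟩
  · rw [← ENNReal.tsum_mul_right]
    refine ENNReal.tsum_le_tsum fun z => ?_
    rw [← ofReal_exp_add]
    exact ofReal_exp_le (birkhoffSum_add_le hB m i z)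

variable [IsContMDiffRiemannianBundle (𝓡 n) ∞ (EuclideanSpace ℝ (Fin n))
      (fun x : M => TangentSpace (𝓡 n) x)]
  [IsRiemannianManifold (𝓡 n) M] [CompactSpace M]
  {f : M ≃ₘ^1⟮𝓡 n, 𝓡 n⟯ M} {φ : M → ℝ}

/-- Points of a small piece of leaf which are close for the Bowen metric of `M` are close for the
Bowen metric of the leaf. -/
lemma IsInvariant.exists_mem_bowenBall (hF : F.IsInvariant f) {ε : ℝ} (hε : 0 < ε) :
    ∃ η > 0, ∀ (m : ℕ) (y w : M), F.leafEDist y w < ENNReal.ofReal η →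
      (∀ j < m, dist (f^[j] y) (f^[j] w) < η) → w ∈ F.bowenBall f y m ε := by
  obtain ⟨r, hr, C, hC, hrC⟩ := F.exists_leafEDist_le_dist
  obtain ⟨L, hL, hfL⟩ := hF.exists_leafEDist_le
  have hC0 : 0 < C := by linarith
  have hL0 : 0 < L := by linarith
  set ε₁ := min ε (r / L)
  have hε₁ : 0 < ε₁ := by positivity
  refine ⟨ε₁ / C, by positivity, fun m y w hyw hd => ?_⟩
  have key : ∀ j < m, F.leafEDist (f^[j] y) (f^[j] w) < ENNReal.ofReal ε₁ := by
    intro j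
    induction j with
    | zero =>
      exact fun _ => hyw.trans_le (ENNReal.ofReal_le_ofReal (div_le_self hε₁.le hC))
    | succ j ih =>
      intro hj
      have h1 := ih (by omega)
      have h2 : F.leafEDist (f^[j + 1] y) (f^[j + 1] w) < ENNReal.ofReal r := by
        rw [Function.iterate_succ_apply', Function.iterate_succ_apply']
        refine (hfL _ _).trans_lt ?_
        calc ENNReal.ofReal L * F.leafEDist (f^[j] y) (f^[j] w)
            < ENNReal.ofReal L * ENNReal.ofReal ε₁ :=
              ENNReal.mul_lt_mul_right (by simpa using hL0) ENNReal.ofReal_ne_top h1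
          _ = ENNReal.ofReal (L * ε₁) := (ENNReal.ofReal_mul hL0.le).symm
          _ ≤ ENNReal.ofReal r := ENNReal.ofReal_le_ofReal (by
              calc L * ε₁ ≤ L * (r / L) := by gcongr; exact min_le_right _ _
                _ = r := by field_simp)
      refine (hrC _ _ h2).trans_lt ((ENNReal.ofReal_lt_ofReal_iff hε₁).2 ?_)
      have h3 := hd (j + 1) hj
      rw [lt_div_iff₀ hC0] at h3
      linarith
  exact fun j hj => (key j hj).trans_le (ENNReal.ofReal_le_ofReal (min_le_left _ _))

/-- The pressure along a leaf is at most the topological pressure. -/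
lemma IsInvariant.eventually_spanningSum_le (hF : F.IsInvariant f) (hφ : Continuous φ) {c : ℝ}
    (hc : topPressure f φ < c) (x : M) (δ : ℝ) {ε : ℝ} (hε : 0 < ε) :
    ∀ᶠ m : ℕ in atTop, F.spanningSum f φ (closure (F.ball x δ)) m ε ≤
      ENNReal.ofReal (Real.exp (c * m)) := by
  obtain ⟨c₂, hc₂, hc₂c⟩ := EReal.lt_iff_exists_real_btwn.1 hc
  rw [EReal.coe_lt_coe_iff] at hc₂c
  obtain ⟨c₁, hc₂₁, hc₁c⟩ := exists_between hc₂c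
  set τ := c₁ - c₂
  have hτ : 0 < τ := sub_pos.2 hc₂₁
  obtain ⟨ε₁, hε₁, hmod⟩ := exists_modulus hφ hτ
  obtain ⟨η, hη, hbow⟩ := hF.exists_mem_bowenBall hε
  obtain ⟨t, ht, hcov⟩ := F.exists_finite_ball_cover x (δ + 1) (half_pos hη)
  set K := closure (F.ball x δ)
  have hKt : K ⊆ ⋃ z ∈ t, F.ball z (η / 2) := (F.closure_ball_subset x (by linarith)).trans hcov
  set ε' := min ε₁ (η / 2)
  have hε' : 0 < ε' := by positivity
  have : Fintype t := ht.fintype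
  refine eventually_le_of_le_mul (D := (Fintype.card t : ℝ)) hc₁c
    (b := fun m : ℕ => ENNReal.ofReal (Real.exp (τ * m)) * _root_.spanningSum f φ m ε') ?_ ?_
  · filter_upwards [_root_.eventually_spanningSum_le hc₂ hε'] with m hm
    calc ENNReal.ofReal (Real.exp (τ * m)) * _root_.spanningSum f φ m ε'
        ≤ ENNReal.ofReal (Real.exp (τ * m)) * ENNReal.ofReal (Real.exp (c₂ * m)) := by gcongr
      _ = ENNReal.ofReal (Real.exp (c₁ * m)) := by
        rw [← ofReal_exp_add]; congr 2; simp only [τ]; ring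
  refine Eventually.of_forall fun m => ?_
  rcases isEmpty_or_nonempty t with hemp | hne
  · -- without leaf balls in the cover, `K` is empty
    have hK0 : K = ∅ := by
      refine eq_empty_of_subset_empty (hKt.trans ?_)
      simp [isEmpty_coe_sort.1 hemp]
    refine le_trans (iInf₂_le ∅ ⟨empty_subset _, by simp [hK0]⟩) ?_
    simp
  have hcard : ENNReal.ofReal (Fintype.card t : ℝ) ≠ 0 :=
    (ENNReal.ofReal_pos.2 (by exact_mod_cast Fintype.card_pos)).ne'
  rw [← mul_assoc, mul_comm, ← ENNReal.div_le_iff_le_mul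
    (.inl (mul_ne_zero hcard (ofReal_exp_ne_zero _)))
    (.inl (ENNReal.mul_ne_top ENNReal.ofReal_ne_top ENNReal.ofReal_ne_top))]
  refine le_iInf₂ fun E hE => ENNReal.div_le_of_le_mul ?_
  let A : E × t → Set M := fun q =>
    {y | y ∈ K ∧ (∀ j < m, dist (f^[j] q.1) (f^[j] y) < ε') ∧ y ∈ F.ball q.2 (η / 2)}
  let g : {q | (A q).Nonempty} → M := fun q => q.2.some
  have hg : ∀ q : {q | (A q).Nonempty}, g q ∈ A q := fun q => q.2.some_mem
  have hspan : F.IsSpanning f m ε K (range g) := by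
    refine ⟨?_, fun y hy => ?_⟩
    · rintro _ ⟨q, rfl⟩
      exact (hg q).1
    · obtain ⟨e, he, hey⟩ := hE y
      obtain ⟨z, hz, hzy⟩ := mem_iUnion₂.1 (hKt hy)
      let q : {q | (A q).Nonempty} := ⟨(⟨e, he⟩, ⟨z, hz⟩), y, hy, hey, hzy⟩
      refine mem_iUnion₂.2 ⟨g q, mem_range_self q, hbow m _ _ ?_ fun j hj => ?_⟩
      · have h1 := mem_ball_add (F.mem_ball_comm.1 (hg q).2.2) hzy
        rwa [add_halves] at h1
      · have h1 := (hg q).2.1 j hj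
        have h2 := hey j hj
        have h3 := dist_triangle_left (f^[j] (g q)) (f^[j] y) (f^[j] e)
        have h4 : ε' ≤ η / 2 := min_le_right _ _
        have h5 : dist (f^[j] e) (f^[j] (g q)) < ε' := h1
        linarith
  refine (iInf₂_le (range g) hspan).trans ?_
  · refine (tsum_range_le g fun y => ENNReal.ofReal (Real.exp (birkhoffSum f φ m y))).trans ?_
    have h1 : ∀ q : {q | (A q).Nonempty}, ENNReal.ofReal (Real.exp (birkhoffSum f φ m (g q))) ≤
        (fun q : E × t => ENNReal.ofReal (Real.exp (τ * m)) *
          ENNReal.ofReal (Real.exp (birkhoffSum f φ m q.1))) q := fun q => by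
      simp only
      rw [← ofReal_exp_add, add_comm]
      refine ofReal_exp_le (birkhoffSum_le_add fun j hj => hmod _ _ ?_)
      rw [dist_comm]
      exact ((hg q).2.1 j hj).trans_le (min_le_left _ _)
    have h2 : ∑' q : {q | (A q).Nonempty}, (fun q : E × t => ENNReal.ofReal (Real.exp (τ * m)) *
          ENNReal.ofReal (Real.exp (birkhoffSum f φ m q.1))) q ≤ ∑' q : E × t, _ :=
      ENNReal.tsum_comp_le_tsum_of_injective (f := Subtype.val) Subtype.val_injective
        (fun q : E × t => ENNReal.ofReal (Real.exp (τ * m)) *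
          ENNReal.ofReal (Real.exp (birkhoffSum f φ m q.1)))
    refine ((ENNReal.tsum_le_tsum h1).trans h2).trans ?_
    refine (ENNReal.tsum_prod (f := fun (e : E) (_ : t) => ENNReal.ofReal (Real.exp (τ * m)) *
      ENNReal.ofReal (Real.exp (birkhoffSum f φ m e)))).trans_le ?_
    simp only [tsum_fintype, Finset.sum_const, Finset.card_univ, nsmul_eq_mul]
    rw [ENNReal.tsum_mul_left, ENNReal.tsum_mul_left, ENNReal.ofReal_natCast]
    rw [mul_comm (∑' _, _), mul_assoc]

omit [IsContMDiffRiemannianBundle (𝓡 n) ∞ (EuclideanSpace ℝ (Fin n))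
      (fun x : M => TangentSpace (𝓡 n) x)] [IsRiemannianManifold (𝓡 n) M] [CompactSpace M] in
/-- Points at leaf distance at most `ε / g^ε(m)` stay at distance at most `ε` up to time `m`.
In condition (C2) this is only asserted inside the balls of radius `r`; but for `ε < r`, if
`r ≤ ε / g^ε(0)`, leaves do not have points at distance `r`. -/
lemma _root_.ConditionC2.exists_leafEDist_le {l : ℕ} {Wcs : Foliation n l M} {g : ℝ → ℕ → ℝ}
    (h : ConditionC2 f Wcs g) : ∃ r > 0, ∀ ε > 0, ε < r → ∀ (m : ℕ) (y z : M),
      z ∈ Wcs.ball y (ε * (g ε m)⁻¹) → ∀ j ≤ m,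
        Wcs.leafEDist (f^[j] y) (f^[j] z) ≤ ENNReal.ofReal ε := by
  obtain ⟨r, hr, h⟩ := h
  refine ⟨r, hr, fun ε hε hεr m y z hz j hj => ?_⟩
  obtain ⟨hg0, hgm, -, hC⟩ := h ε hε
  have hmono : ∀ i ≤ m, ENNReal.ofReal (ε * (g ε m)⁻¹) ≤ ENNReal.ofReal (ε * (g ε i)⁻¹) :=
    fun i hi => ENNReal.ofReal_le_ofReal (by
      have := hgm hi
      have := hg0 i
      gcongr)
  refine hC j y z ?_ (hz.le.trans (hmono j hj))
  by_contra hcon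
  rw [mem_ball, not_lt] at hcon
  have hfin : Wcs.leafEDist y z ≠ ⊤ := (mem_ball.1 hz).ne_top
  have hεD : ENNReal.ofReal ε < Wcs.leafEDist y z :=
    ((ENNReal.ofReal_lt_ofReal_iff hr).2 hεr).trans_le hcon
  have hlt : Wcs.leafEDist y z < ENNReal.ofReal r + (Wcs.leafEDist y z - ENNReal.ofReal ε) := by
    calc Wcs.leafEDist y z = ENNReal.ofReal ε + (Wcs.leafEDist y z - ENNReal.ofReal ε) :=
          (add_tsub_cancel_of_le hεD.le).symm
      _ < _ := by
        refine ENNReal.add_lt_add_right (ne_top_of_le_ne_top hfin tsub_le_self) ?_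
        exact (ENNReal.ofReal_lt_ofReal_iff hr).2 hεr
  obtain ⟨w, hw1, hw2⟩ := Wcs.exists_leafEDist_lt_lt (by simpa using hr) (tsub_pos_of_lt hεD) hlt
  have h1 := hC 0 y w hw1 ((hw1.le.trans hcon).trans (hz.le.trans (hmono 0 (Nat.zero_le m))))
  refine lt_irrefl (Wcs.leafEDist y z) ?_
  calc Wcs.leafEDist y z ≤ Wcs.leafEDist y w + Wcs.leafEDist w z := Wcs.leafEDist_triangle
    _ < ENNReal.ofReal ε + (Wcs.leafEDist y z - ENNReal.ofReal ε) :=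
        ENNReal.add_lt_add_of_le_of_lt (ne_top_of_le_ne_top ENNReal.ofReal_ne_top h1) h1 hw2
    _ = _ := add_tsub_cancel_of_le hεD.le

omit [IsContMDiffRiemannianBundle (𝓡 n) ∞ (EuclideanSpace ℝ (Fin n))
      (fun x : M => TangentSpace (𝓡 n) x)] in
/-- The pressure along a leaf is at least the topological pressure: up to a shadowing along `Wcs`
every orbit is an orbit of a point of `f^h (W(x, δ))` where `h` is negligible. -/
lemma eventually_le_coverSum {l : ℕ} {Wcs : Foliation n l M} {g : ℝ → ℕ → ℝ}
    (hC2 : ConditionC2 f Wcs g) (hC3 : ConditionC3 f F Wcs g) (hφ : Continuous φ) {c : ℝ}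
    (hc : c < topPressure f φ) (x : M) {δ : ℝ} (hδ : 0 < δ) :
    ∃ ε > 0, ∀ᶠ m : ℕ in atTop, ENNReal.ofReal (Real.exp (c * m)) ≤
      F.coverSum f φ (closure (F.ball x δ)) m ε := by
  set K := closure (F.ball x δ)
  obtain ⟨c₁, hc₁, hc₁P⟩ := EReal.lt_iff_exists_real_btwn.1 hc
  rw [EReal.coe_lt_coe_iff] at hc₁
  obtain ⟨ε₀, hε₀, hsp⟩ := exists_le_spanningSum hφ hc₁P
  obtain ⟨B, hB0, hB⟩ := exists_abs_le_of_continuous hφ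
  obtain ⟨r, hr, hC⟩ := hC2.exists_leafEDist_le
  set ε := min (ε₀ / 2) (r / 2)
  have hε : 0 < ε := by positivity
  have hεr : ε < r := (min_le_right _ _).trans_lt (by linarith)
  have hε2 : 2 * ε ≤ ε₀ := by have := min_le_left (ε₀ / 2) (r / 2); linarith
  obtain ⟨h, hh, hh'⟩ := hC3 x δ hδ ε hε
  refine ⟨ε, hε, ?_⟩
  -- comparison with the spanning sums of `M`
  have key : ∀ m : ℕ, _root_.spanningSum f φ m ε₀ ≤
      ENNReal.ofReal (Real.exp (h m * B)) * F.coverSum f φ K (m + h m) ε := by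
    intro m
    rw [mul_comm, ← ENNReal.div_le_iff_le_mul (.inl (ofReal_exp_ne_zero _))
      (.inl ENNReal.ofReal_ne_top)]
    refine le_iInf₂ fun E hE => ENNReal.div_le_of_le_mul ?_
    refine (spanningSum_anti hε2).trans ?_
    refine (iInf₂_le (range fun z : E => f^[h m] z) fun y => ?_).trans ?_
    · obtain ⟨_, ⟨p, hp, rfl⟩, hz⟩ := hh' m y
      obtain ⟨e, he, hep⟩ := mem_iUnion₂.1 (hE hp)
      refine ⟨_, mem_range_self ⟨e, he⟩, fun j hj => ?_⟩
      have h1 := F.dist_lt_of_leafEDist_lt (hep (j + h m) (by omega))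
      rw [Function.iterate_add_apply, Function.iterate_add_apply] at h1
      have h2 := (Wcs.edist_le_leafEDist).trans (hC ε hε hεr m y _ hz j hj.le)
      rw [edist_dist, ENNReal.ofReal_le_ofReal_iff hε.le] at h2
      have h3 := dist_triangle_right (f^[j] (f^[h m] e)) (f^[j] y) (f^[j] (f^[h m] p))
      change dist (f^[j] (f^[h m] e)) (f^[j] y) < _
      linarith
    · refine (tsum_range_le (fun z : E => f^[h m] z)
        fun y => ENNReal.ofReal (Real.exp (birkhoffSum f φ m y))).trans ?_
      rw [← ENNReal.tsum_mul_right]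
      refine ENNReal.tsum_le_tsum fun z => ?_
      rw [← ofReal_exp_add]
      exact ofReal_exp_le (birkhoffSum_iterate_le hB m (h m) z)
  obtain ⟨τ, hτ, hτ'⟩ := exists_pos_mul_lt (show 0 < min ((c₁ - c) / 2) (1 / 2) by
    have := sub_pos.2 hc₁; positivity) (B + |c₁| + 1)
  have hBc : 0 ≤ B + |c₁| := by positivity
  have hτ1 : τ < 1 / 2 := by
    have := hτ'.trans_le (min_le_right _ _)
    nlinarith
  have hτ2 : (B + |c₁|) * τ ≤ (c₁ - c) / 2 := by
    have := hτ'.trans_le (min_le_left _ _)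
    nlinarith
  have hgood : ∀ᶠ m : ℕ in atTop, (h m : ℝ) ≤ τ * m ∧
      ENNReal.ofReal (Real.exp (c₁ * m)) ≤ _root_.spanningSum f φ m ε₀ := by
    filter_upwards [hh.eventually (gt_mem_nhds hτ), hsp, eventually_gt_atTop 0] with m h1 h2 h3
    refine ⟨?_, h2⟩
    have h3' : (0 : ℝ) < m := by exact_mod_cast h3
    rw [div_lt_iff₀ h3'] at h1
    exact h1.le
  have hfloor : Tendsto (fun N : ℕ => ⌊(1 - τ) * N⌋₊) atTop atTop :=
    tendsto_nat_floor_atTop.comp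
      (tendsto_natCast_atTop_atTop.const_mul_atTop (by linarith))
  have hlarge : ∀ᶠ N : ℕ in atTop, B + |c₁| ≤ (c₁ - c) / 2 * N :=
    (tendsto_natCast_atTop_atTop.const_mul_atTop
      (by have := sub_pos.2 hc₁; positivity)).eventually_ge_atTop _
  filter_upwards [hfloor.eventually hgood, hlarge] with N hN hNl
  set m := ⌊(1 - τ) * N⌋₊
  have hm1 : (m : ℝ) ≤ (1 - τ) * N := Nat.floor_le (mul_nonneg (by linarith) (Nat.cast_nonneg N))
  have hm2 : (1 - τ) * N < m + 1 := Nat.lt_floor_add_one _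
  have hmN : m + h m ≤ N := by
    have : (m + h m : ℝ) ≤ N := by
      have h1 : τ * m ≤ τ * ((1 - τ) * N) := by gcongr
      have h2 : 0 ≤ τ * τ * N := by positivity
      nlinarith [hN.1]
    exact_mod_cast this
  obtain ⟨i, hi⟩ := Nat.exists_eq_add_of_le hmN
  have h1 : ENNReal.ofReal (Real.exp (c₁ * m)) ≤ ENNReal.ofReal (Real.exp ((h m + i : ℝ) * B)) *
      F.coverSum f φ K N ε := by
    refine (hN.2.trans (key m)).trans ?_
    rw [add_mul, ofReal_exp_add, mul_assoc, hi]
    gcongr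
    exact coverSum_le_mul hB K _ i ε
  rw [mul_comm (ENNReal.ofReal _) (F.coverSum _ _ _ _ _), ←
    ENNReal.div_le_iff_le_mul (.inl (ofReal_exp_ne_zero _)) (.inl ENNReal.ofReal_ne_top)] at h1
  refine le_trans ?_ h1
  rw [ENNReal.le_div_iff_mul_le (.inl (ofReal_exp_ne_zero _)) (.inl ENNReal.ofReal_ne_top),
    ← ofReal_exp_add]
  apply ofReal_exp_le
  have hi' : (N : ℝ) = m + h m + i := by exact_mod_cast hi
  have h2 : (h m + i : ℝ) = N - m := by linarith
  rw [h2]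
  have h3 : (N : ℝ) - m ≤ τ * N + 1 := by linarith
  have h4 : 0 ≤ (N : ℝ) - m := by rw [← h2]; positivity
  have h5 : (B + |c₁|) * (N - m) ≤ (B + |c₁|) * (τ * N + 1) := by gcongr
  have h6 : c₁ * (N - m) ≤ |c₁| * (N - m) := by gcongr; exact le_abs_self _
  have h7 : (B + |c₁|) * τ * N ≤ (c₁ - c) / 2 * N := by gcongr
  nlinarith

/-- The pressure of a closed leaf ball is the topological pressure. -/
lemma IsInvariant.pressureOn_eq {l : ℕ} {Wcs : Foliation n l M} {g : ℝ → ℕ → ℝ}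
    (hF : F.IsInvariant f) (hC2 : ConditionC2 f Wcs g) (hC3 : ConditionC3 f F Wcs g)
    (hφ : Continuous φ) (x : M) {δ : ℝ} (hδ : 0 < δ) :
    F.pressureOn f φ (closure (F.ball x δ)) = topPressure f φ := by
  apply le_antisymm
  · refine iSup₂_le fun ε hε => EReal.le_of_forall_lt_iff_le.1 fun c hc => ?_
    exact limsup_log_div_le (hF.eventually_spanningSum_le hφ hc x δ hε)
  · refine EReal.ge_of_forall_gt_iff_ge.1 fun c hc => ?_
    obtain ⟨ε, hε, h⟩ := eventually_le_coverSum hC2 hC3 hφ hc x hδ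
    refine le_trans (le_limsup_log_div (h.mono fun m hm =>
      hm.trans (coverSum_le_spanningSum f φ _ m ε))) (le_iSup₂_of_le ε hε le_rfl)

end PressureOn

end Foliation

/-! ### Growth of the weighted volume of leaf balls -/

lemma eventually_exp_le_of_le_mul {a b : ℕ → ℝ≥0∞} {c c' D : ℝ} (hc : c < c')
    (hb : ∀ᶠ m : ℕ in atTop, ENNReal.ofReal (Real.exp (c' * m)) ≤ b m)
    (hab : ∀ᶠ m : ℕ in atTop, b m ≤ ENNReal.ofReal D * a m) :
    ∀ᶠ m : ℕ in atTop, ENNReal.ofReal (Real.exp (c * m)) ≤ a m := by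
  have h1 : ∀ᶠ m : ℕ in atTop, max D 1 ≤ Real.exp ((c' - c) * m) := by
    refine Tendsto.eventually_ge_atTop ?_ _
    exact Real.tendsto_exp_atTop.comp
      (tendsto_natCast_atTop_atTop.const_mul_atTop (sub_pos.2 hc))
  filter_upwards [h1, hb, hab] with m h1 h2 h3
  have h4 : ENNReal.ofReal (Real.exp ((c' - c) * m)) * ENNReal.ofReal (Real.exp (c * m)) ≤
      ENNReal.ofReal (Real.exp ((c' - c) * m)) * a m := by
    rw [← ofReal_exp_add, ← add_mul, sub_add_cancel]
    refine (h2.trans h3).trans ?_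
    gcongr
    exact (le_max_left _ _).trans h1
  exact (ENNReal.mul_le_mul_iff_right (ofReal_exp_ne_zero _) ENNReal.ofReal_ne_top).1 h4

namespace Foliation

section Integrals

variable {n k : ℕ} {M : Type*} [MetricSpace M] [ChartedSpace (EuclideanSpace ℝ (Fin n)) M]
  [IsManifold (𝓡 n) ∞ M] {F : Foliation n k M}
  [RiemannianBundle (fun x : M => TangentSpace (𝓡 n) x)]

/-- A maximal separated subset for the leaf distance. -/
lemma exists_maximal_separated (F : Foliation n k M) (W : Set M) {s : ℝ} (hs : 0 < s) :
    ∃ E ⊆ W, (∀ z ∈ E, ∀ z' ∈ E, z ≠ z' → z' ∉ F.ball z s) ∧ ∀ y ∈ W, ∃ z ∈ E, y ∈ F.ball z s := by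
  obtain ⟨E, hE⟩ := zorn_subset
    {E | E ⊆ W ∧ E.Pairwise fun z z' => z' ∉ F.ball z s} fun c hc hchain => by
      refine ⟨⋃₀ c, ⟨sUnion_subset fun E hE => (hc hE).1, ?_⟩, fun E hE => subset_sUnion_of_mem hE⟩
      exact (pairwise_sUnion hchain.directedOn).2 fun E hE => (hc hE).2
  refine ⟨E, hE.prop.1, fun z hz z' hz' hne => hE.prop.2 hz hz' hne, fun y hy => ?_⟩
  by_contra! hcon
  have hyE : insert y E ∈ {E | E ⊆ W ∧ E.Pairwise fun z z' => z' ∉ F.ball z s} := by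
    refine ⟨insert_subset hy hE.prop.1, hE.prop.2.insert fun z hz _ => ⟨?_, hcon z hz⟩⟩
    rw [F.mem_ball_comm]
    exact hcon z hz
  exact hcon y (hE.le_of_ge hyE (subset_insert y E) (mem_insert y E)) (F.mem_ball_self y hs)

variable [IsContMDiffRiemannianBundle (𝓡 n) ∞ (EuclideanSpace ℝ (Fin n))
      (fun x : M => TangentSpace (𝓡 n) x)]
  [IsRiemannianManifold (𝓡 n) M] [CompactSpace M] [MeasurableSpace M] [BorelSpace M]
  {f : M ≃ₘ^1⟮𝓡 n, 𝓡 n⟯ M} {φ : M → ℝ}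

/-- The weighted volume of `f^m W(x, δ)` grows no faster than the topological pressure: the
leafwise spanning sums of the ball do not, and the image under `f^m` of a leafwise Bowen ball lies
in a leaf ball of fixed radius, hence has bounded volume. -/
lemma IsInvariant.eventually_lintegral_image_le (hF : F.IsInvariant f) (hφ : Continuous φ) {c : ℝ}
    (hc : topPressure f φ < c) (x : M) (δ : ℝ) :
    ∀ᶠ m : ℕ in atTop, ∫⁻ y in f^[m] '' F.ball x δ,
        ENNReal.ofReal (Real.exp (birkhoffSum f φ m (f.symm^[m] y))) ∂μHE[k] ≤
      ENNReal.ofReal (Real.exp (c * m)) := by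
  obtain ⟨c₂, hc₂, hc₂c⟩ := EReal.lt_iff_exists_real_btwn.1 hc
  rw [EReal.coe_lt_coe_iff] at hc₂c
  obtain ⟨c₁, hc₂₁, hc₁c⟩ := exists_between hc₂c
  set τ := c₁ - c₂
  have hτ : 0 < τ := sub_pos.2 hc₂₁
  obtain ⟨ε₁, hε₁, hmod⟩ := exists_modulus hφ hτ
  obtain ⟨L, hL, hfL⟩ := hF.exists_leafEDist_le
  obtain ⟨r, hr, D, hD, hvol⟩ := F.exists_measure_ball_le
  have hL0 : 0 < L := by linarith
  set ε := min ε₁ (r / L)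
  have hε : 0 < ε := by positivity
  have hLε : L * ε ≤ r := by
    calc L * ε ≤ L * (r / L) := by gcongr; exact min_le_right _ _
      _ = r := by field_simp
  refine eventually_le_of_le_mul (D := D) hc₁c (b := fun m : ℕ =>
    ENNReal.ofReal (Real.exp (τ * m)) * F.spanningSum f φ (closure (F.ball x δ)) m ε) ?_ ?_
  · filter_upwards [hF.eventually_spanningSum_le hφ hc₂ x δ hε] with m hm
    calc ENNReal.ofReal (Real.exp (τ * m)) * F.spanningSum f φ (closure (F.ball x δ)) m ε
        ≤ ENNReal.ofReal (Real.exp (τ * m)) * ENNReal.ofReal (Real.exp (c₂ * m)) := by gcongr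
      _ = ENNReal.ofReal (Real.exp (c₁ * m)) := by
        rw [← ofReal_exp_add]; congr 2; simp only [τ]; ring
  filter_upwards [eventually_gt_atTop 0] with m hm
  have hD0 : ENNReal.ofReal D ≠ 0 := by simpa using hD
  rw [← mul_assoc, mul_comm, ← ENNReal.div_le_iff_le_mul
    (.inl (mul_ne_zero hD0 (ofReal_exp_ne_zero _)))
    (.inl (ENNReal.mul_ne_top ENNReal.ofReal_ne_top ENNReal.ofReal_ne_top))]
  refine le_iInf₂ fun E hE => ENNReal.div_le_of_le_mul ?_
  by_cases hfin : ∑' z : E, ENNReal.ofReal (Real.exp (birkhoffSum f φ m z)) = ⊤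
  · rw [hfin, ENNReal.top_mul (mul_ne_zero hD0 (ofReal_exp_ne_zero _))]
    exact le_top
  have : Countable E := (countable_of_tsum_ne_top
    (ψ := fun z => ENNReal.ofReal (Real.exp (birkhoffSum f φ m z)))
    (fun z => ofReal_exp_ne_zero _) hfin).to_subtype
  have hsub : f^[m] '' F.ball x δ ⊆ ⋃ z : E, f^[m] '' F.bowenBall f z m ε := by
    rintro _ ⟨y, hy, rfl⟩
    obtain ⟨z, hz, hzy⟩ := mem_iUnion₂.1 (hE.2 (subset_closure hy))
    exact mem_iUnion.2 ⟨⟨z, hz⟩, mem_image_of_mem _ hzy⟩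
  refine (lintegral_mono_set hsub).trans ((lintegral_iUnion_le _ _).trans ?_)
  rw [← ENNReal.tsum_mul_right]
  refine ENNReal.tsum_le_tsum fun z => ?_
  have hball : f^[m] '' F.bowenBall f z m ε ⊆ F.ball (f^[m] (z : M)) r := by
    rintro _ ⟨y, hy, rfl⟩
    obtain ⟨i, rfl⟩ := Nat.exists_eq_succ_of_ne_zero hm.ne'
    have h1 := hy i (Nat.lt_succ_self i)
    rw [mem_ball, Nat.succ_eq_add_one, Function.iterate_succ_apply', Function.iterate_succ_apply']
    refine ((hfL _ _).trans_lt (ENNReal.mul_lt_mul_right (by simpa using hL0)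
      ENNReal.ofReal_ne_top h1)).trans_le ?_
    rw [← ENNReal.ofReal_mul hL0.le]
    exact ENNReal.ofReal_le_ofReal hLε
  refine (setLIntegral_mono (g := fun _ => ENNReal.ofReal (Real.exp (birkhoffSum f φ m z + τ * m)))
    measurable_const ?_).trans ?_
  · rintro _ ⟨y, hy, rfl⟩
    rw [f.leftInverse_iterate]
    refine ofReal_exp_le (birkhoffSum_le_add fun j hj => hmod _ _ ?_)
    rw [dist_comm]
    exact (F.dist_lt_of_leafEDist_lt (hy j hj)).trans_le (min_le_left _ _)
  · rw [setLIntegral_const, ofReal_exp_add, mul_assoc, mul_comm (ENNReal.ofReal D)]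
    gcongr
    exact (measure_mono hball).trans (hvol _)

/-- The weighted volume of `f^m W(x, δ)` grows at least as fast as the leafwise cover sums of a
smaller closed ball: a maximal separated set in the image pulls back to a spanning set, because
`f⁻ʲ` expands leaf lengths by at most the factor `C`, and the disjoint balls about its points
have volume bounded below. -/
lemma IsInvariant.eventually_le_lintegral_image (hF : F.IsInvariant f) (hφ : Continuous φ) {c c' : ℝ}
    (hcc' : c < c') {x : M} {δ : ℝ} (hδ : 0 < δ)
    (hcov : ∃ ε > 0, ∀ᶠ m : ℕ in atTop, ENNReal.ofReal (Real.exp (c' * m)) ≤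
      F.coverSum f φ (closure (F.ball x (δ / 4))) m ε)
    {C : ℝ} (hC : 1 ≤ C) {N : ℕ} (hX : ∀ m ≥ N, ∀ j ≤ m, ∀ z, f.symm^[m] z ∈ F.ball x δ →
      ∀ v ∈ F.tangent z, ‖mfderiv (𝓡 n) (𝓡 n) f.symm^[j] z v‖ ≤ C * ‖v‖) :
    ∀ᶠ m : ℕ in atTop, ENNReal.ofReal (Real.exp (c * m)) ≤ ∫⁻ y in f^[m] '' F.ball x δ,
        ENNReal.ofReal (Real.exp (birkhoffSum f φ m (f.symm^[m] y))) ∂μHE[k] := by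
  obtain ⟨ε, hε, hcov⟩ := hcov
  obtain ⟨B, hB0, hB⟩ := exists_abs_le_of_continuous hφ
  have hC0 : 0 < C := by linarith
  set s := min (δ / 2 / C) (ε / 2 / C)
  have hs : 0 < s := by positivity
  have hs1 : C * s ≤ δ / 2 := by
    calc C * s ≤ C * (δ / 2 / C) := by gcongr; exact min_le_left _ _
      _ = δ / 2 := by field_simp
  have hs2 : C * s + C * s ≤ ε := by
    have : C * s ≤ C * (ε / 2 / C) := by gcongr; exact min_le_right _ _
    have h2 : C * (ε / 2 / C) = ε / 2 := by field_simp
    linarith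
  obtain ⟨v, hv, hvol⟩ := F.exists_le_measure_ball (half_pos hs)
  refine eventually_exp_le_of_le_mul (D := Real.exp 1 / v) hcc' hcov ?_
  filter_upwards [eventually_ge_atTop N] with m hm
  obtain ⟨E, hEW, hEsep, hEcov⟩ := F.exists_maximal_separated (f^[m] '' F.ball x (δ / 2)) hs
  have hEx : ∀ z ∈ E, f.symm^[m] z ∈ F.ball x (δ / 2) := fun z hz => by
    obtain ⟨y, hy, rfl⟩ := hEW hz
    rwa [f.leftInverse_iterate]
  have hY : ∀ z ∈ E, ∀ w ∈ F.ball z s, ∀ j ≤ m, f.symm^[j] w ∈ F.ball (f.symm^[j] z) (C * s) :=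
    fun z hz w hw j hj => hF.leafEDist_symm_iterate_lt hC0 (fun j hj => hX m hm j hj) hs1 (hEx z hz)
      hw hj
  -- points of the small balls where the weight is almost minimal
  have hmin : ∀ z : E, ∃ e ∈ F.ball (z : M) (s / 2), ∀ w ∈ F.ball (z : M) (s / 2),
      birkhoffSum f φ m (f.symm^[m] e) ≤ birkhoffSum f φ m (f.symm^[m] w) + 1 := by
    intro z
    have hbdd : BddBelow ((fun w => birkhoffSum f φ m (f.symm^[m] w)) '' F.ball (z : M) (s / 2)) := by
      refine ⟨-(m * B), ?_⟩
      rintro _ ⟨w, -, rfl⟩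
      exact (abs_le.1 (abs_birkhoffSum_le hB m _)).1
    obtain ⟨_, ⟨e, he, rfl⟩, he'⟩ := Real.lt_sInf_add_pos
      (Set.Nonempty.image (fun w => birkhoffSum f φ m (f.symm^[m] w))
        ⟨(z : M), F.mem_ball_self (z : M) (half_pos hs)⟩) one_pos
    refine ⟨e, he, fun w hw => he'.le.trans ?_⟩
    gcongr
    exact csInf_le hbdd (mem_image_of_mem _ hw)
  choose e he hemin using hmin
  have hball : ∀ z : E, F.ball (z : M) (s / 2) ⊆ F.ball z s := fun z => F.ball_mono _ (by linarith)
  calc F.coverSum f φ (closure (F.ball x (δ / 4))) m ε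
      ≤ ∑' z : range fun z : E => f.symm^[m] (e z),
          ENNReal.ofReal (Real.exp (birkhoffSum f φ m z)) := by
        refine iInf₂_le _ fun y hy => ?_
        have hy' := F.closure_ball_subset x (show δ / 4 < δ / 2 by linarith) hy
        obtain ⟨z, hz, hzy⟩ := hEcov _ (mem_image_of_mem _ hy')
        refine mem_iUnion₂.2 ⟨_, mem_range_self ⟨z, hz⟩, fun j hj => ?_⟩
        have h0 : ∀ y, f^[j] (f.symm^[m] y) = f.symm^[m - j] y := fun y => by
          conv_lhs => rw [show m = j + (m - j) by omega, Function.iterate_add_apply]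
          exact f.rightInverse_iterate _ _
        have h1 := hY z hz _ hzy (m - j) (Nat.sub_le _ _)
        have h2 := hY z hz _ (hball ⟨z, hz⟩ (he ⟨z, hz⟩)) (m - j) (Nat.sub_le _ _)
        rw [← h0, ← h0, f.leftInverse_iterate] at h1
        rw [← h0, ← h0] at h2
        exact F.ball_mono _ hs2 (mem_ball_add (F.mem_ball_comm.1 h2) h1)
    _ ≤ ∑' z : E, ENNReal.ofReal (Real.exp (birkhoffSum f φ m (f.symm^[m] (e z)))) :=
        tsum_range_le (fun z : E => f.symm^[m] (e z))
          fun y => ENNReal.ofReal (Real.exp (birkhoffSum f φ m y))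
    _ ≤ ∑' z : E, ENNReal.ofReal (Real.exp 1 / v) * ∫⁻ y in F.ball (z : M) (s / 2),
          ENNReal.ofReal (Real.exp (birkhoffSum f φ m (f.symm^[m] y))) ∂μHE[k] := by
        refine ENNReal.tsum_le_tsum fun z => ?_
        have h1 : ENNReal.ofReal (Real.exp (birkhoffSum f φ m (f.symm^[m] (e z)) - 1)) *
            ENNReal.ofReal v ≤ ∫⁻ y in F.ball (z : M) (s / 2),
              ENNReal.ofReal (Real.exp (birkhoffSum f φ m (f.symm^[m] y))) ∂μHE[k] := by
          refine le_trans ?_ (setLIntegral_mono' (f := fun _ => ENNReal.ofReal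
            (Real.exp (birkhoffSum f φ m (f.symm^[m] (e z)) - 1))) (F.measurableSet_ball _ _)
            fun w hw => ofReal_exp_le (by have := hemin z w hw; linarith))
          rw [setLIntegral_const]
          gcongr
          exact hvol z
        refine le_trans (le_of_eq ?_) (mul_le_mul_right h1 _)
        rw [← ENNReal.ofReal_mul (Real.exp_pos _).le, ← ENNReal.ofReal_mul (by positivity)]
        congr 1
        rw [Real.exp_sub]
        field_simp
    _ ≤ _ := by
        rw [ENNReal.tsum_mul_left]
        gcongr
        rw [ENNReal.tsum_eq_iSup_sum]
        refine iSup_le fun T => ?_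
        rw [← lintegral_biUnion_finset (fun z _ z' _ hzz' => ?_)
          (fun z _ => F.measurableSet_ball _ _)]
        · refine lintegral_mono_set (iUnion₂_subset fun z _ w hw => ?_)
          refine ⟨f.symm^[m] w, ?_, f.rightInverse_iterate _ _⟩
          have h1 := mem_ball_add (hEx z z.2) (hY z z.2 w (hball z hw) m le_rfl)
          exact F.ball_mono _ (by linarith) h1
        · refine disjoint_left.2 fun w hw hw' => hEsep z z.2 z' z'.2 (Subtype.coe_injective.ne hzz') ?_
          have := mem_ball_add hw (F.mem_ball_comm.1 hw')
          rwa [add_halves] at this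

/-- The exponential growth rate of the weighted volume of the images of a leaf ball is the
pressure. -/
lemma tendsto_log_lintegral_image {l : ℕ} {Wcs : Foliation n l M} {g : ℝ → ℕ → ℝ}
    (hC1 : ConditionC1 f F Wcs) (hC2 : ConditionC2 f Wcs g) (hC3 : ConditionC3 f F Wcs g)
    (hφ : Continuous φ) (x : M) {δ : ℝ} (hδ : 0 < δ) :
    Tendsto (fun m : ℕ => ENNReal.log (∫⁻ y in f^[m] '' F.ball x δ,
        ENNReal.ofReal (Real.exp (birkhoffSum f φ m (f.symm^[m] y))) ∂μHE[k]) / (m : EReal))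
      atTop (𝓝 (topPressure f φ)) := by
  obtain ⟨hF, C, hC, hX⟩ := hC1.exists_norm_mfderiv_symm_le
  obtain ⟨N, hN⟩ := hX x δ hδ
  refine tendsto_log_div (fun c hc => hF.eventually_lintegral_image_le hφ hc x δ) fun c hc => ?_
  obtain ⟨c', hcc', hc'⟩ := EReal.lt_iff_exists_real_btwn.1 hc
  exact hF.eventually_le_lintegral_image hφ (EReal.coe_lt_coe_iff.1 hcc') hδ
    (eventually_le_coverSum hC2 hC3 hφ hc' x (by positivity)) hC hN

end Integrals

end Foliation

/-! ### Change of variables along the leaves -/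

section ChangeOfVariables

lemma tendsto_log_div_of_le_mul {a b : ℕ → ℝ≥0∞} {P : EReal} {D : ℝ}
    (ha : Tendsto (fun m : ℕ => ENNReal.log (a m) / (m : EReal)) atTop (𝓝 P))
    (hab : ∀ m, a m ≤ ENNReal.ofReal D * b m) (hba : ∀ m, b m ≤ ENNReal.ofReal D * a m) :
    Tendsto (fun m : ℕ => ENNReal.log (b m) / (m : EReal)) atTop (𝓝 P) := by
  refine tendsto_log_div (fun c hc => ?_) fun c hc => ?_
  · obtain ⟨c', hc', hcc'⟩ := EReal.lt_iff_exists_real_btwn.1 hc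
    exact eventually_le_of_le_mul (EReal.coe_lt_coe_iff.1 hcc')
      (eventually_le_of_limsup_lt (by rwa [ha.limsup_eq])) (Eventually.of_forall hba)
  · obtain ⟨c', hcc', hc'⟩ := EReal.lt_iff_exists_real_btwn.1 hc
    refine eventually_exp_le_of_le_mul (EReal.coe_lt_coe_iff.1 hcc') ?_ (Eventually.of_forall hab)
    filter_upwards [ha.eventually (lt_mem_nhds hc'), eventually_gt_atTop 0] with m hm h0
    exact (le_log_div_iff h0).1 hm.le

variable {n k : ℕ} {M : Type*} [MetricSpace M] [ChartedSpace (EuclideanSpace ℝ (Fin n)) M]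
  [IsManifold (𝓡 n) ∞ M] {F : Foliation n k M} {f : M ≃ₘ^1⟮𝓡 n, 𝓡 n⟯ M}
  [RiemannianBundle (fun x : M => TangentSpace (𝓡 n) x)]

instance finiteDimensional_tangentSpace (x : M) : FiniteDimensional ℝ (TangentSpace (𝓡 n) x) :=
  inferInstanceAs (FiniteDimensional ℝ (EuclideanSpace ℝ (Fin n)))

omit [IsManifold (𝓡 n) ∞ M] in
lemma absDetOn_eq_normDet (g : M → M) (x : M) (V : Submodule ℝ (TangentSpace (𝓡 n) x)) :
    absDetOn g x V = ((mfderiv (𝓡 n) (𝓡 n) g x).toLinearMap.domRestrict V).normDet := by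
  rw [← Real.sqrt_sq (LinearMap.normDet_nonneg
    ((mfderiv (𝓡 n) (𝓡 n) g x).toLinearMap.domRestrict V))]
  have h := LinearMap.normDet_sq_eq_det_gram
    ((mfderiv (𝓡 n) (𝓡 n) g x).toLinearMap.domRestrict V) (stdOrthonormalBasis ℝ V)
  simp only [RCLike.ofReal_real_eq_id, id_eq] at h
  rw [h]
  rfl

omit [IsManifold (𝓡 n) ∞ M] [RiemannianBundle (fun x : M => TangentSpace (𝓡 n) x)] in
lemma Diffeomorph.injective_mfderiv (f : M ≃ₘ^1⟮𝓡 n, 𝓡 n⟯ M) (x : M) :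
    Function.Injective (mfderiv (𝓡 n) (𝓡 n) f x) :=
  Function.LeftInverse.injective (g := mfderiv (𝓡 n) (𝓡 n) f.symm (f x))
    fun v => f.mfderiv_symm_iterate 1 x v

namespace Foliation

lemma absDetOn_tangent_pos (F : Foliation n k M) (f : M ≃ₘ^1⟮𝓡 n, 𝓡 n⟯ M) (y : M) :
    0 < absDetOn f y (F.tangent y) := by
  rw [absDetOn_eq_normDet]
  refine lt_of_le_of_ne (LinearMap.normDet_nonneg _) (Ne.symm fun h => ?_)
  rw [LinearMap.normDet_eq_zero_iff_ker_ne_bot] at h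
  refine h (LinearMap.ker_eq_bot.2 fun v w hvw => ?_)
  exact Subtype.ext (f.injective_mfderiv y hvw)

lemma exp_neg_geometricPotential (F : Foliation n k M) (f : M ≃ₘ^1⟮𝓡 n, 𝓡 n⟯ M) (y : M) :
    Real.exp (-geometricPotential f F y) = absDetOn f y (F.tangent y) := by
  rw [geometricPotential, neg_neg, Real.exp_log (F.absDetOn_tangent_pos f y)]

variable [IsContMDiffRiemannianBundle (𝓡 n) ∞ (EuclideanSpace ℝ (Fin n))
      (fun x : M => TangentSpace (𝓡 n) x)]
  [IsRiemannianManifold (𝓡 n) M] [CompactSpace M]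

/-- A cover of a leaf ball by leaf balls of radii depending on the center has a finite
subcover. -/
lemma exists_finite_cover_of_pos (F : Foliation n k M) {ρ : M → ℝ} (hρ : ∀ y, 0 < ρ y) (x : M)
    (R : ℝ) : ∃ t : Finset M, F.ball x R ⊆ ⋃ y ∈ t, F.ball y (ρ y) := by
  classical
  obtain ⟨C, a, r, hC, ha, hr, hCr, hU⟩ := F.exists_uniformPlaque
  obtain ⟨t, ht, hcov⟩ := F.exists_finite_ball_cover x R hr
  have hloc : ∀ z, ∃ T : Finset M, F.ball z r ⊆ ⋃ y ∈ T, F.ball y (ρ y) := by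
    intro z
    obtain ⟨H, p, rfl, hH⟩ := hU z
    obtain ⟨T, hT, hTcov⟩ := (isCompact_closedBall p a).elim_nhdsWithin_subcover
      (fun q => {q' | H q' ∈ F.ball (H q) (ρ (H q))}) fun q hq => by
        have h1 := hH.continuousOn_leafEDist (H q) q hq
        have h2 : F.leafEDist (H q) (H q) < ENNReal.ofReal (ρ (H q)) :=
          F.mem_ball_self (H q) (hρ _)
        exact h1.eventually (gt_mem_nhds h2)
    refine ⟨T.image H, fun w hw => ?_⟩
    obtain ⟨q, hq, rfl⟩ := hH.exists_eq w hw
    obtain ⟨q', hq', hqq'⟩ := mem_iUnion₂.1 (hTcov hq)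
    exact mem_iUnion₂.2 ⟨H q', Finset.mem_image_of_mem _ hq', hqq'⟩
  choose T hT using hloc
  refine ⟨ht.toFinset.biUnion T, fun w hw => ?_⟩
  obtain ⟨z, hz, hzw⟩ := mem_iUnion₂.1 (hcov hw)
  obtain ⟨y, hy, hyw⟩ := mem_iUnion₂.1 (hT z hzw)
  exact mem_iUnion₂.2 ⟨y, Finset.mem_biUnion.2 ⟨z, ht.mem_toFinset.2 hz, hy⟩, hyw⟩

variable [MeasurableSpace M] [BorelSpace M] {φ : M → ℝ}

/-- To first order, `f` multiplies the volume on leaves by `|det (Df|T_y F)|`. -/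
lemma exists_measure_image_le (F : Foliation n k M) (f : M ≃ₘ^1⟮𝓡 n, 𝓡 n⟯ M) (y : M) {c : ℝ}
    (hc : 1 < c) :
    ∃ ρ > 0, ∀ B ⊆ F.ball y ρ,
      μHE[k] (f '' B) ≤ ENNReal.ofReal c *
        (ENNReal.ofReal (absDetOn f y (F.tangent y)) * μHE[k] B) ∧
      ENNReal.ofReal (absDetOn f y (F.tangent y)) * μHE[k] B ≤
        ENNReal.ofReal c * μHE[k] (f '' B) := by
  set b := Real.sqrt c with hb
  have hb1 : 1 < b := Real.lt_sqrt_of_sq_lt (by simpa using hc)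
  have hb0 : 0 ≤ b := by linarith
  have hbc : ENNReal.ofReal b * ENNReal.ofReal b = ENNReal.ofReal c := by
    rw [← ENNReal.ofReal_mul hb0, Real.mul_self_sqrt (by linarith)]
  obtain ⟨C, a, r, hC, ha, hr, hCr, hU⟩ := F.exists_uniformPlaque
  obtain ⟨H, p, rfl, hH⟩ := hU y
  set G : EuclideanSpace ℝ (Fin k) → M := fun q => f (H q) with hG
  have hGs : ContMDiff (𝓡 k) (𝓡 n) 1 G := f.contMDiff.comp hH.contMDiff
  have hGd : (immDeriv (n := n) G p).toLinearMap =
      (mfderiv (𝓡 n) (𝓡 n) f (H p)).toLinearMap ∘ₗ (immDeriv (n := n) H p).toLinearMap :=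
    congrArg ContinuousLinearMap.toLinearMap (mfderiv_comp p
      ((f.contMDiff (H p)).mdifferentiableAt one_ne_zero)
      ((hH.contMDiff p).mdifferentiableAt one_ne_zero))
  have hGinj : Function.Injective (immDeriv (n := n) G p) := by
    have h1 : Function.Injective (immDeriv (n := n) G p).toLinearMap := by
      rw [hGd]
      exact (f.injective_mfderiv (H p)).comp (hH.injective_immDeriv p)
    exact h1
  have hdet : (immDeriv (n := n) G p).toLinearMap.normDet =
      absDetOn f (H p) (F.tangent (H p)) * (immDeriv (n := n) H p).toLinearMap.normDet := by
    rw [absDetOn_eq_normDet, hH.tangent_eq_range, hGd]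
    exact LinearMap.normDet_comp _ _
  obtain ⟨ρ₁, hρ₁, h₁⟩ := exists_euclideanHausdorffMeasure_immersion_le (n := n) (hH.contMDiff p)
    (hH.injective_immDeriv p) hb1
  obtain ⟨ρ₂, hρ₂, h₂⟩ := exists_euclideanHausdorffMeasure_immersion_le (n := n) (hGs p) hGinj hb1
  have hC0 : 0 < C := by linarith
  refine ⟨min r (min ρ₁ ρ₂ / C), by positivity, fun B hB => ?_⟩
  obtain ⟨S, hS, rfl⟩ : ∃ S ⊆ Metric.ball p (min ρ₁ ρ₂), H '' S = B := by
    refine ⟨H ⁻¹' B ∩ Metric.ball p (min ρ₁ ρ₂), inter_subset_right, ?_⟩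
    refine Subset.antisymm (by rintro _ ⟨q, hq, rfl⟩; exact hq.1) fun z hz => ?_
    obtain ⟨q, hq, rfl⟩ := hH.exists_eq z ((hB hz).trans_le
      (ENNReal.ofReal_le_ofReal (min_le_left _ _)))
    refine mem_image_of_mem H ⟨hz, ?_⟩
    have h3 := F.dist_lt_of_leafEDist_lt (hB hz)
    have h4 := hH.dist_le p (Metric.mem_closedBall_self ha.le) q hq
    have h5 := h3.trans_le (min_le_right _ _)
    rw [lt_div_iff₀ hC0] at h5
    rw [Metric.mem_ball, dist_comm]
    linarith
  have h3 := h₁ S (hS.trans (Metric.ball_subset_ball (min_le_left _ _)))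
  have h4 := h₂ S (hS.trans (Metric.ball_subset_ball (min_le_right _ _)))
  rw [hdet, ENNReal.ofReal_mul (F.absDetOn_tangent_pos f _).le, mul_assoc] at h4
  have himage : f '' (H '' S) = G '' S := image_image _ _ _
  rw [himage]
  set J := ENNReal.ofReal (absDetOn f (H p) (F.tangent (H p)))
  set D := ENNReal.ofReal (immDeriv (n := n) H p).toLinearMap.normDet * volume S
  constructor
  · calc μHE[k] (G '' S) ≤ ENNReal.ofReal b * (J * D) := h4.1
      _ ≤ ENNReal.ofReal b * (J * (ENNReal.ofReal b * μHE[k] (H '' S))) := by gcongr; exact h3.2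
      _ = (ENNReal.ofReal b * ENNReal.ofReal b) * (J * μHE[k] (H '' S)) := by ring
      _ = _ := by rw [hbc]
  · calc J * μHE[k] (H '' S) ≤ J * (ENNReal.ofReal b * D) := by gcongr; exact h3.1
      _ = ENNReal.ofReal b * (J * D) := by ring
      _ ≤ ENNReal.ofReal b * (ENNReal.ofReal b * μHE[k] (G '' S)) := mul_le_mul_right h4.2 _
      _ = _ := by rw [← mul_assoc, hbc]

/-- To first order, `f^m` multiplies the volume on leaves by `exp (- S_m Φ (y))`. -/
lemma IsInvariant.exists_measure_image_iterate_le (hF : F.IsInvariant f) (m : ℕ) (y : M) {κ : ℝ}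
    (hκ : 0 < κ) : ∃ ρ > 0, ∀ B ⊆ F.ball y ρ,
      μHE[k] (f^[m] '' B) ≤ ENNReal.ofReal (Real.exp
        (birkhoffSum f (fun z => -geometricPotential f F z) m y + κ)) * μHE[k] B ∧
      ENNReal.ofReal (Real.exp (birkhoffSum f (fun z => -geometricPotential f F z) m y)) *
        μHE[k] B ≤ ENNReal.ofReal (Real.exp κ) * μHE[k] (f^[m] '' B) := by
  induction m generalizing y κ with
  | zero =>
    refine ⟨1, one_pos, fun B _ => ?_⟩
    have h1 : (1 : ℝ≥0∞) ≤ ENNReal.ofReal (Real.exp κ) := by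
      rw [← ENNReal.ofReal_one]
      exact ENNReal.ofReal_le_ofReal (Real.one_le_exp hκ.le)
    simpa [birkhoffSum_zero] using le_mul_of_one_le_left (zero_le (a := μHE[k] B)) h1
  | succ m ih =>
    obtain ⟨ρ₁, hρ₁, h₁⟩ := ih (f y) (half_pos hκ)
    obtain ⟨ρ₂, hρ₂, h₂⟩ := F.exists_measure_image_le f y
      (c := Real.exp (κ / 2)) (Real.one_lt_exp_iff.2 (half_pos hκ))
    obtain ⟨L, hL, hfL⟩ := hF.exists_leafEDist_le
    have hL0 : 0 < L := by linarith
    refine ⟨min ρ₂ (ρ₁ / L), by positivity, fun B hB => ?_⟩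
    have h3 := h₂ B (hB.trans (F.ball_mono y (min_le_left _ _)))
    have h4 := h₁ (f '' B) (by
      rintro _ ⟨z, hz, rfl⟩
      rw [mem_ball]
      refine ((hfL y z).trans_lt (ENNReal.mul_lt_mul_right (by simpa using hL0)
        ENNReal.ofReal_ne_top (hB hz))).trans_le ?_
      rw [← ENNReal.ofReal_mul hL0.le]
      refine ENNReal.ofReal_le_ofReal ?_
      calc L * min ρ₂ (ρ₁ / L) ≤ L * (ρ₁ / L) := by gcongr; exact min_le_right _ _
        _ = ρ₁ := by field_simp)
    rw [← F.exp_neg_geometricPotential f y] at h3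
    rw [image_image] at h4
    have himage : (fun z => f^[m] (f z)) '' B = f^[m + 1] '' B := rfl
    rw [himage] at h4
    rw [birkhoffSum_succ']
    set s := birkhoffSum f (fun z => -geometricPotential f F z) m (f y)
    set d := -geometricPotential f F y
    constructor
    · refine (h4.1.trans (mul_le_mul_right h3.1 _)).trans_eq ?_
      rw [← mul_assoc, ← mul_assoc, ← ofReal_exp_add, ← ofReal_exp_add]
      congr 3; ring
    · calc ENNReal.ofReal (Real.exp (d + s)) * μHE[k] B
          = ENNReal.ofReal (Real.exp s) * (ENNReal.ofReal (Real.exp d) * μHE[k] B) := by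
            rw [ofReal_exp_add]; ring
        _ ≤ ENNReal.ofReal (Real.exp s) * (ENNReal.ofReal (Real.exp (κ / 2)) * μHE[k] (f '' B)) :=
            mul_le_mul_right h3.2 _
        _ = ENNReal.ofReal (Real.exp (κ / 2)) * (ENNReal.ofReal (Real.exp s) * μHE[k] (f '' B)) := by
            ring
        _ ≤ ENNReal.ofReal (Real.exp (κ / 2)) *
              (ENNReal.ofReal (Real.exp (κ / 2)) * μHE[k] (f^[m + 1] '' B)) :=
            mul_le_mul_right h4.2 _
        _ = ENNReal.ofReal (Real.exp κ) * μHE[k] (f^[m + 1] '' B) := by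
            rw [← mul_assoc, ← ofReal_exp_add, add_halves]

/-- The volume growth of iterates near `y` is locally comparable to the growth at `y`. -/
lemma IsInvariant.exists_birkhoffSum_geometricPotential_le (hF : F.IsInvariant f) (m : ℕ) (y : M) :
    ∃ ρ > 0, ∀ z ∈ F.ball y ρ,
      birkhoffSum f (fun z => -geometricPotential f F z) m y ≤
        birkhoffSum f (fun z => -geometricPotential f F z) m z + 2 ∧
      birkhoffSum f (fun z => -geometricPotential f F z) m z ≤
        birkhoffSum f (fun z => -geometricPotential f F z) m y + 2 := by
  obtain ⟨ρ, hρ, h⟩ := hF.exists_measure_image_iterate_le m y one_pos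
  have hρ2 : 0 < ρ / 2 := by positivity
  refine ⟨ρ / 2, hρ2, fun z hz => ?_⟩
  obtain ⟨ρ', hρ', h'⟩ := hF.exists_measure_image_iterate_le m z one_pos
  have hs : 0 < min ρ' (ρ / 2) := by positivity
  set B := F.ball z (min ρ' (ρ / 2))
  have hBy : B ⊆ F.ball y ρ := fun w hw => by
    have := mem_ball_add hz (F.ball_mono z (min_le_right _ _) hw)
    rwa [add_halves] at this
  have h1 := h B hBy
  have h2 := h' B (F.ball_mono z (min_le_left _ _))
  obtain ⟨v, hv, hvol⟩ := F.exists_le_measure_ball hs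
  have hB0 : μHE[k] B ≠ 0 := ((ENNReal.ofReal_pos.2 hv).trans_le (hvol z)).ne'
  have hBt : μHE[k] B ≠ ⊤ := (F.measure_ball_lt_top z _).ne
  have key : ∀ s t : ℝ, ENNReal.ofReal (Real.exp s) * μHE[k] B ≤
      ENNReal.ofReal (Real.exp t) * μHE[k] B → s ≤ t := fun s t hst => by
    rw [ENNReal.mul_le_mul_iff_left hB0 hBt, ENNReal.ofReal_le_ofReal_iff (Real.exp_pos _).le,
      Real.exp_le_exp] at hst
    exact hst
  constructor
  · refine key _ _ ((h1.2.trans (mul_le_mul_right h2.1 _)).trans_eq ?_)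
    rw [← mul_assoc, ← ofReal_exp_add]
    congr 3; ring
  · refine key _ _ ((h2.2.trans (mul_le_mul_right h1.1 _)).trans_eq ?_)
    rw [← mul_assoc, ← ofReal_exp_add]
    congr 3; ring

omit [IsManifold (𝓡 n) ∞ M] [RiemannianBundle (fun x : M => TangentSpace (𝓡 n) x)]
  [IsContMDiffRiemannianBundle (𝓡 n) ∞ (EuclideanSpace ℝ (Fin n))
      (fun x : M => TangentSpace (𝓡 n) x)]
  [IsRiemannianManifold (𝓡 n) M] in
lemma measurableSet_image_iterate (f : M ≃ₘ^1⟮𝓡 n, 𝓡 n⟯ M) (m : ℕ) {B : Set M}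
    (hB : MeasurableSet B) : MeasurableSet (f^[m] '' B) :=
  hB.image_of_continuousOn_injOn (f.contMDiff_iterate m).continuous.continuousOn
    (f.leftInverse_iterate m).injective.injOn

/-- The two integrals are comparable over small sets, hence over leaf balls. -/
lemma IsInvariant.lintegral_image_comparable (hF : F.IsInvariant f) (hφ : Continuous φ) (m : ℕ)
    (x : M) (δ : ℝ) :
    ∫⁻ y in f^[m] '' F.ball x δ,
        ENNReal.ofReal (Real.exp (birkhoffSum f φ m (f.symm^[m] y))) ∂μHE[k] ≤
      ENNReal.ofReal (Real.exp 6) * ∫⁻ y in F.ball x δ, ENNReal.ofReal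
        (Real.exp (birkhoffSum f (fun z => φ z - geometricPotential f F z) m y)) ∂μHE[k] ∧
    ∫⁻ y in F.ball x δ, ENNReal.ofReal
        (Real.exp (birkhoffSum f (fun z => φ z - geometricPotential f F z) m y)) ∂μHE[k] ≤
      ENNReal.ofReal (Real.exp 6) * ∫⁻ y in f^[m] '' F.ball x δ,
        ENNReal.ofReal (Real.exp (birkhoffSum f φ m (f.symm^[m] y))) ∂μHE[k] := by
  classical
  have hsum : ∀ y, birkhoffSum f (fun z => φ z - geometricPotential f F z) m y =
      birkhoffSum f φ m y + birkhoffSum f (fun z => -geometricPotential f F z) m y := fun y => by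
    simp only [birkhoffSum, ← Finset.sum_add_distrib, sub_eq_add_neg]
  simp only [hsum]
  set T := birkhoffSum f (fun z => -geometricPotential f F z) m
  have hcont : Continuous (birkhoffSum f φ m) :=
    continuous_finsetSum _ fun i _ => hφ.comp (f.contMDiff_iterate i).continuous
  obtain ⟨ε, hε, hmod⟩ := exists_modulus hcont one_pos
  have hloc : ∀ y, ∃ ρ > 0, ∀ B ⊆ F.ball y ρ,
      (∀ z ∈ B, T y ≤ T z + 2 ∧ T z ≤ T y + 2) ∧
      (∀ z ∈ B, birkhoffSum f φ m y ≤ birkhoffSum f φ m z + 1 ∧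
        birkhoffSum f φ m z ≤ birkhoffSum f φ m y + 1) ∧
      μHE[k] (f^[m] '' B) ≤ ENNReal.ofReal (Real.exp (T y + 1)) * μHE[k] B ∧
      ENNReal.ofReal (Real.exp (T y)) * μHE[k] B ≤
        ENNReal.ofReal (Real.exp 1) * μHE[k] (f^[m] '' B) := by
    intro y
    obtain ⟨ρ₁, hρ₁, h₁⟩ := hF.exists_birkhoffSum_geometricPotential_le m y
    obtain ⟨ρ₂, hρ₂, h₂⟩ := hF.exists_measure_image_iterate_le m y one_pos
    refine ⟨min (min ρ₁ ρ₂) ε, by positivity, fun B hB => ⟨fun z hz => h₁ z ?_, fun z hz => ?_,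
      h₂ B (hB.trans (F.ball_mono y ((min_le_left _ _).trans (min_le_right _ _))))⟩⟩
    · exact F.ball_mono y ((min_le_left _ _).trans (min_le_left _ _)) (hB hz)
    · have h3 := F.dist_lt_of_leafEDist_lt (F.ball_mono y (min_le_right _ _) (hB hz))
      exact ⟨hmod _ _ h3, hmod _ _ (dist_comm y z ▸ h3)⟩
  choose ρ hρ hloc using hloc
  have hpiece : ∀ y, ∀ B ⊆ F.ball y (ρ y), MeasurableSet B →
      ∫⁻ y in f^[m] '' B, ENNReal.ofReal (Real.exp (birkhoffSum f φ m (f.symm^[m] y))) ∂μHE[k] ≤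
        ENNReal.ofReal (Real.exp 6) * ∫⁻ y in B, ENNReal.ofReal
          (Real.exp (birkhoffSum f φ m y + T y)) ∂μHE[k] ∧
      ∫⁻ y in B, ENNReal.ofReal (Real.exp (birkhoffSum f φ m y + T y)) ∂μHE[k] ≤
        ENNReal.ofReal (Real.exp 6) * ∫⁻ y in f^[m] '' B,
          ENNReal.ofReal (Real.exp (birkhoffSum f φ m (f.symm^[m] y))) ∂μHE[k] := by
    intro y B hB hBm
    obtain ⟨h1, h2, h3, h4⟩ := hloc y B hB
    rw [← lintegral_const_mul' _ _ ENNReal.ofReal_ne_top,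
      ← lintegral_const_mul' _ _ ENNReal.ofReal_ne_top]
    constructor
    · calc ∫⁻ y in f^[m] '' B, ENNReal.ofReal (Real.exp (birkhoffSum f φ m (f.symm^[m] y))) ∂μHE[k]
          ≤ ∫⁻ _ in f^[m] '' B, ENNReal.ofReal (Real.exp (birkhoffSum f φ m y + 1)) ∂μHE[k] := by
            refine setLIntegral_mono measurable_const ?_
            rintro _ ⟨z, hz, rfl⟩
            rw [f.leftInverse_iterate]
            exact ofReal_exp_le (h2 z hz).2
        _ ≤ ENNReal.ofReal (Real.exp (birkhoffSum f φ m y + 1)) *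
              (ENNReal.ofReal (Real.exp (T y + 1)) * μHE[k] B) := by
            rw [setLIntegral_const]; gcongr
        _ = ∫⁻ _ in B, ENNReal.ofReal (Real.exp (birkhoffSum f φ m y + 1 + (T y + 1))) ∂μHE[k] := by
            rw [setLIntegral_const, ofReal_exp_add (_ + 1) (_ + 1), mul_assoc]
        _ ≤ _ := by
            refine setLIntegral_mono' hBm fun z hz => ?_
            rw [← ofReal_exp_add]
            exact ofReal_exp_le (by linarith [(h1 z hz).1, (h2 z hz).1])
    · calc ∫⁻ y in B, ENNReal.ofReal (Real.exp (birkhoffSum f φ m y + T y)) ∂μHE[k]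
          ≤ ∫⁻ _ in B, ENNReal.ofReal (Real.exp (birkhoffSum f φ m y + 3 + T y)) ∂μHE[k] := by
            refine setLIntegral_mono measurable_const fun z hz => ?_
            exact ofReal_exp_le (by linarith [(h1 z hz).2, (h2 z hz).2])
        _ ≤ ENNReal.ofReal (Real.exp (birkhoffSum f φ m y + 3)) *
              (ENNReal.ofReal (Real.exp 1) * μHE[k] (f^[m] '' B)) := by
            rw [setLIntegral_const, ofReal_exp_add, mul_assoc]
            gcongr
        _ = ∫⁻ _ in f^[m] '' B,
              ENNReal.ofReal (Real.exp (birkhoffSum f φ m y + 3 + 1)) ∂μHE[k] := by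
            rw [setLIntegral_const, ofReal_exp_add _ 1, mul_assoc]
        _ ≤ _ := by
            refine setLIntegral_mono' (measurableSet_image_iterate f m hBm) ?_
            rintro _ ⟨z, hz, rfl⟩
            rw [f.leftInverse_iterate, ← ofReal_exp_add]
            exact ofReal_exp_le (by linarith [(h2 z hz).1])
  -- cut the ball into finitely many disjoint small pieces
  obtain ⟨t, ht⟩ := F.exists_finite_cover_of_pos hρ x δ
  have hall : ∀ (t : Finset M) (B : Set M), MeasurableSet B → B ⊆ ⋃ y ∈ t, F.ball y (ρ y) →
      ∫⁻ y in f^[m] '' B, ENNReal.ofReal (Real.exp (birkhoffSum f φ m (f.symm^[m] y))) ∂μHE[k] ≤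
        ENNReal.ofReal (Real.exp 6) * ∫⁻ y in B, ENNReal.ofReal
          (Real.exp (birkhoffSum f φ m y + T y)) ∂μHE[k] ∧
      ∫⁻ y in B, ENNReal.ofReal (Real.exp (birkhoffSum f φ m y + T y)) ∂μHE[k] ≤
        ENNReal.ofReal (Real.exp 6) * ∫⁻ y in f^[m] '' B,
          ENNReal.ofReal (Real.exp (birkhoffSum f φ m (f.symm^[m] y))) ∂μHE[k] := by
    intro t
    induction t using Finset.induction_on with
    | empty =>
      intro B _ hB
      obtain rfl : B = ∅ := by simpa using hB
      simp
    | insert y t _ ih =>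
      intro B hBm hB
      have hym := F.measurableSet_ball y (ρ y)
      have h1 := hpiece y (B ∩ F.ball y (ρ y)) inter_subset_right (hBm.inter hym)
      have h2 := ih (B \ F.ball y (ρ y)) (hBm.diff hym) fun z hz => by
        have := hB hz.1
        rw [Finset.set_biUnion_insert] at this
        exact this.resolve_left hz.2
      have h3 : ∀ w : M → ℝ≥0∞, ∫⁻ z in B, w z ∂μHE[k] =
          ∫⁻ z in B ∩ F.ball y (ρ y), w z ∂μHE[k] + ∫⁻ z in B \ F.ball y (ρ y), w z ∂μHE[k] :=
        fun w => (lintegral_inter_add_sdiff w B hym).symm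
      have h4 : ∀ w : M → ℝ≥0∞, ∫⁻ z in f^[m] '' B, w z ∂μHE[k] =
          ∫⁻ z in f^[m] '' (B ∩ F.ball y (ρ y)), w z ∂μHE[k] +
            ∫⁻ z in f^[m] '' (B \ F.ball y (ρ y)), w z ∂μHE[k] := fun w => by
        rw [← lintegral_union (measurableSet_image_iterate f m (hBm.diff hym)), ← image_union,
          inter_union_sdiff]
        exact (disjoint_image_iff (f.leftInverse_iterate m).injective).2 disjoint_inf_sdiff
      rw [h3, h4, mul_add, mul_add]
      exact ⟨add_le_add h1.1 h2.1, add_le_add h1.2 h2.2⟩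
  exact hall t _ (F.measurableSet_ball x δ) ht

end Foliation

end ChangeOfVariables

/-- The volume induced by the Riemannian metric on the leaves of the `k`-dimensional foliation `Wu`
is the `k`-dimensional Hausdorff measure `μHE[k]` (normalized to agree with Lebesgue measure). -/
theorem theorem5p1 {n k l : ℕ} {M : Type*} [MetricSpace M] [CompactSpace M]
    [ChartedSpace (EuclideanSpace ℝ (Fin n)) M] [IsManifold (𝓡 n) ∞ M]
    [RiemannianBundle (fun x : M => TangentSpace (𝓡 n) x)]
    [IsContMDiffRiemannianBundle (𝓡 n) ∞ (EuclideanSpace ℝ (Fin n))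
      (fun x : M => TangentSpace (𝓡 n) x)]
    [IsRiemannianManifold (𝓡 n) M] [MeasurableSpace M] [BorelSpace M]
    (f : M ≃ₘ^1⟮𝓡 n, 𝓡 n⟯ M) (Wu : Foliation n k M) (Wcs : Foliation n l M)
    (g : ℝ → ℕ → ℝ)
    (hC1 : ConditionC1 f Wu Wcs) (hC2 : ConditionC2 f Wcs g) (hC3 : ConditionC3 f Wu Wcs g)
    (φ : M → ℝ) (hφ : Continuous φ) (x : M) (δ : ℝ) (hδ : 0 < δ) :
    Tendsto (fun m : ℕ => ENNReal.log (∫⁻ y in f^[m] '' Wu.ball x δ,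
        ENNReal.ofReal (Real.exp (birkhoffSum f φ m (f.symm^[m] y))) ∂μHE[k]) / (m : EReal))
      atTop (𝓝 (topPressure f φ)) ∧
    Tendsto (fun m : ℕ => ENNReal.log (∫⁻ y in Wu.ball x δ,
        ENNReal.ofReal (Real.exp (birkhoffSum f (fun z => φ z - geometricPotential f Wu z) m y))
          ∂μHE[k]) / (m : EReal))
      atTop (𝓝 (topPressure f φ)) ∧
    (∀ ρ > 0, topPressure f φ = Wu.pressure f φ ρ) ∧
    topPressure f φ = Wu.pressureOn f φ (closure (Wu.ball x δ)) := by
  have hF := hC1.exists_norm_mfderiv_symm_le.1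
  have hlim := Foliation.tendsto_log_lintegral_image hC1 hC2 hC3 hφ x hδ
  have hP : ∀ y : M, ∀ ρ > 0, Wu.pressureOn f φ (closure (Wu.ball y ρ)) = topPressure f φ :=
    fun y ρ hρ => hF.pressureOn_eq hC2 hC3 hφ y hρ
  refine ⟨hlim, tendsto_log_div_of_le_mul hlim
    (fun m => (hF.lintegral_image_comparable hφ m x δ).1)
    (fun m => (hF.lintegral_image_comparable hφ m x δ).2), fun ρ hρ => ?_, (hP x δ hδ).symm⟩
  have : Nonempty M := ⟨x⟩
  simp only [Foliation.pressure, hP _ ρ hρ, ciSup_const]
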